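/- **Conventions.** Strings and languages are over $\{0,1\}$. A circuit is a finite directed acyclic graph of gates with a sequence of output gates; its size is the number of gates, its depth the length of a longest path. $\mathrm{AC}$-circuits use input-, not-, and-, or-gates of unbounded fan-in, $\mathrm{NC}$-circuits only those of fan-in at most two, and $\mathrm{TC}$-circuits may in addition use threshold gates ("at least $t$ of the inputs are true"). Write $\ell(n)=\lfloor\log_2 n\rfloor+1$ (and $\ell(0)=1$); this is the "$\log n$" of depth and time bounds. Fix an encoding of circuits as bit strings that lists gate types, wires, gate parameters and output gates. Let $\mathrm{X}\in\{\mathrm{NC},\mathrm{AC},\mathrm{TC}\}$ and $i\ge 0$. * A *dlogtime-uniform family of $\mathrm{X}^i$-circuits* is a family $(C_n)_{n\in\mathbb N}$ of $\mathrm X$-circuits, $C_n$ having $n$ inputs, with depth $O(\ell(n)^i)$ and size and number of outputs polynomial in $n$, for which a deterministic Turing machine on input $\mathrm{bin}(j)\#\mathrm{bin}(n)$ outputs the $j$th bit of the encoding of $C_n$ (which is $0$ beyond the end of the encoding) in $O(\ell(n)+\ell(j))$ steps, thus $O(\ell(n))$ steps for the polynomially many bits of the encoding. Such a family computes a map $K\colon\{0,1\}^*\to\{0,1\}^*$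 if on each input $x$ the outputs of $C_{|x|}$ present $K(x)$, each bit $b$ being written as $1b$ and the remaining outputs being $0$. * A *parameterized problem* is a pair $(Q,\kappa)$ of a language $Q\subseteq\{0,1\}^*$ and a function $\kappa\colon\{0,1\}^*\to\mathbb N$ whose value, in binary, is computed by a dlogtime-uniform family of $\mathrm{AC}^0$-circuits. It is decidable if $Q$ is decidable. * $(Q,\kappa)$ is in *dlogtime-uniform $\mathrm{para}\text{-}\mathrm X^i$* if there are a computable $f\colon\mathbb N\to\mathbb N$, a constant $c$ and single-output $\mathrm X$-circuits $(C_{n,k})_{n,k\in\mathbb N}$, $C_{n,k}$ having $n$ inputs, such that $C_{|x|,\kappa(x)}(x)=1\iff x\in Q$ for all $x$; for all $n,k$ the depth of $C_{n,k}$ is at most $f(k)+c\,\ell(n)^i$ if $i>0$ and at most $c$ if $i=0$, and its size is at most $f(k)\,(n+1)^c$; and a deterministic Turing machine on input $\mathrm{bin}(j)\#\mathrm{bin}(k)\#\mathrm{bin}(n)$ outputs the $j$th bit of the encoding of $C_{n,k}$ in at most $f(k)+c\,(\ell(n)+\ell(j))$ steps. * A *kernelization* of $(Q,\kappa)$ is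 a map $K\colon\{0,1\}^*\to\{0,1\}^*$ for which there is a computable $f\colon\mathbb N\to\mathbb N$ such that, for all $x$, $x\in Q\iff K(x)\in Q$ and $|K(x)|\le f(\kappa(x))$. **Theorem.** Let $i\ge 0$. A decidable parameterized problem is in dlogtime-uniform $\mathrm{para}\text{-}\mathrm{AC}^i$ if and only if it has a kernelization that is computed by a dlogtime-uniform family of $\mathrm{AC}^i$-circuits. The same holds with $\mathrm{TC}^i$ for all $i\ge 0$ and with $\mathrm{NC}^i$ for all $i\ge 1$ in place of $\mathrm{AC}^i$ (the parameterization still being computed by $\mathrm{AC}^0$-circuits). -/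

import Mathlib

namespace ParaCircuit

/-! ### Boolean circuits -/

/-- Gate types of a circuit with `n` input bits and `s` gates. -/
inductive GateKind (n s : ℕ) : Type
  /-- reads the input bit at position `p` -/
  | input (p : Fin n)
  | not
  | and
  | or
  /-- true iff at least `t` of the predecessors are true -/
  | threshold (t : Fin (s + 1))

namespace GateKind

variable {n s : ℕ}

/-- Value of a gate with `fanIn` predecessors, exactly `numTrue` of which are true. -/
def apply (x : Fin n → Bool) (fanIn numTrue : ℕ) : GateKind n s → Bool
  | input p => x p
  | not => decide (numTrue = 0)
  | and => decide (numTrue = fanIn)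
  | or => decide (0 < numTrue)
  | threshold t => decide (t.val ≤ numTrue)

/-- Numerical code of the type of a gate. -/
def code : GateKind n s → ℕ
  | input _ => 0
  | not => 1
  | and => 2
  | or => 3
  | threshold _ => 4

/-- The numerical parameter of a gate (input position or threshold), if it has one. -/
def param? : GateKind n s → Option ℕ
  | input p => some p.val
  | threshold t => some t.val
  | _ => none

end GateKind

/-- A Boolean circuit with `n` input bits: a finite directed acyclic graph of gates with a sequence
of output gates. The fan-in is not bounded. An `and`-gate (`or`-gate) of fan-in `0` is the constant
true (false). -/
structure Circuit (n : ℕ) where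
  /-- number of gates -/
  size : ℕ
  /-- type of each gate -/
  kind : Fin size → GateKind n size
  /-- the gates whose values are fed into a given gate -/
  preds : Fin size → Finset (Fin size)
  acyclic : WellFounded (fun h g => h ∈ preds g)
  input_preds : ∀ g p, kind g = GateKind.input p → preds g = ∅
  not_preds : ∀ g, kind g = GateKind.not → (preds g).card = 1
  /-- number of output bits -/
  numOut : ℕ
  /-- the gate that provides a given output bit -/
  out : Fin numOut → Fin size

namespace Circuit

variable {n : ℕ}

/-- The value of gate `g` on input `x`. -/
noncomputable def val (C : Circuit n) (x : Fin n → Bool) : Fin C.size → Bool :=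
  C.acyclic.fix fun g ih =>
    (C.kind g).apply x (C.preds g).card
      ((C.preds g).attach.filter fun h => ih h.1 h.2 = true).card

theorem val_eq (C : Circuit n) (x : Fin n → Bool) (g : Fin C.size) :
    C.val x g = (C.kind g).apply x (C.preds g).card
      ((C.preds g).filter fun h => C.val x h = true).card := by
  have h1 : C.val x g = (C.kind g).apply x (C.preds g).card
      ((C.preds g).attach.filter fun h => C.val x h.1 = true).card := by
    unfold val
    rw [WellFounded.fix_eq]
  rw [h1]
  congr 1
  rw [Finset.filter_attach (fun h => C.val x h = true) (C.preds g), Finset.card_map,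
    Finset.card_attach]

/-- The sequence of output bits on input `x`. -/
noncomputable def output (C : Circuit n) (x : Fin n → Bool) : List Bool :=
  List.ofFn fun j => C.val x (C.out j)

/-- The length (number of wires) of a longest path ending at gate `g`. -/
noncomputable def gateDepth (C : Circuit n) : Fin C.size → ℕ :=
  C.acyclic.fix fun g ih => (C.preds g).attach.sup fun h => ih h.1 h.2 + 1

theorem gateDepth_eq (C : Circuit n) (g : Fin C.size) :
    C.gateDepth g = (C.preds g).sup fun h => C.gateDepth h + 1 := by
  have h1 : C.gateDepth g = (C.preds g).attach.sup fun h => C.gateDepth h.1 + 1 := by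
    unfold gateDepth
    rw [WellFounded.fix_eq]
  rw [h1, Finset.sup_attach (C.preds g) fun h => C.gateDepth h + 1]

/-- The length of a longest path in the circuit. -/
noncomputable def depth (C : Circuit n) : ℕ :=
  Finset.univ.sup C.gateDepth

end Circuit

/-- The three circuit bases. -/
inductive Basis : Type
  /-- `not`, and `and`, `or` of bounded fan-in (at most two) -/
  | NC
  /-- `not`, and `and`, `or` of unbounded fan-in -/
  | AC
  /-- as `AC`, with threshold gates in addition -/
  | TC

/-- The circuit uses only gates of the basis. -/
def Circuit.Over {n : ℕ} (C : Circuit n) : Basis → Prop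
  | .NC => ∀ g, (∀ t, C.kind g ≠ .threshold t) ∧ (C.preds g).card ≤ 2
  | .AC => ∀ g t, C.kind g ≠ .threshold t
  | .TC => True

/-! ### Encoding of circuits as bit strings -/

/-- Splits the binary digits of a number into those at even and those at odd positions;
a bijection from `ℕ` to `ℕ × ℕ`. -/
def deinterleave (m : ℕ) : ℕ × ℕ :=
  if h : m = 0 then (0, 0)
  else
    let r := deinterleave (m / 4)
    (2 * r.1 + m % 2, 2 * r.2 + m / 2 % 2)
termination_by m
decreasing_by omega

/-- The bit at position `i` of the encoding of a circuit. The encoding consists of four interleaved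
Boolean tables, indexed by pairs `(a, b)`; they say that the type of gate `a` is `b`, that there is
a wire from gate `b` to gate `a`, that the parameter of gate `a` is `b`, and that the output bit `a`
is provided by gate `b`, respectively. All ones stand at positions polynomially bounded in the size
and the number of input and output bits; the string is continued by zeros. -/
def Circuit.bit {n : ℕ} (C : Circuit n) (i : ℕ) : Bool :=
  let a := (deinterleave (i / 4)).1
  let b := (deinterleave (i / 4)).2
  if i % 4 = 0 then decide (∃ g : Fin C.size, g.val = a ∧ (C.kind g).code = b)
  else if i % 4 = 1 then
    decide (∃ g h : Fin C.size, g.val = a ∧ h.val = b ∧ h ∈ C.preds g)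
  else if i % 4 = 2 then decide (∃ g : Fin C.size, g.val = a ∧ (C.kind g).param? = some b)
  else decide (∃ j : Fin C.numOut, j.val = a ∧ (C.out j).val = b)

/-! ### Uniformity -/

/-- The logarithm to base two, rounded down, plus one (so that it is never zero). -/
def lg (n : ℕ) : ℕ := Nat.log 2 n + 1

/-- Strings over `{0, 1, #}`, where `none` is the separator `#`: binary encoding of a number (least
significant digit first). -/
def bin (n : ℕ) : List (Option Bool) := n.bits.map some

/-- A deterministic Turing machine (with several stacks as its memory) with input alphabet
`{0, 1, #}` and output alphabet `{0, 1}`. -/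
abbrev Machine := Turing.TM2ComputableAux (Option Bool) Bool

/-- On input `w` the machine halts after at most `t` steps with the single bit `b` as its output. -/
def Machine.OutputsBit (M : Machine) (w : List (Option Bool)) (b : Bool) (t : ℕ) : Prop :=
  Nonempty (Turing.TM2OutputsInTime M.tm (w.map M.inputAlphabet.symm)
    (some ([b].map M.outputAlphabet.symm)) t)

/-- DLOGTIME-uniformity of a family of circuits: on input `bin(i)#bin(n)` a machine outputs bit `i`
of the encoding of `C n` in `O(log n + log i)` steps. (For positions `i` polynomially bounded in
`n` these are `O(log n)` steps; the term `log i` lets the machine read an oversized `i`.) -/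
def Uniform (C : (n : ℕ) → Circuit n) : Prop :=
  ∃ (M : Machine) (c : ℕ), ∀ i n,
    M.OutputsBit (bin i ++ none :: bin n) ((C n).bit i) (c * (lg n + lg i))

/-- The family `C` is a DLOGTIME-uniform family of `AC^i`-circuits (or `NC^i`- or
`TC^i`-circuits, depending on the basis): depth `O(log^i n)`, polynomial size. -/
def IsUniformFamily (B : Basis) (i : ℕ) (C : (n : ℕ) → Circuit n) : Prop :=
  (∃ c : ℕ, ∀ n, (C n).Over B ∧ (C n).depth ≤ c * lg n ^ i ∧ (C n).size ≤ c * (n + 1) ^ c ∧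
    (C n).numOut ≤ c * (n + 1) ^ c) ∧
  Uniform C

/-! ### Parameterized problems and kernelizations -/

/-- The function `κ` is computed by a DLOGTIME-uniform family of constant-depth, polynomial-size
`AC`-circuits; the output bits are the binary digits of the value, least significant first,
possibly followed by zeros. -/
def IsParameterization (κ : List Bool → ℕ) : Prop :=
  ∃ C : (n : ℕ) → Circuit n, IsUniformFamily .AC 0 C ∧
    ∀ x : List Bool, κ x = Nat.ofDigits 2 (((C x.length).output x.get).map Bool.toNat)

/-- The parameterized problem `(Q, κ)` is in DLOGTIME-uniform `para-AC^i` (or `para-NC^i` or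
`para-TC^i`, depending on the basis). For `i = 0` the depth is constant. -/
def InPara (B : Basis) (i : ℕ) (Q : Language Bool) (κ : List Bool → ℕ) : Prop :=
  ∃ (f : ℕ → ℕ) (c : ℕ) (C : (n k : ℕ) → Circuit n), Computable f ∧
    (∀ x : List Bool, ∃ b : Bool, (C x.length (κ x)).output x.get = [b] ∧ (b = true ↔ x ∈ Q)) ∧
    (∀ n k, (C n k).Over B ∧
      (C n k).depth ≤ (if i = 0 then c else f k + c * lg n ^ i) ∧
      (C n k).size ≤ f k * (n + 1) ^ c ∧ (C n k).numOut = 1) ∧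
    ∃ M : Machine, ∀ j n k,
      M.OutputsBit (bin j ++ none :: bin k ++ none :: bin n) ((C n k).bit j)
        (f k + c * (lg n + lg j))

/-- The map `K` is a kernelization of `(Q, κ)`. -/
def IsKernelization (Q : Language Bool) (κ : List Bool → ℕ) (K : List Bool → List Bool) : Prop :=
  (∀ x, x ∈ Q ↔ K x ∈ Q) ∧ ∃ f : ℕ → ℕ, Computable f ∧ ∀ x, (K x).length ≤ f (κ x)

/-- The output bits `o` of a circuit present the string `y`, whose length may vary while the number
of output bits is fixed: every bit of `y` is preceded by a `1`, and the rest is filled by `0`. -/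
def Presents (o y : List Bool) : Prop :=
  ∃ r : ℕ, o = y.flatMap (fun b => [true, b]) ++ List.replicate r false

/-- The function `K` on strings is computed by a DLOGTIME-uniform family of `AC^i`-circuits (or
`NC^i`- or `TC^i`-circuits, depending on the basis). -/
def ComputedBy (B : Basis) (i : ℕ) (K : List Bool → List Bool) : Prop :=
  ∃ C : (n : ℕ) → Circuit n, IsUniformFamily B i C ∧
    ∀ x : List Bool, Presents ((C x.length).output x.get) (K x)

end ParaCircuit

/-!
The two directions are `exists_kernelization` and `inPara_of_kernelization`.

*From parameterized circuits to a kernelization.* On an input `x` of length `n`, a constant-depth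
circuit computes `w = κ x`. If `f w ≤ log n`, then the circuit `C n w` of the para-family has
polynomial size, depth `O(log^i n)`, and an encoding that is computed in time `O(log n)`. A single
circuit can hence contain copies of all `C n w` of this kind, select the one for `w = κ x`, evaluate
it, and output a fixed instance of the problem with the same answer. If `f w > log n`, then the
length of `x` is bounded by a computable function of `κ x`, and `x` itself is the output. For
uniformity, the condition `f w ≤ log n` has to be decided in time `O(log n)`, which is impossible for
a general computable `f`. It is replaced by the condition that a machine deciding `2 ^ f w ≤ n`
accepts within `O(log n)` steps; this fails only for `n` bounded in terms of `w`
(`exists_recognizer`).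

*From a kernelization to parameterized circuits.* The output of the kernel circuit, read as a number,
is below `4 ^ F k`, where `F k` bounds the length of the kernel for parameter `k`. The circuit
compares this number with all numbers below a bound and accepts if it is equal to one that presents
an element of the problem; as the problem is decidable, this can be found out in time depending on
`k` only (`PB.decode_mem`).

Both directions use the same circuit, `Inspector.net`: it contains a circuit whose output is read as
a number `w`, and for every `w` of a set `good` a circuit `Sub w` that is evaluated if the number is
`w`. `Inspector.value_eq` determines the truth values of its gates. As it needs unbounded fan-in, for
`NC` certain gates are replaced by binary trees (`Net.Marking.narrow`). There are boundedly many of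
these gates on every path, so that the depth grows by `O(log n)` only; this is where `1 ≤ i` is
required.

*Uniformity.* `PT` is the class of functions of several numbers that are computable in time linear
in the lengths of the arguments, up to a computable function of the parameter, and `PB` consists of
the predicates of this kind. Their time is that of programs in a small language over stacks, which
are compiled to machines (`PB.exists_machine₂`, `PB.exists_machine₃`). The class is closed under
composition and case distinction, and contains addition, comparison, access to single bits, the
interleaving of binary digits that is used by the encoding of circuits, computable functions of
numbers bounded in terms of the parameter (`PT.guard`), and the simulation of a machine for a
logarithmic number of steps (`Machine.exists_pb_acceptsIn`), hence also the encodings of the given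
circuits. Circuits are described by tables of numbers (`Net`), and it remains to see that the tables
of the circuits above belong to the class (`Inspector.DataPT.finalNet`).
-/

namespace ParaCircuit

/-! ### A small programming language over stacks -/

/-- Symbols held by the registers of a program: the symbols `0`, `1`, `#` and `q` extra symbols. -/
abbrev Sym (q : ℕ) := Option Bool ⊕ Fin q

/-- The symbol of a bit. -/
abbrev bitS {q : ℕ} (b : Bool) : Sym q := Sum.inl (some b)

/-- The separator symbol. -/
abbrev sepS {q : ℕ} : Sym q := Sum.inl none

/-- Structured programs on registers, each of which holds a stack of symbols. `case r f` branches on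
the top symbol of register `r`, and `loop r p` repeats `p` while register `r` is nonempty. -/
inductive Prog (q : ℕ) : Type
  | skip
  | push (r : ℕ) (a : Sym q)
  | pop (r : ℕ)
  | seq (p₁ p₂ : Prog q)
  | case (r : ℕ) (f : Option (Sym q) → Prog q)
  | loop (r : ℕ) (p : Prog q)

/-- The contents of all registers; the head of a list is the top of the stack. -/
abbrev Store (q : ℕ) := ℕ → List (Sym q)

variable {q : ℕ}

open Function (update)

/-- `Runs p s s' t`: started in store `s` the program `p` halts in store `s'` after exactly `t`
elementary steps. -/
inductive Runs : Prog q → Store q → Store q → ℕ → Prop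
  | skip (s) : Runs .skip s s 1
  | push (s r a) : Runs (.push r a) s (update s r (a :: s r)) 1
  | pop (s r) : Runs (.pop r) s (update s r (s r).tail) 1
  | seq {p₁ p₂ s s₁ s₂ t₁ t₂} : Runs p₁ s s₁ t₁ → Runs p₂ s₁ s₂ t₂ →
      Runs (.seq p₁ p₂) s s₂ (t₁ + t₂)
  | case {s r f s' t} : Runs (f (s r).head?) s s' t → Runs (.case r f) s s' (t + 1)
  | loop_nil {s r p} : s r = [] → Runs (.loop r p) s s 1
  | loop_cons {s r p s₁ s₂ t₁ t₂} : s r ≠ [] → Runs p s s₁ t₁ → Runs (.loop r p) s₁ s₂ t₂ →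
      Runs (.loop r p) s s₂ (t₁ + 1 + t₂)

namespace Prog

/-- All registers used by the program are below `N`. -/
def Below (N : ℕ) : Prog q → Prop
  | skip => True
  | push r _ => r < N
  | pop r => r < N
  | seq p₁ p₂ => p₁.Below N ∧ p₂.Below N
  | case r f => r < N ∧ ∀ a, (f a).Below N
  | loop r p => r < N ∧ p.Below N

theorem Below.mono {N N' : ℕ} (h : N ≤ N') : ∀ {p : Prog q}, p.Below N → p.Below N'
  | skip, _ => trivial
  | push _ _, h' => lt_of_lt_of_le h' h
  | pop _, h' => lt_of_lt_of_le h' h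
  | seq _ _, h' => ⟨h'.1.mono h, h'.2.mono h⟩
  | case _ _, h' => ⟨lt_of_lt_of_le h'.1 h, fun a => (h'.2 a).mono h⟩
  | loop _ _, h' => ⟨lt_of_lt_of_le h'.1 h, h'.2.mono h⟩

theorem exists_below : ∀ p : Prog q, ∃ N, p.Below N
  | skip => ⟨0, trivial⟩
  | push r _ => ⟨r + 1, Nat.lt_succ_self r⟩
  | pop r => ⟨r + 1, Nat.lt_succ_self r⟩
  | seq p₁ p₂ => by
      obtain ⟨N₁, h₁⟩ := p₁.exists_below
      obtain ⟨N₂, h₂⟩ := p₂.exists_below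
      exact ⟨max N₁ N₂, h₁.mono (le_max_left _ _), h₂.mono (le_max_right _ _)⟩
  | case r f => by
      choose N hN using fun a => (f a).exists_below
      refine ⟨max (r + 1) (Finset.univ.sup N), lt_of_lt_of_le (Nat.lt_succ_self r) (le_max_left _ _),
        fun a => (hN a).mono (le_trans ?_ (le_max_right _ _))⟩
      exact Finset.le_sup (Finset.mem_univ a)
  | loop r p => by
      obtain ⟨N, h⟩ := p.exists_below
      exact ⟨max (r + 1) N, lt_of_lt_of_le (Nat.lt_succ_self r) (le_max_left _ _),
        h.mono (le_max_right _ _)⟩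

/-! ### Compilation to stack machines -/

/-- The control states needed to run a program. -/
abbrev Lab : Prog q → Type
  | skip => Unit
  | push _ _ => Unit
  | pop _ => Unit
  | seq p₁ p₂ => p₁.Lab ⊕ p₂.Lab
  | case _ f => Option (Σ a, (f a).Lab)
  | loop _ p => Option p.Lab

theorem finite_lab : ∀ p : Prog q, Finite p.Lab
  | skip => inferInstanceAs (Finite Unit)
  | push _ _ => inferInstanceAs (Finite Unit)
  | pop _ => inferInstanceAs (Finite Unit)
  | seq p₁ p₂ => by
      have := p₁.finite_lab
      have := p₂.finite_lab
      exact inferInstanceAs (Finite (p₁.Lab ⊕ p₂.Lab))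
  | case _ f => by
      have := fun a => (f a).finite_lab
      exact inferInstanceAs (Finite (Option (Σ a, (f a).Lab)))
  | loop _ p => by
      have := p.finite_lab
      exact inferInstanceAs (Finite (Option p.Lab))

/-- The control state in which a program starts. -/
def entry : (p : Prog q) → p.Lab
  | skip => ()
  | push _ _ => ()
  | pop _ => ()
  | seq p₁ _ => Sum.inl p₁.entry
  | case _ _ => none
  | loop _ _ => none

end Prog

/-- Alphabets of the stacks of a compiled machine: an input stack, an output stack, and the
registers. -/
abbrev StackSym (q N : ℕ) : Bool ⊕ Fin N → Type
  | .inl false => Option Bool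
  | .inl true => Bool
  | .inr _ => Sym q

/-- Stack contents of a compiled machine. -/
def stackMap (N : ℕ) (i : List (Option Bool)) (o : List Bool) (s : Store q) :
    ∀ k, List (StackSym q N k)
  | .inl false => i
  | .inl true => o
  | .inr r => s r.val

theorem update_stackMap_reg (N : ℕ) (i : List (Option Bool)) (o : List Bool) (s : Store q) {r : ℕ}
    (hr : r < N + 1) (l : List (Sym q)) :
    update (stackMap (N + 1) i o s) (.inr (Fin.ofNat (N + 1) r)) l
      = stackMap (N + 1) i o (update s r l) := by
  have h : (Fin.ofNat (N + 1) r).val = r := Nat.mod_eq_of_lt hr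
  funext k
  rcases k with (_ | _) | k
  · rfl
  · rfl
  · by_cases hk : k = Fin.ofNat (N + 1) r
    · subst hk
      simp only [Function.update_self, stackMap, h]
    · rw [Function.update_of_ne (by simpa using hk)]
      have : k.val ≠ r := fun e => hk (Fin.ext (e.trans h.symm))
      simp [stackMap, Function.update_of_ne this]

theorem stackMap_reg (N : ℕ) (i : List (Option Bool)) (o : List Bool) (s : Store q) {r : ℕ}
    (hr : r < N + 1) :
    stackMap (N + 1) i o s (.inr (Fin.ofNat (N + 1) r)) = s r := by
  have h : (Fin.ofNat (N + 1) r).val = r := Nat.mod_eq_of_lt hr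
  simp only [stackMap, h]

/-- The machine statement for a control state of a program. `emb` embeds the control states of the
program into those of the machine and `ex` is the control state in which to continue. -/
def Prog.code (N : ℕ) {Λ : Type} : (p : Prog q) → (p.Lab → Λ) → Λ → p.Lab →
    Turing.TM2.Stmt (StackSym q (N + 1)) Λ (Option (Sym q))
  | .skip, _, ex, _ => .goto fun _ => ex
  | .push r a, _, ex, _ => .push (.inr (Fin.ofNat (N + 1) r)) (fun _ => a) (.goto fun _ => ex)
  | .pop r, _, ex, _ => .pop (.inr (Fin.ofNat (N + 1) r)) (fun v _ => v) (.goto fun _ => ex)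
  | .seq p₁ p₂, emb, _, .inl l =>
      p₁.code N (fun l => emb (.inl l)) (emb (.inr p₂.entry)) l
  | .seq _ p₂, emb, ex, .inr l => p₂.code N (fun l => emb (.inr l)) ex l
  | .case r f, emb, _, none =>
      .peek (.inr (Fin.ofNat (N + 1) r)) (fun _ b => b)
        (.goto fun v => emb (some ⟨v, (f v).entry⟩))
  | .case _ f, emb, ex, some ⟨a, l⟩ => (f a).code N (fun l => emb (some ⟨a, l⟩)) ex l
  | .loop r p, emb, ex, none =>
      .peek (.inr (Fin.ofNat (N + 1) r)) (fun _ b => b)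
        (.goto fun v => if v.isSome then emb (some p.entry) else ex)
  | .loop _ p, emb, _, some l => p.code N (fun l => emb (some l)) (emb none) l

/-- The machine with statements `m` goes from `c` to `c'` in exactly `t` steps. -/
def StepsTo {K : Type} [DecidableEq K] {Γ : K → Type} {Λ σ : Type}
    (m : Λ → Turing.TM2.Stmt Γ Λ σ) (c c' : Turing.TM2.Cfg Γ Λ σ) (t : ℕ) : Prop :=
  (flip bind (Turing.TM2.step m))^[t] (some c) = some c'

theorem StepsTo.trans {K : Type} [DecidableEq K] {Γ : K → Type} {Λ σ : Type}
    {m : Λ → Turing.TM2.Stmt Γ Λ σ} {c₁ c₂ c₃ : Turing.TM2.Cfg Γ Λ σ} {t₁ t₂ : ℕ}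
    (h₁ : StepsTo m c₁ c₂ t₁) (h₂ : StepsTo m c₂ c₃ t₂) : StepsTo m c₁ c₃ (t₁ + t₂) := by
  unfold StepsTo at *
  rw [Nat.add_comm, Function.iterate_add_apply, h₁, h₂]

theorem StepsTo.one {K : Type} [DecidableEq K] {Γ : K → Type} {Λ σ : Type}
    {m : Λ → Turing.TM2.Stmt Γ Λ σ} {l : Λ} {v : σ} {S : ∀ k, List (Γ k)}
    {c' : Turing.TM2.Cfg Γ Λ σ} (h : Turing.TM2.stepAux (m l) v S = c') :
    StepsTo m ⟨some l, v, S⟩ c' 1 := by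
  subst h
  rfl

/-- A machine that contains the code of a program follows a run of the program step by step, in
exactly the same number of steps. -/
theorem Runs.stepsTo {N : ℕ} {Λ : Type}
    {m : Λ → Turing.TM2.Stmt (StackSym q (N + 1)) Λ (Option (Sym q))} {p : Prog q} {s s' : Store q}
    {t : ℕ} (h : Runs p s s' t) :
    ∀ {emb : p.Lab → Λ} {ex : Λ}, p.Below (N + 1) → (∀ l, m (emb l) = p.code N emb ex l) →
      ∀ i o v, ∃ v', StepsTo m ⟨some (emb p.entry), v, stackMap (N + 1) i o s⟩
        ⟨some ex, v', stackMap (N + 1) i o s'⟩ t := by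
  induction h with
  | skip s =>
    intro emb ex hb hm i o v
    exact ⟨v, StepsTo.one (by rw [hm]; simp [Prog.code])⟩
  | push s r a =>
    intro emb ex hb hm i o v
    refine ⟨v, StepsTo.one ?_⟩
    rw [hm]
    simp only [Prog.code, Turing.TM2.stepAux]
    rw [stackMap_reg _ _ _ _ hb, update_stackMap_reg _ _ _ _ hb]
  | pop s r =>
    intro emb ex hb hm i o v
    refine ⟨v, StepsTo.one ?_⟩
    rw [hm]
    simp only [Prog.code, Turing.TM2.stepAux]
    rw [stackMap_reg _ _ _ _ hb, update_stackMap_reg _ _ _ _ hb]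
  | seq h₁ h₂ ih₁ ih₂ =>
    intro emb ex hb hm i o v
    obtain ⟨v₁, g₁⟩ := ih₁ (emb := fun l => emb (.inl l)) hb.1 (fun l => hm (.inl l)) i o v
    obtain ⟨v₂, g₂⟩ := ih₂ (emb := fun l => emb (.inr l)) hb.2 (fun l => hm (.inr l)) i o v₁
    exact ⟨v₂, g₁.trans g₂⟩
  | @case s r f s' t h ih =>
    intro emb ex hb hm i o v
    obtain ⟨v₁, g₁⟩ := ih (emb := fun l => emb (some ⟨_, l⟩)) (hb.2 _)
      (fun l => hm (some ⟨_, l⟩)) i o (s r).head?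
    refine ⟨v₁, ?_⟩
    rw [Nat.add_comm t 1]
    refine StepsTo.trans (StepsTo.one ?_) g₁
    change Turing.TM2.stepAux (m (emb none)) _ _ = _
    rw [hm]
    simp only [Prog.code, Turing.TM2.stepAux]
    rw [stackMap_reg _ _ _ _ hb.1]
  | @loop_nil s r p h =>
    intro emb ex hb hm i o v
    refine ⟨none, StepsTo.one ?_⟩
    change Turing.TM2.stepAux (m (emb none)) _ _ = _
    rw [hm]
    simp only [Prog.code, Turing.TM2.stepAux]
    rw [stackMap_reg _ _ _ _ hb.1, h]
    rfl
  | @loop_cons s r p s₁ s₂ t₁ t₂ h h₁ h₂ ih₁ ih₂ =>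
    intro emb ex hb hm i o v
    obtain ⟨v₁, g₁⟩ := ih₁ (emb := fun l => emb (some l)) hb.2
      (fun l => hm (some l)) i o (s r).head?
    obtain ⟨v₂, g₂⟩ := ih₂ (emb := emb) hb hm i o v₁
    refine ⟨v₂, ?_⟩
    rw [Nat.add_comm t₁ 1]
    refine StepsTo.trans (StepsTo.trans (StepsTo.one ?_) g₁) g₂
    change Turing.TM2.stepAux (m (emb none)) _ _ = _
    rw [hm]
    simp only [Prog.code, Turing.TM2.stepAux]
    rw [stackMap_reg _ _ _ _ hb.1]
    obtain ⟨a, l, e⟩ := List.exists_cons_of_ne_nil h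
    rw [e]
    rfl

/-- The statements of the machine that loads its input into register `3`, runs the program and
outputs whether register `3` is nonempty. -/
def Prog.machineCode (N : ℕ) (p : Prog q) : Option (Option p.Lab) →
    Turing.TM2.Stmt (StackSym q (N + 1)) (Option (Option p.Lab)) (Option (Sym q))
  | none => .pop (.inl false) (fun _ a => a.map Sum.inl)
      (.branch (fun v => v.isSome)
        (.push (.inr (Fin.ofNat (N + 1) 3)) (fun v => v.getD sepS) (.goto fun _ => none))
        (.goto fun _ => some (some p.entry)))
  | some none => .pop (.inr (Fin.ofNat (N + 1) 3)) (fun _ a => a)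
      (.push (.inl true) (fun v => v.isSome) (.load (fun _ => none) .halt))
  | some (some l) => p.code N (fun l => some (some l)) (some none) l

/-- The machine that runs a program. -/
noncomputable def Prog.machine (N : ℕ) (p : Prog q) : Machine where
  tm :=
    { K := Bool ⊕ Fin (N + 1)
      k₀ := .inl false
      k₁ := .inl true
      Γ := StackSym q (N + 1)
      Λ := Option (Option p.Lab)
      main := none
      ΛFin := by
        have := p.finite_lab
        exact Fintype.ofFinite _
      σ := Option (Sym q)
      initialState := none
      Γk₀Fin := inferInstanceAs (Fintype (Option Bool))
      m := p.machineCode N }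
  inputAlphabet := Equiv.refl _
  outputAlphabet := Equiv.refl _

/-- The first phase of the machine: the input stack is moved to register `3`, in reverse order. -/
theorem Prog.load_input (N : ℕ) (hN : 3 < N + 1) (p : Prog q) (w : List (Option Bool)) :
    ∀ (v) (s : Store q), ∃ v', StepsTo (p.machineCode N) ⟨some none, v, stackMap (N + 1) w [] s⟩
      ⟨some (some (some p.entry)), v',
        stackMap (N + 1) [] [] (update s 3 ((w.map Sum.inl).reverse ++ s 3))⟩ (w.length + 1) := by
  induction w with
  | nil =>
    intro v s
    refine ⟨none, StepsTo.one ?_⟩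
    simp only [Prog.machineCode, Turing.TM2.stepAux]
    simp [stackMap]
  | cons a w ih =>
    intro v s
    obtain ⟨v', h'⟩ := ih (some (.inl a)) (update s 3 (.inl a :: s 3))
    refine ⟨v', ?_⟩
    rw [List.length_cons, Nat.add_comm (w.length + 1) 1]
    have e : update (update s 3 (.inl a :: s 3)) 3
        ((w.map Sum.inl).reverse ++ update s 3 (.inl a :: s 3) 3)
        = update s 3 (((a :: w).map Sum.inl).reverse ++ s 3) := by
      simp
    rw [e] at h'
    refine StepsTo.trans (StepsTo.one ?_) h'
    · simp only [Prog.machineCode, Turing.TM2.stepAux]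
      have : update (stackMap (N + 1) (a :: w) [] s) (.inl false) w = stackMap (N + 1) w [] s := by
        funext k
        rcases k with (_ | _) | k <;> rfl
      change Turing.TM2.Cfg.mk _ _ (update (update (stackMap (N + 1) (a :: w) [] s) (.inl false) w)
        _ _) = _
      change Turing.TM2.Cfg.mk _ _ (update (update (stackMap (N + 1) (a :: w) [] s) (.inl false) w)
        (.inr (Fin.ofNat (N + 1) 3)) (.inl a :: (update (stackMap (N + 1) (a :: w) [] s) (.inl false) w)
          (.inr (Fin.ofNat (N + 1) 3)))) = _
      rw [this, update_stackMap_reg _ _ _ _ hN, stackMap_reg _ _ _ _ hN]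
      rfl

/-- A program that clears all registers but `3`, where it leaves at most one symbol, gives a
machine whose output bit says whether there is such a symbol. -/
theorem Prog.exists_machine (p : Prog q) : ∃ M : Machine, ∀ w b s t,
    Runs p (update (fun _ => []) 3 (w.map Sum.inl).reverse) (update (fun _ => []) 3 s) t →
      (s.length = b.toNat) → M.OutputsBit w b (t + w.length + 2) := by
  obtain ⟨N, hN⟩ := p.exists_below
  have hb : p.Below (N + 3 + 1) := hN.mono (by omega)
  have h3 : 3 < N + 3 + 1 := by omega
  refine ⟨p.machine (N + 3), fun w b s t h hs => ?_⟩
  obtain ⟨v₁, g₁⟩ := p.load_input (N + 3) h3 w none (fun _ => [])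
  rw [List.append_nil] at g₁
  obtain ⟨v₂, g₂⟩ := h.stepsTo (m := p.machineCode (N + 3)) (emb := fun l => some (some l))
    (ex := some none) hb (fun l => rfl) [] [] v₁
  have g₃ : StepsTo (p.machineCode (N + 3))
      ⟨some (some none), v₂, stackMap (N + 3 + 1) [] [] (update (fun _ => []) 3 s)⟩
      ⟨none, none, stackMap (N + 3 + 1) [] [b] (fun _ => [])⟩ 1 := by
    refine StepsTo.one ?_
    simp only [Prog.machineCode, Turing.TM2.stepAux]
    rw [stackMap_reg _ _ _ _ h3, update_stackMap_reg _ _ _ _ h3]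
    have e : (update (fun _ => []) 3 s : Store q) 3 = s := by simp
    rw [e]
    have e1 : s.head?.isSome = b := by
      cases b <;> rcases s with _ | ⟨x, s⟩ <;> simp_all
    have e2 : s.tail = [] := by
      cases b <;> rcases s with _ | ⟨x, s⟩ <;> simp_all
    rw [e1, e2]
    congr 1
    funext k
    rcases k with (_ | _) | k
    · rfl
    · rfl
    · change (update (update (fun _ => []) 3 s) 3 [] : Store q) k = _
      simp [stackMap]
  refine ⟨⟨⟨w.length + 1 + t + 1, ?_⟩, ?_⟩⟩
  · have g := (g₁.trans g₂).trans g₃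
    unfold StepsTo at g
    refine Eq.trans ?_ (g.trans ?_)
    · congr 1
      simp only [Turing.initList]
      congr 2
      funext k
      rcases k with (_ | _) | k
      · simp only [Prog.machine, stackMap]
        exact List.map_id w
      · simp [Prog.machine, stackMap]
      · simp [Prog.machine, stackMap]
    · simp only [Option.map, Turing.haltList]
      congr 2
      funext k
      rcases k with (_ | _) | k
      · simp [Prog.machine, stackMap]
      · simp only [Prog.machine, stackMap]
        rfl
      · simp [Prog.machine, stackMap]
  · change w.length + 1 + t + 1 ≤ _
    omega

end ParaCircuit

namespace ParaCircuit

open Function (update)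

variable {q : ℕ}

/-! ### Running programs within a time bound -/

/-- Started in store `s` the program `p` halts in store `s'` after at most `t` steps. -/
def RunsIn (p : Prog q) (s s' : Store q) (t : ℕ) : Prop := ∃ t' ≤ t, Runs p s s' t'

theorem Runs.runsIn {p : Prog q} {s s' : Store q} {t : ℕ} (h : Runs p s s' t) : RunsIn p s s' t :=
  ⟨t, le_rfl, h⟩

namespace RunsIn

variable {p p₁ p₂ : Prog q} {s s' s₁ s₂ : Store q} {t t' t₁ t₂ r : ℕ}

theorem mono (h : RunsIn p s s' t) (ht : t ≤ t') : RunsIn p s s' t' :=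
  let ⟨u, hu, h'⟩ := h
  ⟨u, hu.trans ht, h'⟩

theorem skip : RunsIn (.skip : Prog q) s s 1 := (Runs.skip s).runsIn

theorem push {a : Sym q} (e : update s r (a :: s r) = s') : RunsIn (.push r a) s s' 1 :=
  e ▸ (Runs.push s r a).runsIn

theorem pop (e : update s r (s r).tail = s') : RunsIn (.pop r) s s' 1 :=
  e ▸ (Runs.pop s r).runsIn

theorem seq (h₁ : RunsIn p₁ s s₁ t₁) (h₂ : RunsIn p₂ s₁ s₂ t₂) :
    RunsIn (.seq p₁ p₂) s s₂ (t₁ + t₂) :=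
  let ⟨_, hu₁, h₁'⟩ := h₁
  let ⟨_, hu₂, h₂'⟩ := h₂
  ⟨_, add_le_add hu₁ hu₂, .seq h₁' h₂'⟩

theorem case {f : Option (Sym q) → Prog q} {a : Option (Sym q)} (e : (s r).head? = a)
    (h : RunsIn (f a) s s' t) : RunsIn (.case r f) s s' (t + 1) := by
  subst e
  obtain ⟨u, hu, h'⟩ := h
  exact ⟨u + 1, Nat.succ_le_succ hu, .case h'⟩

theorem loop_nil (h : s r = []) : RunsIn (.loop r p) s s 1 := (Runs.loop_nil h).runsIn

theorem loop_cons (h : s r ≠ []) (h₁ : RunsIn p s s₁ t₁) (h₂ : RunsIn (.loop r p) s₁ s₂ t₂) :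
    RunsIn (.loop r p) s s₂ (t₁ + 1 + t₂) :=
  let ⟨_, hu₁, h₁'⟩ := h₁
  let ⟨_, hu₂, h₂'⟩ := h₂
  ⟨_, by omega, .loop_cons h h₁' h₂'⟩

theorem congr {s'' : Store q} (h : RunsIn p s s' t) (e : s' = s'') : RunsIn p s s'' t := e ▸ h

end RunsIn

theorem Runs.length_le {p : Prog q} {s s' : Store q} {t : ℕ} (h : Runs p s s' t) (r : ℕ) :
    (s' r).length ≤ (s r).length + t := by
  induction h with
  | skip s => omega
  | push s r' a =>
    by_cases e : r = r'
    · subst e; simp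
    · simp [Function.update_of_ne e]
  | pop s r' =>
    by_cases e : r = r'
    · subst e; simp; omega
    · simp [Function.update_of_ne e]
  | seq _ _ ih₁ ih₂ => omega
  | case _ ih => omega
  | loop_nil _ => omega
  | loop_cons _ _ _ ih₁ ih₂ => omega

theorem RunsIn.length_le {p : Prog q} {s s' : Store q} {t : ℕ} (h : RunsIn p s s' t) (r : ℕ) :
    (s' r).length ≤ (s r).length + t := by
  obtain ⟨u, hu, h⟩ := h
  have := h.length_le r
  omega

/-! ### Renaming of registers -/

/-- The program with its registers renamed. -/
def Prog.map (ρ : ℕ → ℕ) : Prog q → Prog q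
  | .skip => .skip
  | .push r a => .push (ρ r) a
  | .pop r => .pop (ρ r)
  | .seq p₁ p₂ => .seq (p₁.map ρ) (p₂.map ρ)
  | .case r f => .case (ρ r) fun a => (f a).map ρ
  | .loop r p => .loop (ρ r) (p.map ρ)

/-- A renamed program does to the renamed registers what the program does to the registers, and
leaves all other registers alone. -/
theorem Runs.map {ρ : ℕ → ℕ} (hρ : ρ.Injective) {p : Prog q} {s s' : Store q} {t : ℕ}
    (h : Runs p s s' t) : ∀ S : Store q, (∀ i, S (ρ i) = s i) →
      ∃ S', Runs (p.map ρ) S S' t ∧ (∀ i, S' (ρ i) = s' i) ∧ ∀ r, (∀ i, ρ i ≠ r) → S' r = S r := by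
  have upd : ∀ (S s : Store q) (r : ℕ) (l : List (Sym q)), (∀ i, S (ρ i) = s i) →
      ∀ i, update S (ρ r) l (ρ i) = update s r l i := by
    intro S s r l h i
    by_cases e : i = r
    · subst e; simp
    · rw [Function.update_of_ne e, Function.update_of_ne (fun e' => e (hρ e')), h]
  induction h with
  | skip s => exact fun S hS => ⟨S, .skip S, hS, fun _ _ => rfl⟩
  | push s r a =>
    intro S hS
    refine ⟨_, .push S (ρ r) a, ?_, fun r' hr' => Function.update_of_ne (hr' r).symm _ _⟩
    rw [hS]
    exact upd S s r _ hS
  | pop s r =>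
    intro S hS
    refine ⟨_, .pop S (ρ r), ?_, fun r' hr' => Function.update_of_ne (hr' r).symm _ _⟩
    rw [hS]
    exact upd S s r _ hS
  | seq _ _ ih₁ ih₂ =>
    intro S hS
    obtain ⟨S₁, h₁, e₁, o₁⟩ := ih₁ S hS
    obtain ⟨S₂, h₂, e₂, o₂⟩ := ih₂ S₁ e₁
    exact ⟨S₂, .seq h₁ h₂, e₂, fun r hr => (o₂ r hr).trans (o₁ r hr)⟩
  | @case s r f s' t _ ih =>
    intro S hS
    obtain ⟨S₁, h₁, e₁, o₁⟩ := ih S hS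
    refine ⟨S₁, .case (r := ρ r) ?_, e₁, o₁⟩
    rw [hS]
    exact h₁
  | @loop_nil s r p h => exact fun S hS => ⟨S, .loop_nil (by rw [hS, h]), hS, fun _ _ => rfl⟩
  | @loop_cons s r p s₁ s₂ t₁ t₂ h _ _ ih₁ ih₂ =>
    intro S hS
    obtain ⟨S₁, h₁, e₁, o₁⟩ := ih₁ S hS
    obtain ⟨S₂, h₂, e₂, o₂⟩ := ih₂ S₁ e₁
    exact ⟨S₂, .loop_cons (by rw [hS]; exact h) h₁ h₂, e₂,
      fun r hr => (o₂ r hr).trans (o₁ r hr)⟩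

/-! ### Registers that hold numbers -/

/-- The contents of a register that holds the number `x` in binary, least significant bit on top. -/
def enc (x : ℕ) : List (Sym q) := x.bits.map bitS

/-- The least significant bit of a nonzero number. -/
def lsb? (x : ℕ) : Option Bool := if x = 0 then none else some (x.testBit 0)

theorem enc_zero : (enc 0 : List (Sym q)) = [] := by simp [enc]

theorem enc_of_ne_zero {x : ℕ} (h : x ≠ 0) :
    (enc x : List (Sym q)) = bitS (x.testBit 0) :: enc (x / 2) := by
  have e : x.bits = x.testBit 0 :: (x / 2).bits := by
    have h1 : Nat.bit x.bodd x.div2 = x := Nat.bit_bodd_div2 x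
    have h2 : (Nat.bit x.bodd x.div2).bits = x.bodd :: x.div2.bits := by
      refine Nat.bits_append_bit _ _ fun h0 => ?_
      by_contra hb
      have : x.bodd = false := by simpa using hb
      rw [h0, this] at h1
      exact h (by rw [← h1]; rfl)
    rw [h1] at h2
    rw [h2, Nat.div2_val]
    congr 1
  simp [enc, e]

theorem enc_head (x : ℕ) : (enc x : List (Sym q)).head? = (lsb? x).map bitS := by
  by_cases h : x = 0
  · simp [h, enc_zero, lsb?]
  · simp [enc_of_ne_zero h, h, lsb?]

theorem enc_tail (x : ℕ) : (enc x : List (Sym q)).tail = enc (x / 2) := by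
  by_cases h : x = 0
  · simp [h, enc_zero]
  · simp [enc_of_ne_zero h]

theorem enc_eq_nil {x : ℕ} : (enc x : List (Sym q)) = [] ↔ x = 0 := by
  constructor
  · intro h
    by_contra h0
    rw [enc_of_ne_zero h0] at h
    exact absurd h (by simp)
  · rintro rfl
    exact enc_zero

theorem enc_bit (b : Bool) (x : ℕ) :
    (enc (Nat.bit b x) : List (Sym q)) = if x = 0 ∧ b = false then [] else bitS b :: enc x := by
  by_cases h : x = 0 ∧ b = false
  · rw [if_pos h, h.1, h.2, enc_eq_nil]; rfl
  · have h0 : Nat.bit b x ≠ 0 := by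
      intro e
      rw [Nat.bit_eq_zero_iff] at e
      exact h e
    rw [if_neg h, enc_of_ne_zero h0, Nat.testBit_bit_zero, Nat.bit_div_two]

theorem length_enc (x : ℕ) : (enc x : List (Sym q)).length = x.size := by
  simp [enc, Nat.size_eq_bits_len]

theorem size_div_two (x : ℕ) : (x / 2).size = x.size - 1 := by
  have h := congrArg List.length (enc_tail (q := 0) x)
  rw [List.length_tail, length_enc, length_enc] at h
  exact h.symm

theorem size_pos_of_ne_zero {x : ℕ} (h : x ≠ 0) : 0 < x.size :=
  Nat.size_pos.2 (Nat.pos_of_ne_zero h)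

/-- The store in which register `r` holds the number `v r`. -/
def cx (v : ℕ → ℕ) : Store q := fun r => enc (v r)

theorem update_cx (v : ℕ → ℕ) (r x : ℕ) :
    update (cx v) r (enc x) = (cx (update v r x) : Store q) := by
  funext i
  by_cases h : i = r
  · subst h; simp [cx]
  · simp [cx, Function.update_of_ne h]

/-- Renaming for stores of numbers: `V` and `V'` restrict along `ρ` to the stores before and after
the run, and agree outside the range of `ρ`. -/
theorem RunsIn.map_cx {p : Prog q} {v v' V V' : ℕ → ℕ} {t : ℕ} (h : RunsIn p (cx v) (cx v') t)
    {ρ : ℕ → ℕ} (hρ : ρ.Injective) (hV : ∀ i, V (ρ i) = v i) (hV' : ∀ i, V' (ρ i) = v' i)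
    (ho : ∀ r, (∀ i, ρ i ≠ r) → V' r = V r) : RunsIn (p.map ρ) (cx V) (cx V') t := by
  obtain ⟨u, hu, h⟩ := h
  obtain ⟨S', h', e, o⟩ := h.map hρ (cx V) (fun i => by simp [cx, hV])
  refine ⟨u, hu, ?_⟩
  convert h'
  funext r
  by_cases hr : ∃ i, ρ i = r
  · obtain ⟨i, rfl⟩ := hr
    rw [e, cx, cx, hV']
  · rw [o r fun i hi => hr ⟨i, hi⟩, cx, cx, ho r fun i hi => hr ⟨i, hi⟩]

/-! ### Clearing, moving and copying -/

namespace Prog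

/-- Empties a register. -/
def clear (r : ℕ) : Prog q := .loop r (.pop r)

/-- Moves the contents of register `r` to register `r'` in reverse order, applying `g` to each
symbol. -/
def mv (g : Sym q → Sym q) (r r' : ℕ) : Prog q :=
  .loop r (.case r fun a => .seq (.pop r) (a.elim .skip fun a => .push r' (g a)))

/-- Moves the contents of register `r` in reverse order to both `r₁` and `r₂`. -/
def mv₂ (r r₁ r₂ : ℕ) : Prog q :=
  .loop r (.case r fun a => .seq (.pop r)
    (a.elim .skip fun a => .seq (.push r₁ a) (.push r₂ a)))

theorem clear_runsIn (s : Store q) (r : ℕ) :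
    RunsIn (clear r) s (update s r []) (2 * (s r).length + 1) := by
  generalize hl : s r = l
  induction l generalizing s with
  | nil =>
    rw [← hl, Function.update_eq_self]
    exact (RunsIn.loop_nil hl).mono (by omega)
  | cons a l ih =>
    have h := ih (update s r l) (by simp)
    rw [Function.update_idem] at h
    refine (RunsIn.loop_cons (by simp [hl]) (RunsIn.pop rfl) (by rw [hl]; exact h)).mono ?_
    simp only [List.length_cons]
    omega

theorem mv_runsIn (g : Sym q → Sym q) (s : Store q) {r r' : ℕ} (hr : r ≠ r') :
    RunsIn (mv g r r') s (update (update s r []) r' (((s r).map g).reverse ++ s r'))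
      (4 * (s r).length + 1) := by
  generalize hl : s r = l
  induction l generalizing s with
  | nil =>
    have : update (update s r []) r' (((([] : List (Sym q)).map g)).reverse ++ s r') = s := by
      funext i
      by_cases h : i = r
      · subst h; simp [hl, Function.update_of_ne hr]
      · simp [Function.update_apply, h]
        rintro rfl; rfl
    rw [this]
    exact (RunsIn.loop_nil hl).mono (by omega)
  | cons a l ih =>
    have h := ih (update (update s r l) r' (g a :: s r')) (by simp [Function.update_of_ne hr])
    refine (RunsIn.loop_cons (by simp [hl]) (RunsIn.case (a := some a) (by simp [hl])
      (RunsIn.seq (RunsIn.pop rfl) (RunsIn.push rfl))) ?_ (t₂ := 4 * l.length + 1)).mono ?_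
    · rw [hl, List.tail_cons, Function.update_of_ne hr.symm]
      refine h.congr ?_
      funext i
      by_cases h1 : i = r'
      · subst h1; simp
      · by_cases h2 : i = r
        · subst h2; simp [Function.update_of_ne h1]
        · simp [Function.update_of_ne h1, Function.update_of_ne h2]
    · simp only [List.length_cons]
      omega

theorem mv₂_runsIn (s : Store q) {r r₁ r₂ : ℕ} (h₁ : r ≠ r₁) (h₂ : r ≠ r₂) (h₁₂ : r₁ ≠ r₂) :
    RunsIn (mv₂ r r₁ r₂) s (update (update (update s r []) r₁ ((s r).reverse ++ s r₁)) r₂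
      ((s r).reverse ++ s r₂)) (5 * (s r).length + 1) := by
  generalize hl : s r = l
  induction l generalizing s with
  | nil =>
    have : update (update (update s r []) r₁ (([] : List (Sym q)).reverse ++ s r₁)) r₂
        (([] : List (Sym q)).reverse ++ s r₂) = s := by
      funext i
      by_cases h : i = r
      · subst h; simp [hl, Function.update_of_ne h₁, Function.update_of_ne h₂]
      · simp [Function.update_apply, h]
        split_ifs with e1 e2 <;> simp_all
    rw [this]
    exact (RunsIn.loop_nil hl).mono (by omega)
  | cons a l ih =>
    have h := ih (update (update (update s r l) r₁ (a :: s r₁)) r₂ (a :: s r₂))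
      (by simp [Function.update_of_ne h₁, Function.update_of_ne h₂])
    refine (RunsIn.loop_cons (by simp [hl]) (RunsIn.case (a := some a) (by simp [hl])
      (RunsIn.seq (RunsIn.pop rfl) (RunsIn.seq (RunsIn.push rfl) (RunsIn.push rfl)))) ?_
      (t₂ := 5 * l.length + 1)).mono ?_
    · rw [hl, List.tail_cons, Function.update_of_ne h₁.symm, Function.update_of_ne h₁₂.symm,
        Function.update_of_ne h₂.symm]
      refine h.congr ?_
      funext i
      by_cases e2 : i = r₂
      · subst e2; simp
      · by_cases e1 : i = r₁
        · subst e1; simp [Function.update_of_ne h₁₂]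
        · by_cases e : i = r
          · subst e; simp [Function.update_of_ne e1, Function.update_of_ne e2]
          · simp [Function.update_of_ne e1, Function.update_of_ne e2, Function.update_of_ne e]
    · simp only [List.length_cons]
      omega

theorem clear_cx (v : ℕ → ℕ) (r : ℕ) :
    RunsIn (clear r : Prog q) (cx v) (cx (update v r 0)) (2 * (v r).size + 1) := by
  have h := clear_runsIn (cx v : Store q) r
  rw [← enc_zero, update_cx] at h
  refine h.mono (le_of_eq ?_)
  rw [cx, length_enc]

/-- Moves the contents of register `r` to register `r'`, using the empty register `x`. -/
def move (r r' x : ℕ) : Prog q := .seq (mv id r x) (mv id x r')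

theorem move_cx (v : ℕ → ℕ) {r r' x : ℕ} (h : r ≠ r') (hx : r ≠ x) (hx' : r' ≠ x) (h0 : v r' = 0)
    (hx0 : v x = 0) :
    RunsIn (move r r' x : Prog q) (cx v) (cx (update (update v r 0) r' (v r)))
      (8 * (v r).size + 2) := by
  have h₁ := mv_runsIn id (cx v : Store q) hx
  have h₂ := mv_runsIn id (update (update (cx v : Store q) r []) x
    (((cx v r).map id).reverse ++ cx v x)) hx'.symm
  refine ((RunsIn.seq h₁ h₂).congr ?_).mono ?_
  · funext i
    by_cases e1 : i = r'
    · subst e1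
      simp [Function.update_of_ne hx', cx, h0, hx0, enc_zero, Function.update_of_ne h.symm]
    · by_cases e2 : i = x
      · subst e2; simp [Function.update_of_ne e1, Function.update_of_ne hx.symm, cx, hx0, enc_zero]
      · by_cases e3 : i = r
        · subst e3; simp [Function.update_of_ne e1, Function.update_of_ne e2, cx, enc_zero]
        · simp [Function.update_of_ne e1, Function.update_of_ne e2, Function.update_of_ne e3, cx]
  · simp [cx, hx0, enc_zero, length_enc]
    omega

/-- Copies the contents of register `r` to register `r'`, using the empty register `x`. -/
def copy (r r' x : ℕ) : Prog q := .seq (mv id r x) (mv₂ x r r')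

theorem copy_cx (v : ℕ → ℕ) {r r' x : ℕ} (h : r ≠ r') (hx : r ≠ x) (hx' : r' ≠ x) (h0 : v r' = 0)
    (hx0 : v x = 0) :
    RunsIn (copy r r' x : Prog q) (cx v) (cx (update v r' (v r))) (9 * (v r).size + 2) := by
  have h₁ := mv_runsIn id (cx v : Store q) hx
  have h₂ := mv₂_runsIn (s := update (update (cx v : Store q) r []) x
    (((cx v r).map id).reverse ++ cx v x)) hx.symm hx'.symm h
  refine ((RunsIn.seq h₁ h₂).congr ?_).mono ?_
  · funext i
    by_cases e1 : i = r'
    · subst e1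
      simp [Function.update_of_ne hx', cx, h0, hx0, enc_zero, Function.update_of_ne h.symm]
    · by_cases e2 : i = x
      · subst e2; simp [Function.update_of_ne e1, Function.update_of_ne hx.symm, cx, hx0, enc_zero]
      · by_cases e3 : i = r
        · subst e3; simp [Function.update_of_ne e1, Function.update_of_ne e2, cx, hx0, enc_zero]
        · simp [Function.update_of_ne e1, Function.update_of_ne e2, Function.update_of_ne e3, cx]
  · simp [cx, hx0, enc_zero, length_enc]
    omega

end Prog

end ParaCircuit

namespace ParaCircuit

open Function (update)

variable {q : ℕ}

/-! ### Computable functions of the registers, with time bounds -/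

/-- Some program computes `f` from the numbers in the registers below `m`, which it preserves, into
register `m`, within time `T`. -/
def Cp (q m : ℕ) (f T : (ℕ → ℕ) → ℕ) : Prop :=
  ∃ p : Prog q, ∀ v, (∀ r, m ≤ r → v r = 0) → RunsIn p (cx v) (cx (update v m (f v))) (T v)

/-- Some program computes `f` from the numbers in the registers below `l`, which it consumes, into
register `0`, within time `T`. -/
def Dp (q l : ℕ) (f T : (ℕ → ℕ) → ℕ) : Prop :=
  ∃ p : Prog q, ∀ v, (∀ r, l ≤ r → v r = 0) →
    RunsIn p (cx v) (cx (update (fun _ => 0) 0 (f v))) (T v)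

/-- Total length of the numbers in the registers below `m`. -/
def total (m : ℕ) (v : ℕ → ℕ) : ℕ := ∑ r ∈ Finset.range m, (v r).size

theorem size_le_total {m r : ℕ} (h : r < m) (v : ℕ → ℕ) : (v r).size ≤ total m v :=
  Finset.single_le_sum (f := fun r => (v r).size) (fun _ _ => Nat.zero_le _)
    (Finset.mem_range.2 h)

theorem Cp.mono {m : ℕ} {f T T' : (ℕ → ℕ) → ℕ} (h : Cp q m f T)
    (hT : ∀ v, (∀ r, m ≤ r → v r = 0) → T v ≤ T' v) : Cp q m f T' := by
  obtain ⟨p, hp⟩ := h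
  exact ⟨p, fun v hv => (hp v hv).mono (hT v hv)⟩

theorem Cp.congr {m : ℕ} {f f' T : (ℕ → ℕ) → ℕ} (h : Cp q m f T)
    (hf : ∀ v, (∀ r, m ≤ r → v r = 0) → f v = f' v) : Cp q m f' T := by
  obtain ⟨p, hp⟩ := h
  exact ⟨p, fun v hv => by rw [← hf v hv]; exact hp v hv⟩

theorem Dp.mono {m : ℕ} {f T T' : (ℕ → ℕ) → ℕ} (h : Dp q m f T)
    (hT : ∀ v, (∀ r, m ≤ r → v r = 0) → T v ≤ T' v) : Dp q m f T' := by
  obtain ⟨p, hp⟩ := h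
  exact ⟨p, fun v hv => (hp v hv).mono (hT v hv)⟩

theorem Cp.size_le {m : ℕ} {f T : (ℕ → ℕ) → ℕ} (h : Cp q m f T) {v : ℕ → ℕ}
    (hv : ∀ r, m ≤ r → v r = 0) : (f v).size ≤ T v := by
  obtain ⟨p, hp⟩ := h
  have := (hp v hv).length_le m
  simpa [cx, length_enc, hv m le_rfl] using this

theorem Cp.proj {m i : ℕ} (hi : i < m) : Cp q m (fun v => v i) (fun v => 9 * (v i).size + 2) :=
  ⟨Prog.copy i m (m + 1), fun v hv =>
    Prog.copy_cx v hi.ne (by omega) (by omega) (hv m le_rfl) (hv _ (by omega))⟩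

/-- Pushes a list of bits, the last one ending up on top. -/
def Prog.pushBits (r : ℕ) : List Bool → Prog q
  | [] => .skip
  | b :: l => .seq (.push r (bitS b)) (Prog.pushBits r l)

theorem Prog.pushBits_runsIn (r : ℕ) (l : List Bool) (s : Store q) :
    RunsIn (Prog.pushBits r l) s (update s r ((l.map bitS).reverse ++ s r)) (l.length + 1) := by
  induction l generalizing s with
  | nil => exact RunsIn.skip.congr (by simp)
  | cons b l ih =>
    refine ((RunsIn.seq (RunsIn.push rfl) (ih _)).congr ?_).mono (by simp; omega)
    simp

theorem Cp.const (m x : ℕ) : Cp q m (fun _ => x) (fun _ => x.size + 1) := by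
  refine ⟨Prog.pushBits m x.bits.reverse, fun v hv => ?_⟩
  refine ((Prog.pushBits_runsIn m x.bits.reverse (cx v)).congr ?_).mono ?_
  · rw [← update_cx]
    congr 1
    rw [cx, hv m le_rfl, enc_zero, List.append_nil, List.map_reverse, List.reverse_reverse]
    rfl
  · rw [List.length_reverse, Nat.size_eq_bits_len]

/-- Clears the registers from `k` on up to, excluding, `k + l`. -/
theorem Prog.exists_clear (k l : ℕ) : ∃ p : Prog q, ∀ v : ℕ → ℕ,
    RunsIn p (cx v) (cx (fun r => if k ≤ r ∧ r < k + l then 0 else v r))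
      (∑ i ∈ Finset.range l, (2 * (v (k + i)).size + 1) + 1) := by
  induction l with
  | zero =>
    refine ⟨.skip, fun v => ?_⟩
    refine (RunsIn.skip.congr ?_).mono (by simp)
    congr 1
    funext r
    rw [if_neg (by omega)]
  | succ l ih =>
    obtain ⟨p, hp⟩ := ih
    refine ⟨.seq p (Prog.clear (k + l)), fun v => ?_⟩
    refine ((RunsIn.seq (hp v) (Prog.clear_cx _ _)).congr ?_).mono ?_
    · congr 1
      funext r
      by_cases h : r = k + l
      · subst h; simp
      · rw [Function.update_of_ne h]
        by_cases h' : k ≤ r ∧ r < k + l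
        · rw [if_pos h', if_pos (by omega)]
        · rw [if_neg h', if_neg (by omega)]
    · rw [Finset.sum_range_succ, if_neg (by omega)]
      omega

/-- A program that preserves its arguments gives one that consumes them, at the cost of clearing
the arguments and moving the result. -/
theorem Cp.dp {l : ℕ} {f T : (ℕ → ℕ) → ℕ} (h : Cp q l f T) :
    Dp q l f (fun v => 9 * T v + 2 * total l v + l + 3) := by
  obtain ⟨p, hp⟩ := id h
  obtain ⟨p', hp'⟩ := Prog.exists_clear (q := q) 0 l
  cases l with
  | zero =>
    refine ⟨p, fun v hv => ?_⟩
    refine ((hp v hv).congr ?_).mono (by dsimp only; omega)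
    congr 1
    funext r
    by_cases h : r = 0
    · subst h; simp
    · rw [Function.update_of_ne h, Function.update_of_ne h, hv r (by omega)]
  | succ l =>
    refine ⟨.seq p (.seq p' (Prog.move (l + 1) 0 (l + 2))), fun v hv => ?_⟩
    refine ((RunsIn.seq (hp v hv) (RunsIn.seq (hp' _) (Prog.move_cx _ (by omega) (by omega)
      (by omega) (by simp) ?_))).congr ?_).mono ?_
    · simp [hv (l + 2) (by omega)]
    · congr 1
      funext r
      by_cases h : r = 0
      · subst h; simp
      · rw [Function.update_of_ne h, Function.update_of_ne h]
        by_cases h' : r = l + 1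
        · subst h'; simp
        · rw [Function.update_of_ne h']
          by_cases h'' : r < l + 1
          · rw [if_pos (by omega)]
          · rw [if_neg (by omega), Function.update_of_ne h', hv r (by omega)]
    · have e : ∑ i ∈ Finset.range (l + 1), (2 * (update v (l + 1) (f v) (0 + i)).size + 1)
          = 2 * total (l + 1) v + (l + 1) := by
        rw [Finset.sum_add_distrib, ← Finset.mul_sum, Finset.sum_const, Finset.card_range,
          smul_eq_mul, mul_one, total]
        congr 2
        refine Finset.sum_congr rfl fun i hi => ?_
        rw [Finset.mem_range] at hi
        rw [Nat.zero_add, Function.update_of_ne (by omega)]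
      rw [e]
      simp only [Nat.zero_le, Nat.zero_add, lt_irrefl, and_false, if_false, Function.update_self]
      have := h.size_le hv
      omega

/-- Computes several functions into consecutive registers. -/
theorem Cp.exists_block {m : ℕ} {G TG : ℕ → (ℕ → ℕ) → ℕ} (l : ℕ)
    (hG : ∀ i < l, Cp q m (G i) (TG i)) : ∃ p : Prog q, ∀ v, (∀ r, m ≤ r → v r = 0) →
      RunsIn p (cx v) (cx (fun r => if r < m then v r else if r < m + l then G (r - m) v else 0))
        (∑ i ∈ Finset.range l, TG i v + 1) := by
  induction l with
  | zero =>
    refine ⟨.skip, fun v hv => (RunsIn.skip.congr ?_).mono (by simp)⟩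
    congr 1
    funext r
    by_cases h : r < m
    · rw [if_pos h]
    · rw [if_neg h, if_neg (by omega), hv r (by omega)]
  | succ l ih =>
    obtain ⟨p, hp⟩ := ih fun i hi => hG i (by omega)
    obtain ⟨p', hp'⟩ := hG l (by omega)
    -- the next program sees the arguments and works above the values computed so far
    refine ⟨.seq p (p'.map fun r => if r < m then r else r + l), fun v hv => ?_⟩
    have h' := (hp' v hv).map_cx (ρ := fun r => if r < m then r else r + l)
      (V := fun r => if r < m then v r else if r < m + l then G (r - m) v else 0)
      (V' := fun r => if r < m then v r else if r < m + (l + 1) then G (r - m) v else 0)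
      ?_ ?_ ?_ ?_
    · refine (RunsIn.seq (hp v hv) h').mono ?_
      rw [Finset.sum_range_succ]
      omega
    · intro a b h
      simp only at h
      split_ifs at h <;> omega
    · intro i
      by_cases h : i < m
      · simp [h]
      · simp only [h, if_false]
        rw [if_neg (by omega), if_neg (by omega), hv i (by omega)]
    · intro i
      by_cases h : i < m
      · simp [h, Function.update_of_ne h.ne]
      · simp only [h, if_false]
        rw [if_neg (by omega)]
        by_cases h1 : i = m
        · subst h1
          rw [if_pos (by omega), Function.update_self]
          congr 1
          omega
        · rw [if_neg (by omega), Function.update_of_ne h1, hv i (by omega)]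
    · intro r hr
      by_cases h : r < m
      · simp [h]
      · simp only [h, if_false]
        by_cases h1 : r < m + l
        · rw [if_pos h1, if_pos (by omega)]
        · refine absurd ?_ (hr (r - l))
          split_ifs <;> omega

/-- Composition: the arguments are computed into fresh registers and then consumed. -/
theorem Dp.comp {l m : ℕ} {f T : (ℕ → ℕ) → ℕ} {G TG : ℕ → (ℕ → ℕ) → ℕ} (hf : Dp q l f T)
    (hG : ∀ i < l, Cp q m (G i) (TG i)) :
    Cp q m (fun v => f fun i => if i < l then G i v else 0)
      (fun v => ∑ i ∈ Finset.range l, TG i v + 1 + T fun i => if i < l then G i v else 0) := by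
  obtain ⟨p, hp⟩ := Cp.exists_block l hG
  obtain ⟨p', hp'⟩ := hf
  refine ⟨.seq p (p'.map fun r => m + r), fun v hv => ?_⟩
  refine RunsIn.seq (hp v hv) ((hp' (fun i => if i < l then G i v else 0) ?_).map_cx
    (fun a b h => by simpa using h) ?_ ?_ ?_)
  · intro r hr
    rw [if_neg (by omega)]
  · intro i
    rw [if_neg (by omega)]
    by_cases h : i < l
    · rw [if_pos (by omega), if_pos h, Nat.add_sub_cancel_left]
    · rw [if_neg (by omega), if_neg h]
  · intro i
    by_cases h : i = 0
    · subst h; simp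
    · rw [Function.update_of_ne (by omega), Function.update_of_ne h, hv _ (by omega)]
  · intro r hr
    have h : r < m := by
      by_contra h
      exact hr (r - m) (by omega)
    rw [if_pos h, Function.update_of_ne h.ne]

/-- A conditional, decided by whether a number is nonzero. -/
theorem Cp.ite {m : ℕ} {c f g Tc Tf Tg : (ℕ → ℕ) → ℕ} (hc : Cp q m c Tc) (hf : Cp q m f Tf)
    (hg : Cp q m g Tg) : Cp q m (fun v => if c v ≠ 0 then f v else g v)
      (fun v => 3 * Tc v + 2 + if c v ≠ 0 then Tf v else Tg v) := by
  obtain ⟨pc, hpc⟩ := id hc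
  obtain ⟨pf, hpf⟩ := hf
  obtain ⟨pg, hpg⟩ := hg
  refine ⟨.seq pc (.case m fun a => .seq (Prog.clear m) (a.elim pg fun _ => pf)), fun v hv => ?_⟩
  have hs := hc.size_le hv
  have h1 := Prog.clear_cx (q := q) (update v m (c v)) m
  have e : update (update v m (c v)) m 0 = v := by
    rw [Function.update_idem, ← hv m le_rfl, Function.update_eq_self]
  rw [e, Function.update_self] at h1
  by_cases h : c v ≠ 0
  · simp only [if_pos h]
    refine (RunsIn.seq (hpc v hv) (RunsIn.case (a := some (bitS ((c v).testBit 0))) ?_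
      (RunsIn.seq h1 (hpf v hv)))).mono (by omega)
    simp [cx, enc_of_ne_zero h]
  · simp only [if_neg h]
    refine (RunsIn.seq (hpc v hv) (RunsIn.case (a := none) ?_
      (RunsIn.seq h1 (hpg v hv)))).mono (by omega)
    rw [not_not] at h
    simp [cx, h, enc_zero]

end ParaCircuit

namespace ParaCircuit

open Function (update)

variable {q : ℕ}

/-! ### Finite-state transducers -/

/-- Puts the bits of a list below the binary digits of a number, the head being the lowest. -/
def appendBits (l : List Bool) (x : ℕ) : ℕ := l.foldr Nat.bit x

/-- The store with the given contents of the first five registers. -/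
def store₅ (a b c d e : List (Sym q)) : Store q
  | 0 => a
  | 1 => b
  | 2 => c
  | 3 => d
  | 4 => e
  | _ => []

section
variable (a b c d e x : List (Sym q))

theorem update_store₅_zero : update (store₅ a b c d e) 0 x = store₅ x b c d e := by
  funext r; rcases r with _ | _ | _ | _ | _ | r <;> rfl

theorem update_store₅_one : update (store₅ a b c d e) 1 x = store₅ a x c d e := by
  funext r; rcases r with _ | _ | _ | _ | _ | r <;> rfl

theorem update_store₅_two : update (store₅ a b c d e) 2 x = store₅ a b x d e := by
  funext r; rcases r with _ | _ | _ | _ | _ | r <;> rfl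

theorem update_store₅_three : update (store₅ a b c d e) 3 x = store₅ a b c x e := by
  funext r; rcases r with _ | _ | _ | _ | _ | r <;> rfl

theorem update_store₅_four : update (store₅ a b c d e) 4 x = store₅ a b c d x := by
  funext r; rcases r with _ | _ | _ | _ | _ | r <;> rfl

end

namespace Prog

/-- Moves the reversed list of bits in register `4` to register `0`, dropping leading zeros. -/
def flush : Prog q := .loop 4 (.case 4 fun a => .case 0 fun z => .seq (.pop 4)
  (if a = some (bitS false) ∧ z = none then .skip else .push 0 (a.getD sepS)))

theorem flush_runsIn (l : List Bool) (x : ℕ) :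
    RunsIn (flush : Prog q) (store₅ (enc x) [] [] [] (l.map bitS).reverse)
      (store₅ (enc (appendBits l x)) [] [] [] []) (5 * l.length + 1) := by
  induction l using List.reverseRecOn generalizing x with
  | nil => exact RunsIn.loop_nil rfl
  | append_singleton l b ih =>
    have h := ih (Nat.bit b x)
    have e : appendBits (l ++ [b]) x = appendBits l (Nat.bit b x) := by simp [appendBits]
    rw [e]
    have e1 : update (store₅ (enc x) [] [] [] ((l ++ [b]).map bitS).reverse : Store q) 4
        (store₅ (enc x) [] [] [] ((l ++ [b]).map bitS).reverse 4).tail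
        = store₅ (enc x) [] [] [] (l.map bitS).reverse := by
      rw [update_store₅_four]
      simp [store₅]
    refine (RunsIn.loop_cons (s₁ := store₅ (enc (Nat.bit b x)) [] [] [] (l.map bitS).reverse) ?_
      (RunsIn.case (a := some (bitS b)) ?_ (RunsIn.case (a := (lsb? x).map bitS) ?_
        (RunsIn.seq (RunsIn.pop e1)
          (s₁ := store₅ (enc x) [] [] [] (l.map bitS).reverse) (t₂ := 1) ?_))) h).mono ?_
    · simp [store₅]
    · simp [store₅]
    · exact enc_head x
    · have e2 : (lsb? x).map (bitS (q := q)) = none ↔ x = 0 := by simp [lsb?]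
      rw [enc_bit]
      by_cases hb : x = 0 ∧ b = false
      · rw [if_pos ⟨by rw [hb.2], e2.2 hb.1⟩, if_pos hb, hb.1, enc_zero]
        exact RunsIn.skip
      · rw [if_neg ?_, if_neg hb]
        · exact RunsIn.push (update_store₅_zero ..)
        · rintro ⟨h1, h2⟩
          refine hb ⟨e2.1 h2, ?_⟩
          simpa using h1
    · simp only [List.length_append, List.length_singleton]
      omega

/-- The bit denoted by a symbol. -/
def bitOf? : Option (Sym q) → Option Bool
  | some (.inl (some b)) => some b
  | _ => none

theorem bitOf?_map (b : Option Bool) : bitOf? (b.map bitS : Option (Sym q)) = b := by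
  cases b <;> rfl

/-- The state denoted by a symbol. -/
def stateOf : Option (Sym q) → Option Bool
  | some (.inl st) => st
  | _ => none

/-- One round of a finite-state transducer: registers `0` and `1` hold the rest of the input,
register `2` the state, register `3` a flag that is removed at the end, and register `4` the
output. -/
def transducerBody (δ : Option Bool → Option Bool → Option Bool → Option Bool × List Bool)
    (fin : Option Bool → List Bool) : Prog q :=
  .case 0 fun a => .case 1 fun b => .case 2 fun s =>
    if a = none ∧ b = none then .seq (.pop 3) (.seq (.pop 2) (pushBits 4 (fin (stateOf s))))
    else .seq (.pop 0) (.seq (.pop 1) (.seq (.pop 2)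
      (.seq (.push 2 (.inl (δ (stateOf s) (bitOf? a) (bitOf? b)).1))
        (pushBits 4 (δ (stateOf s) (bitOf? a) (bitOf? b)).2))))

/-- A finite-state transducer with state set `Option Bool`, which reads two numbers in parallel. -/
def transducer (δ : Option Bool → Option Bool → Option Bool → Option Bool × List Bool)
    (fin : Option Bool → List Bool) (init : Option Bool) : Prog q :=
  .seq (.push 2 (.inl init)) (.seq (.push 3 sepS) (.seq (.loop 3 (transducerBody δ fin)) flush))

theorem transducerBody_end
    (δ : Option Bool → Option Bool → Option Bool → Option Bool × List Bool)
    (fin : Option Bool → List Bool) (hf : ∀ s, (fin s).length ≤ 3) (s : Option Bool)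
    (l : List Bool) :
    RunsIn (transducerBody δ fin : Prog q)
      (store₅ [] [] [.inl s] [sepS] (l.map bitS).reverse)
      (store₅ [] [] [] [] ((l ++ fin s).map bitS).reverse) 9 := by
  refine (RunsIn.case (a := none) rfl (RunsIn.case (a := none) rfl
    (RunsIn.case (a := some (.inl s)) rfl (t := 1 + (1 + 4)) ?_))).mono (by omega)
  rw [if_pos ⟨rfl, rfl⟩]
  refine RunsIn.seq (RunsIn.pop (update_store₅_three ..)) (RunsIn.seq
    (RunsIn.pop (update_store₅_two ..)) ((Prog.pushBits_runsIn _ _ _).congr ?_ |>.mono ?_))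
  · rw [update_store₅_four]
    simp [store₅, stateOf]
  · have := hf s
    simp only [stateOf]
    omega

theorem transducerBody_step
    (δ : Option Bool → Option Bool → Option Bool → Option Bool × List Bool)
    (fin : Option Bool → List Bool) (hδ : ∀ s a b, (δ s a b).2.length ≤ 3) (s : Option Bool)
    (l : List Bool) {x y : ℕ} (hxy : ¬ (x = 0 ∧ y = 0)) :
    RunsIn (transducerBody δ fin : Prog q)
      (store₅ (enc x) (enc y) [.inl s] [sepS] (l.map bitS).reverse)
      (store₅ (enc (x / 2)) (enc (y / 2)) [.inl (δ s (lsb? x) (lsb? y)).1] [sepS]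
        ((l ++ (δ s (lsb? x) (lsb? y)).2).map bitS).reverse) 11 := by
  refine (RunsIn.case (a := (lsb? x).map bitS) ?_ (RunsIn.case (a := (lsb? y).map bitS) ?_
    (RunsIn.case (a := some (.inl s)) rfl (t := 1 + (1 + (1 + (1 + 4)))) ?_))).mono le_rfl
  · exact enc_head x
  · exact enc_head y
  have hn : ¬ ((lsb? x).map (bitS (q := q)) = none ∧ (lsb? y).map (bitS (q := q)) = none) := by
    simpa [lsb?] using hxy
  rw [if_neg hn]
  simp only [bitOf?_map]
  refine RunsIn.seq (RunsIn.pop (update_store₅_zero ..)) (RunsIn.seq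
      (RunsIn.pop (update_store₅_one ..)) (RunsIn.seq
      (RunsIn.pop (update_store₅_two ..)) (RunsIn.seq
      (RunsIn.push (update_store₅_two ..)) ((Prog.pushBits_runsIn _ _ _).congr ?_ |>.mono ?_))))
  · rw [update_store₅_four]
    simp only [store₅, stateOf, enc_tail, List.tail_cons, List.map_append, List.reverse_append]
  · have := hδ s (lsb? x) (lsb? y)
    simp only [stateOf]
    omega

end Prog

open Prog in
/-- A function is computed by a transducer if it satisfies the corresponding recursion equations. -/
theorem Dp.transducer (δ : Option Bool → Option Bool → Option Bool → Option Bool × List Bool)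
    (fin : Option Bool → List Bool) (init : Option Bool) (val : Option Bool → ℕ → ℕ → ℕ)
    (hδ : ∀ s a b, (δ s a b).2.length ≤ 3) (hf : ∀ s, (fin s).length ≤ 3)
    (h0 : ∀ s, val s 0 0 = appendBits (fin s) 0)
    (hs : ∀ s x y, ¬ (x = 0 ∧ y = 0) → val s x y = appendBits (δ s (lsb? x) (lsb? y)).2
      (val (δ s (lsb? x) (lsb? y)).1 (x / 2) (y / 2))) :
    Dp q 2 (fun v => val init (v 0) (v 1)) (fun v => 50 * total 2 v + 50) := by
  refine ⟨Prog.transducer δ fin init, fun v hv => ?_⟩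
  have e : (cx v : Store q) = store₅ (enc (v 0)) (enc (v 1)) [] [] [] := by
    funext r
    rcases r with _ | _ | _ | _ | _ | r <;> simp [cx, store₅, hv, enc_zero]
  have e' : (cx (update (fun _ => 0) 0 (val init (v 0) (v 1))) : Store q)
      = store₅ (enc (val init (v 0) (v 1))) [] [] [] [] := by
    funext r
    rcases r with _ | _ | _ | _ | _ | r <;> simp [cx, store₅, enc_zero]
  have et : total 2 v = (v 0).size + (v 1).size := by simp [total, Finset.sum_range_succ]
  dsimp only
  rw [e, e', et]
  -- in each round the value of the output so far, followed by the output still to come, is the same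
  have main : ∀ (n : ℕ) (s : Option Bool) (x y : ℕ) (l : List Bool), x.size + y.size ≤ n →
      ∃ l' : List Bool, l'.length ≤ l.length + 3 * n + 3 ∧
        appendBits l' 0 = appendBits l (val s x y) ∧
        RunsIn (.loop 3 (transducerBody δ fin) : Prog q)
          (store₅ (enc x) (enc y) [.inl s] [sepS] (l.map bitS).reverse)
          (store₅ [] [] [] [] (l'.map bitS).reverse) (12 * n + 11) := by
    intro n
    induction n with
    | zero =>
      intro s x y l h
      have hx : x = 0 := by
        by_contra h0
        have := size_pos_of_ne_zero h0
        omega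
      have hy : y = 0 := by
        by_contra h0
        have := size_pos_of_ne_zero h0
        omega
      subst hx hy
      refine ⟨l ++ fin s, by have := hf s; simp; omega, by simp [appendBits, h0], ?_⟩
      have h1 := transducerBody_end (q := q) δ fin hf s l
      rw [enc_zero]
      exact (RunsIn.loop_cons (by simp [store₅]) h1 (RunsIn.loop_nil rfl)).mono (by omega)
    | succ n ih =>
      intro s x y l h
      by_cases hxy : x = 0 ∧ y = 0
      · obtain ⟨l', h1, h2, h3⟩ := ih s x y l (by simp [hxy.1, hxy.2])
        exact ⟨l', by omega, h2, h3.mono (by omega)⟩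
      · obtain ⟨l', h1, h2, h3⟩ := ih (δ s (lsb? x) (lsb? y)).1 (x / 2) (y / 2)
          (l ++ (δ s (lsb? x) (lsb? y)).2) (by
            rw [size_div_two, size_div_two]
            rcases not_and_or.1 hxy with h0 | h0
            · have := size_pos_of_ne_zero h0
              omega
            · have := size_pos_of_ne_zero h0
              omega)
        have h4 := hδ s (lsb? x) (lsb? y)
        refine ⟨l', by rw [List.length_append] at h1; omega, ?_, ?_⟩
        · rw [h2, hs s x y hxy]
          simp [appendBits]
        · exact (RunsIn.loop_cons (by simp [store₅]) (transducerBody_step δ fin hδ s l hxy)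
            h3).mono (by omega)
  obtain ⟨l', h1, h2, h3⟩ := main _ init (v 0) (v 1) [] le_rfl
  have h4 := flush_runsIn (q := q) l' 0
  rw [h2, enc_zero] at h4
  refine (RunsIn.seq (RunsIn.push (update_store₅_two ..)) (RunsIn.seq
    (RunsIn.push (update_store₅_three ..)) (RunsIn.seq h3 h4))).mono ?_
  simp only [List.length_nil] at h1
  omega

end ParaCircuit

namespace ParaCircuit

open Function (update)

variable {q : ℕ}

/-! ### Interleaving of binary digits -/

theorem deinterleave_eq (m : ℕ) : deinterleave m =
    (2 * (deinterleave (m / 4)).1 + m % 2, 2 * (deinterleave (m / 4)).2 + m / 2 % 2) := by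
  by_cases h : m = 0
  · subst h
    have : deinterleave 0 = (0, 0) := by rw [deinterleave]; simp
    simp [this]
  · conv_lhs => rw [deinterleave]
    rw [dif_neg h]

theorem deinterleave_zero : deinterleave 0 = (0, 0) := by rw [deinterleave]; simp

/-- Interleaves the binary digits of two numbers; inverse to `deinterleave`. -/
def interleave (x y : ℕ) : ℕ :=
  if x = 0 ∧ y = 0 then 0
  else 4 * interleave (x / 2) (y / 2) + 2 * (y % 2) + x % 2
termination_by x + y
decreasing_by omega

theorem interleave_eq (x y : ℕ) :
    interleave x y = 4 * interleave (x / 2) (y / 2) + 2 * (y % 2) + x % 2 := by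
  by_cases h : x = 0 ∧ y = 0
  · rw [h.1, h.2]
    have : interleave 0 0 = 0 := by rw [interleave]; simp
    simp [this]
  · conv_lhs => rw [interleave]
    rw [if_neg h]

theorem interleave_zero : interleave 0 0 = 0 := by rw [interleave]; simp

theorem deinterleave_interleave (x y : ℕ) : deinterleave (interleave x y) = (x, y) := by
  induction h : x + y using Nat.strong_induction_on generalizing x y with
  | _ n ih =>
    by_cases h0 : x = 0 ∧ y = 0
    · rw [h0.1, h0.2, interleave_zero, deinterleave_zero]
    · rw [deinterleave_eq, interleave_eq]
      have e1 : (4 * interleave (x / 2) (y / 2) + 2 * (y % 2) + x % 2) / 4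
          = interleave (x / 2) (y / 2) := by omega
      rw [e1, ih (x / 2 + y / 2) (by omega) _ _ rfl]
      ext <;> simp only <;> omega

theorem interleave_deinterleave (m : ℕ) :
    interleave (deinterleave m).1 (deinterleave m).2 = m := by
  induction m using Nat.strong_induction_on with
  | _ m ih =>
    by_cases h0 : m = 0
    · rw [h0, deinterleave_zero, interleave_zero]
    · rw [interleave_eq, deinterleave_eq]
      have e1 : (2 * (deinterleave (m / 4)).1 + m % 2) / 2 = (deinterleave (m / 4)).1 := by omega
      have e2 : (2 * (deinterleave (m / 4)).2 + m / 2 % 2) / 2 = (deinterleave (m / 4)).2 := by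
        omega
      simp only [e1, e2, ih (m / 4) (by omega)]
      omega

theorem interleave_lt {L x y : ℕ} (hx : x < 2 ^ L) (hy : y < 2 ^ L) : interleave x y < 4 ^ L := by
  induction L generalizing x y with
  | zero =>
    have h1 : x = 0 := by simpa using hx
    have h2 : y = 0 := by simpa using hy
    rw [h1, h2, interleave_zero]
    simp
  | succ L ih =>
    rw [pow_succ] at *
    have := ih (x := x / 2) (y := y / 2) (by omega) (by omega)
    rw [interleave_eq]
    omega

theorem deinterleave_lt {L m : ℕ} (h : m < 4 ^ L) :
    (deinterleave m).1 < 2 ^ L ∧ (deinterleave m).2 < 2 ^ L := by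
  induction L generalizing m with
  | zero =>
    have h1 : m = 0 := by simpa using h
    rw [h1, deinterleave_zero]
    simp
  | succ L ih =>
    rw [pow_succ] at *
    have := ih (m := m / 4) (by omega)
    rw [deinterleave_eq]
    constructor <;> simp only <;> omega

theorem interleave_lt_iff {L x y : ℕ} : interleave x y < 4 ^ L ↔ x < 2 ^ L ∧ y < 2 ^ L := by
  refine ⟨fun h => ?_, fun h => interleave_lt h.1 h.2⟩
  simpa [deinterleave_interleave] using deinterleave_lt h

theorem testBit_eq (x i : ℕ) : x.testBit i = decide (x / 2 ^ i % 2 = 1) := by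
  rw [Nat.testBit_eq_decide_div_mod_eq]

theorem testBit_deinterleave (m i : ℕ) :
    (deinterleave m).1.testBit i = m.testBit (2 * i) ∧
      (deinterleave m).2.testBit i = m.testBit (2 * i + 1) := by
  induction i generalizing m with
  | zero =>
    rw [deinterleave_eq]
    simp only [testBit_eq]
    constructor
    · congr 2
      simp
    · congr 2
      simp
  | succ i ih =>
    rw [deinterleave_eq]
    have h := ih (m / 4)
    have e1 : (2 * (deinterleave (m / 4)).1 + m % 2) / 2 = (deinterleave (m / 4)).1 := by omega
    have e2 : (2 * (deinterleave (m / 4)).2 + m / 2 % 2) / 2 = (deinterleave (m / 4)).2 := by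
      omega
    rw [Nat.testBit_succ, Nat.testBit_succ, e1, e2, h.1, h.2]
    have e3 : m / 4 = m / 2 / 2 := by omega
    rw [show 2 * (i + 1) = 2 * i + 1 + 1 by ring, show 2 * i + 1 + 1 + 1 = (2 * i + 1) + 1 + 1 by ring]
    simp only [Nat.testBit_succ, e3]
    exact ⟨trivial, trivial⟩

theorem toNat_decide_mod_two (x : ℕ) : (decide (x % 2 = 1)).toNat = x % 2 := by
  rcases Nat.mod_two_eq_zero_or_one x with h | h <;> simp [h]

/-! ### Basic functions computed by transducers -/

theorem lsb?_getD (x : ℕ) : (lsb? x).getD false = x.testBit 0 := by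
  unfold lsb?
  split_ifs with h
  · simp [h]
  · rfl

theorem bit_eq (b : Bool) (x : ℕ) : Nat.bit b x = 2 * x + b.toNat := by
  rw [Nat.bit_val]

theorem toNat_testBit_zero (x : ℕ) : (x.testBit 0).toNat = x % 2 := by
  rw [Nat.testBit_zero]
  rcases Nat.mod_two_eq_zero_or_one x with h | h <;> simp [h]

theorem Dp.eq : Dp q 2 (fun v => if v 0 = v 1 then 1 else 0) (fun v => 50 * total 2 v + 50) := by
  have h := Dp.transducer (q := q)
    (fun s a b => if a.getD false = b.getD false then (s, []) else (some false, []))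
    (fun s => if s = some true then [true] else []) (some true)
    (fun s x y => if s = some true ∧ x = y then 1 else 0)
    (fun s a b => by split_ifs <;> simp) (fun s => by split_ifs <;> simp)
    (fun s => by by_cases h : s = some true <;> simp [h, appendBits]) ?_
  · simpa using h
  · intro s x y _
    simp only [lsb?_getD]
    have e : x = y ↔ x.testBit 0 = y.testBit 0 ∧ x / 2 = y / 2 := by
      simp only [Nat.testBit_zero, decide_eq_decide]
      omega
    by_cases h : x.testBit 0 = y.testBit 0
    · rw [if_pos h]
      simp only [e, h, true_and]
      rfl
    · rw [if_neg h]
      simp only [e, h, false_and, and_false, if_false]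
      simp [appendBits]

theorem Dp.lt : Dp q 2 (fun v => if v 0 < v 1 then 1 else 0) (fun v => 50 * total 2 v + 50) := by
  have h := Dp.transducer (q := q)
    (fun s a b => if a.getD false = b.getD false then (s, []) else (some (b.getD false), []))
    (fun s => if s = some true then [true] else []) (some false)
    (fun s x y => if x < y ∨ (x = y ∧ s = some true) then 1 else 0)
    (fun s a b => by split_ifs <;> simp) (fun s => by split_ifs <;> simp)
    (fun s => by by_cases h : s = some true <;> simp [h, appendBits]) ?_
  · simpa using h
  · intro s x y _
    simp only [lsb?_getD]
    by_cases h : x.testBit 0 = y.testBit 0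
    · rw [if_pos h]
      simp only [appendBits, List.foldr_nil]
      simp only [Nat.testBit_zero, decide_eq_decide] at h
      congr 1
      by_cases hs : s = some true <;> simp only [hs, eq_iff_iff] <;> simp <;> omega
    · rw [if_neg h]
      simp only [appendBits, List.foldr_nil]
      congr 1
      simp only [Nat.testBit_zero, decide_eq_decide, Option.some.injEq, decide_eq_true_eq,
        eq_iff_iff] at h ⊢
      omega

theorem Dp.add : Dp q 2 (fun v => v 0 + v 1) (fun v => 50 * total 2 v + 50) := by
  have h := Dp.transducer (q := q)
    (fun s a b => (some (decide (2 ≤ (a.getD false).toNat + (b.getD false).toNat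
        + (s.getD false).toNat)),
      [decide (((a.getD false).toNat + (b.getD false).toNat + (s.getD false).toNat) % 2 = 1)]))
    (fun s => [s.getD false]) (some false)
    (fun s x y => x + y + (s.getD false).toNat)
    (fun s a b => by simp) (fun s => by simp)
    (fun s => by simp [appendBits, bit_eq]) ?_
  · simpa using h
  · intro s x y _
    simp only [lsb?_getD, toNat_testBit_zero, appendBits, List.foldr_cons, List.foldr_nil, bit_eq,
      Option.getD_some]
    have := Bool.toNat_lt (s.getD false)
    generalize (s.getD false).toNat = c at *
    by_cases h1 : 2 ≤ x % 2 + y % 2 + c <;> by_cases h2 : (x % 2 + y % 2 + c) % 2 = 1 <;>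
      simp [h1, h2] <;> omega

theorem Dp.interleave :
    Dp q 2 (fun v => interleave (v 0) (v 1)) (fun v => 50 * total 2 v + 50) := by
  refine Dp.transducer (q := q) (fun s a b => (s, [a.getD false, b.getD false])) (fun _ => []) none
    (fun s x y => ParaCircuit.interleave x y) (fun s a b => by simp) (fun s => by simp)
    (fun s => by simp [appendBits, interleave_zero]) ?_
  intro s x y _
  simp only [lsb?_getD, appendBits, List.foldr_cons, List.foldr_nil, bit_eq, toNat_testBit_zero]
  rw [interleave_eq x y]
  ring

theorem Dp.deinterleave_fst :
    Dp q 2 (fun v => (deinterleave (v 0)).1) (fun v => 50 * total 2 v + 50) := by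
  refine Dp.transducer (q := q) (fun s a _ => if s = none then (some true, [a.getD false])
      else (none, [])) (fun _ => []) none
    (fun s x y => if s = none then (deinterleave x).1 else (deinterleave (x / 2)).1)
    (fun s a b => by split_ifs <;> simp) (fun s => by simp)
    (fun s => by simp [appendBits, deinterleave_zero]) ?_
  intro s x y _
  have e : x / 2 / 2 = x / 4 := by omega
  by_cases h : s = none
  · simp only [if_pos h, appendBits, lsb?_getD, List.foldr_cons, List.foldr_nil, bit_eq,
      toNat_testBit_zero]
    rw [deinterleave_eq x]
    simp [e]
  · simp [h, appendBits]

theorem Dp.deinterleave_snd :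
    Dp q 2 (fun v => (deinterleave (v 0)).2) (fun v => 50 * total 2 v + 50) := by
  refine Dp.transducer (q := q) (fun s a _ => if s = none then (some true, [])
      else (none, [a.getD false])) (fun _ => []) none
    (fun s x y => if s = none then (deinterleave x).2 else 2 * (deinterleave (x / 2)).2 + x % 2)
    (fun s a b => by split_ifs <;> simp) (fun s => by simp)
    (fun s => by simp [appendBits, deinterleave_zero]) ?_
  intro s x y _
  have e : x / 2 / 2 = x / 4 := by omega
  by_cases h : s = none
  · simp only [if_pos h, appendBits, List.foldr_nil]
    rw [deinterleave_eq x]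
    simp [e]
  · simp [h, appendBits, lsb?_getD, bit_eq, toNat_decide_mod_two]

theorem Dp.bit (b : Bool) :
    Dp q 2 (fun v => Nat.bit b (v 0)) (fun v => 50 * total 2 v + 50) := by
  refine Dp.transducer (q := q) (fun s a _ => if s = none then (some true, [b, a.getD false])
      else (some true, [a.getD false])) (fun s => if s = none then [b] else []) none
    (fun s x y => if s = none then Nat.bit b x else x)
    (fun s a b => by split_ifs <;> simp) (fun s => by split_ifs <;> simp)
    (fun s => by split_ifs <;> simp [appendBits]) ?_
  intro s x y _
  by_cases h : s = none
  · simp [h, appendBits, lsb?_getD, bit_eq, toNat_decide_mod_two]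
    omega
  · simp [h, appendBits, lsb?_getD, bit_eq, toNat_decide_mod_two]
    omega

theorem Dp.div_two : Dp q 2 (fun v => v 0 / 2) (fun v => 50 * total 2 v + 50) := by
  refine Dp.transducer (q := q) (fun s a _ => if s = none then (some true, [])
      else (some true, [a.getD false])) (fun s => []) none
    (fun s x y => if s = none then x / 2 else x)
    (fun s a b => by split_ifs <;> simp) (fun s => by simp)
    (fun s => by split_ifs <;> simp [appendBits]) ?_
  intro s x y _
  by_cases h : s = none
  · simp [h, appendBits]
  · simp [h, appendBits, lsb?_getD, bit_eq, toNat_decide_mod_two]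
    omega

theorem Dp.mod_two : Dp q 2 (fun v => v 0 % 2) (fun v => 50 * total 2 v + 50) := by
  refine Dp.transducer (q := q) (fun s a _ => if s = none then (some true, [a.getD false])
      else (some true, [])) (fun s => []) none
    (fun s x y => if s = none then x % 2 else 0)
    (fun s a b => by split_ifs <;> simp) (fun s => by simp)
    (fun s => by split_ifs <;> simp [appendBits]) ?_
  intro s x y _
  by_cases h : s = none
  · simp [h, appendBits, lsb?_getD, bit_eq, toNat_decide_mod_two]
  · simp [h, appendBits]

theorem Dp.two_pow_size :
    Dp q 2 (fun v => 2 ^ ((v 0).size + (v 1).size)) (fun v => 50 * total 2 v + 50) := by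
  refine Dp.transducer (q := q) (fun s a b => (s, (a.elim [] fun _ => [false])
      ++ (b.elim [] fun _ => [false]))) (fun s => [true]) none
    (fun s x y => 2 ^ (x.size + y.size))
    (fun s a b => by cases a <;> cases b <;> simp) (fun s => by simp)
    (fun s => by simp [appendBits]) ?_
  intro s x y h
  have key : ∀ x : ℕ, x ≠ 0 → x.size = (x / 2).size + 1 := fun x hx => by
    have := size_pos_of_ne_zero hx
    rw [size_div_two]
    omega
  by_cases hx : x = 0 <;> by_cases hy : y = 0
  · exact absurd ⟨hx, hy⟩ h
  · rw [key y hy]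
    simp [hx, hy, lsb?, appendBits, bit_eq]
    ring
  · rw [key x hx]
    simp [hx, hy, lsb?, appendBits, bit_eq]
    ring
  · rw [key x hx, key y hy]
    simp [hx, hy, lsb?, appendBits, bit_eq]
    ring

end ParaCircuit

namespace ParaCircuit

open Function (update)

variable {q : ℕ}

/-! ### Access to single bits -/

theorem size_deinterleave_le (w : ℕ) :
    (deinterleave w).1.size ≤ (w.size + 1) / 2 ∧ (deinterleave w).2.size ≤ (w.size + 1) / 2 := by
  have h : w < 4 ^ ((w.size + 1) / 2) := by
    refine (Nat.lt_size_self w).trans_le ?_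
    rw [show (4 : ℕ) = 2 ^ 2 by norm_num, ← pow_mul]
    exact Nat.pow_le_pow_right (by norm_num) (by omega)
  exact ⟨Nat.size_le.2 (deinterleave_lt h).1, Nat.size_le.2 (deinterleave_lt h).2⟩

/-- The registers holding the two given numbers. -/
def regs₂ (w j : ℕ) : ℕ → ℕ := fun r => if r = 0 then w else if r = 1 then j else 0

/-- A bit is selected by following the binary digits of its position; the digits at even or odd
positions of the number are kept in each round, so that the lengths form a geometric series. -/
theorem Dp.testBit : Dp q 2 (fun v => ((v 0).testBit (v 1)).toNat)
    (fun v => 200 * total 2 v + 200) := by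
  obtain ⟨p₁, h₁⟩ := Dp.deinterleave_fst (q := q)
  obtain ⟨p₂, h₂⟩ := Dp.deinterleave_snd (q := q)
  obtain ⟨p₃, h₃⟩ := Dp.mod_two (q := q)
  -- the renaming frees register `1`, which holds the rest of the position
  set ρ : ℕ → ℕ := fun r => if r = 0 then 0 else r + 1 with hρ
  set body : Prog q := .case 1 fun a => .seq (.pop 1)
    (if a = some (bitS true) then p₂.map ρ else p₁.map ρ) with hbody
  have inj : ρ.Injective := by
    intro a b h
    simp only [hρ] at h
    split_ifs at h <;> omega
  have tot : ∀ w j, total 2 (regs₂ w j) = w.size + j.size := by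
    intro w j
    simp [total, Finset.sum_range_succ, regs₂]
  have half : ∀ (p : Prog q) (f : ℕ → ℕ), (∀ v, (∀ r, 2 ≤ r → v r = 0) →
      RunsIn p (cx v) (cx (update (fun _ => 0) 0 (f (v 0)))) (50 * total 2 v + 50)) →
      ∀ w j, RunsIn (p.map ρ) (cx (regs₂ w j)) (cx (regs₂ (f w) j)) (50 * w.size + 50) := by
    intro p f hp w j
    have h := hp (regs₂ w 0) (fun r hr => by simp only [regs₂]; split_ifs <;> omega)
    rw [tot, Nat.size_zero] at h
    refine h.map_cx inj ?_ ?_ ?_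
    · intro i
      by_cases hi : i = 0
      · simp [hi, regs₂, hρ]
      · simp [hi, regs₂, hρ]
    · intro i
      by_cases hi : i = 0
      · simp [hi, regs₂, hρ]
      · simp [hi, regs₂, hρ]
    · intro r hr
      have h1 : r = 1 := by
        by_contra h1
        by_cases h0 : r = 0
        · exact hr 0 (by simp [hρ, h0])
        · exact hr (r - 1) (by simp only [hρ]; rw [if_neg (by omega)]; omega)
      simp [h1, regs₂]
  -- each round halves the length of `w`, so that the time is linear although there are several
  -- rounds
  have loop : ∀ (n w j : ℕ), j.size = n → ∃ w', w'.size ≤ w.size ∧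
      w'.testBit 0 = w.testBit j ∧
      RunsIn (.loop 1 body) (cx (regs₂ w j)) (cx (regs₂ w' 0)) (100 * w.size + 110 * n + 1) := by
    intro n
    induction n with
    | zero =>
      intro w j hj
      have hj : j = 0 := by
        by_contra h0
        have := size_pos_of_ne_zero h0
        omega
      subst hj
      exact ⟨w, le_rfl, rfl, (RunsIn.loop_nil (by simp [cx, regs₂, enc_zero])).mono (by omega)⟩
    | succ n ih =>
      intro w j hj
      have hj0 : j ≠ 0 := by
        rintro rfl
        simp at hj
      have hj2 : (j / 2).size = n := by rw [size_div_two]; omega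
      have pop : RunsIn (.pop 1 : Prog q) (cx (regs₂ w j)) (cx (regs₂ w (j / 2))) 1 := by
        refine RunsIn.pop ?_
        have : (cx (regs₂ w j) : Store q) 1 = enc j := by simp [cx, regs₂]
        rw [this, enc_tail, update_cx]
        congr 1
        funext r
        by_cases hr : r = 1
        · subst hr; simp [regs₂]
        · simp [regs₂, hr]
      have head : ((cx (regs₂ w j) : Store q) 1).head? = some (bitS (j.testBit 0)) := by
        simp [cx, regs₂, enc_of_ne_zero hj0]
      have ne : (cx (regs₂ w j) : Store q) 1 ≠ [] := by
        simp [cx, regs₂, enc_eq_nil, hj0]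
      have hs := size_deinterleave_le w
      have hb := testBit_deinterleave w (j / 2)
      by_cases hbit : j.testBit 0 = true
      · obtain ⟨w', e1, e2, e3⟩ := ih (deinterleave w).2 (j / 2) hj2
        refine ⟨w', by omega, ?_, ?_⟩
        · rw [e2, hb.2]
          congr 1
          simp only [Nat.testBit_zero, decide_eq_true_eq] at hbit
          omega
        · refine (RunsIn.loop_cons ne (RunsIn.case head (RunsIn.seq pop
            (s₂ := cx (regs₂ (deinterleave w).2 (j / 2))) (t₂ := 50 * w.size + 50) ?_)) e3).mono ?_
          · rw [hbit, if_pos rfl]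
            exact half p₂ (fun w => (deinterleave w).2) h₂ w (j / 2)
          · omega
      · obtain ⟨w', e1, e2, e3⟩ := ih (deinterleave w).1 (j / 2) hj2
        refine ⟨w', by omega, ?_, ?_⟩
        · rw [e2, hb.1]
          congr 1
          simp only [Nat.testBit_zero, decide_eq_true_eq] at hbit
          omega
        · refine (RunsIn.loop_cons ne (RunsIn.case head (RunsIn.seq pop
            (s₂ := cx (regs₂ (deinterleave w).1 (j / 2))) (t₂ := 50 * w.size + 50) ?_)) e3).mono ?_
          · rw [if_neg (by simpa using hbit)]
            exact half p₁ (fun w => (deinterleave w).1) h₁ w (j / 2)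
          · omega
  refine ⟨.seq (.loop 1 body) p₃, fun v hv => ?_⟩
  have ev : v = regs₂ (v 0) (v 1) := by
    funext r
    rcases r with _ | _ | r
    · rfl
    · rfl
    · exact hv _ (by omega)
  obtain ⟨w', e1, e2, e3⟩ := loop _ (v 0) (v 1) rfl
  have e4 := h₃ (regs₂ w' 0) (fun r hr => by simp only [regs₂]; split_ifs <;> omega)
  dsimp only at e4
  rw [tot, Nat.size_zero] at e4
  rw [ev]
  refine ((RunsIn.seq e3 e4).congr ?_).mono ?_
  · congr 2
    change w' % 2 = ((v 0).testBit (v 1)).toNat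
    rw [← e2, toNat_testBit_zero]
  · dsimp only
    rw [tot]
    omega

/-! ### Linear time relative to a parameter -/

/-- The function `f` of the registers below `m` is computable in time linear in the total length of
its arguments, up to an additional term that is a computable function of the number in
register `0`. -/
def PT (q m : ℕ) (f : (ℕ → ℕ) → ℕ) : Prop :=
  ∃ (F : ℕ → ℕ) (c : ℕ), Computable F ∧ Cp q m f fun v => F (v 0) + c * total m v

theorem Computable.natAdd {F G : ℕ → ℕ} (hF : Computable F) (hG : Computable G) :
    Computable fun n => F n + G n := Primrec.nat_add.to_comp.comp hF hG

theorem Computable.natMul {F G : ℕ → ℕ} (hF : Computable F) (hG : Computable G) :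
    Computable fun n => F n * G n := Primrec.nat_mul.to_comp.comp hF hG

namespace PT

variable {m l : ℕ} {f g h : (ℕ → ℕ) → ℕ}

theorem congr {f' : (ℕ → ℕ) → ℕ} (hf : PT q m f) (e : ∀ v, f v = f' v) : PT q m f' := by
  rwa [← funext e]

theorem proj {i : ℕ} (hi : i < m) : PT q m fun v => v i := by
  refine ⟨fun _ => 2, 9, Computable.const 2, (Cp.proj hi).mono fun v _ => ?_⟩
  have := size_le_total hi v
  dsimp only
  omega

theorem const (x : ℕ) : PT q m fun _ => x :=
  ⟨fun _ => x.size + 1, 0, Computable.const _, (Cp.const m x).mono fun v _ => by dsimp only; omega⟩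

/-- Finitely many functions have a common time bound. -/
theorem exists_common {G : ℕ → (ℕ → ℕ) → ℕ} (hG : ∀ i < l, PT q m (G i)) :
    ∃ (F : ℕ → ℕ) (c : ℕ), Computable F ∧
      ∀ i < l, Cp q m (G i) fun v => F (v 0) + c * total m v := by
  induction l with
  | zero => exact ⟨fun _ => 0, 0, Computable.const 0, fun i hi => absurd hi (by omega)⟩
  | succ l ih =>
    obtain ⟨F, c, hF, h⟩ := ih fun i hi => hG i (by omega)
    obtain ⟨F', c', hF', h'⟩ := hG l (by omega)
    refine ⟨fun n => F n + F' n, c + c', Computable.natAdd hF hF', fun i hi => ?_⟩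
    rcases Nat.lt_succ_iff_lt_or_eq.1 hi with hi | rfl
    · exact (h i hi).mono fun v _ => by dsimp only; rw [add_mul]; omega
    · exact h'.mono fun v _ => by dsimp only; rw [add_mul]; omega

/-- Composition with a function that consumes its arguments: either register `0` is passed on, or
the additional time `Ff` does not depend on it. -/
theorem comp_aux {G : ℕ → (ℕ → ℕ) → ℕ} {Ff : ℕ → ℕ} {cf : ℕ} (hFf : Computable Ff)
    (hf : Dp q l f fun v => Ff (v 0) + cf * total l v) (hG : ∀ i < l, PT q m (G i))
    (h0 : (∀ v, G 0 v = v 0) ∧ 0 < l ∨ ∀ x, Ff x = Ff 0) :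
    PT q m fun v => f fun i => if i < l then G i v else 0 := by
  obtain ⟨F, c, hF, h⟩ := exists_common hG
  refine ⟨fun k => l * F k + 1 + Ff k + cf * (l * F k), l * c + cf * (l * c), ?_,
    (hf.comp h).mono fun v hv => ?_⟩
  · have h1 := Computable.natMul (Computable.const l) hF
    exact Computable.natAdd (Computable.natAdd (Computable.natAdd h1 (Computable.const 1)) hFf)
      (Computable.natMul (Computable.const cf) h1)
  · dsimp only
    have e1 : ∑ i ∈ Finset.range l, (F (v 0) + c * total m v) = l * F (v 0) + l * c * total m v := by
      rw [Finset.sum_const, Finset.card_range, smul_eq_mul]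
      ring
    have e2 : total l (fun i => if i < l then G i v else 0) ≤ l * F (v 0) + l * c * total m v := by
      rw [← e1]
      refine Finset.sum_le_sum fun i hi => ?_
      rw [Finset.mem_range] at hi
      dsimp only
      rw [if_pos hi]
      exact (h i hi).size_le hv
    have e3 : Ff (if 0 < l then G 0 v else 0) = Ff (v 0) := by
      rcases h0 with h0 | h0
      · rw [if_pos h0.2, h0.1]
      · rw [h0, h0 (v 0)]
    rw [e1, e3]
    have e4 := Nat.mul_le_mul_left cf e2
    calc _ ≤ l * F (v 0) + l * c * total m v + 1
          + (Ff (v 0) + cf * (l * F (v 0) + l * c * total m v)) := by omega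
      _ = _ := by ring

/-- Composition; register `0`, which holds the parameter, has to be preserved. -/
theorem comp (hf : PT q l f) {G : ℕ → (ℕ → ℕ) → ℕ} (hl : 0 < l) (hG : ∀ i < l, PT q m (G i))
    (h0 : ∀ v, G 0 v = v 0) : PT q m fun v => f fun i => if i < l then G i v else 0 := by
  obtain ⟨Ff, cf, hFf, hf⟩ := hf
  refine comp_aux (Ff := fun k => 9 * Ff k + (l + 3)) (cf := 9 * cf + 2) ?_
    (hf.dp.mono fun v _ => ?_) hG (Or.inl ⟨h0, hl⟩)
  · exact Computable.natAdd (Computable.natMul (Computable.const 9) hFf) (Computable.const _)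
  · rw [add_mul, mul_add, mul_assoc]
    omega

/-- A function computed by a transducer may be applied to any two values, as its time does not
depend on the parameter. -/
theorem lift₂ {f : ℕ → ℕ → ℕ} {c : ℕ} (hf : Dp q 2 (fun v => f (v 0) (v 1))
    fun v => c * total 2 v + c) (hg : PT q m g) (hh : PT q m h) :
    PT q m fun v => f (g v) (h v) := by
  refine (comp_aux (l := 2) (Ff := fun _ => c) (cf := c) (G := fun i => if i = 0 then g else h)
    (Computable.const c) (hf.mono fun v _ => by omega) (fun i _ => ?_)
    (Or.inr fun _ => rfl)).congr fun v => ?_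
  · split_ifs
    · exact hg
    · exact hh
  · simp

theorem ite_ne_zero (hf : PT q m f) (hg : PT q m g) (hh : PT q m h) :
    PT q m fun v => if f v ≠ 0 then g v else h v := by
  obtain ⟨F, c, hF, hf⟩ := hf
  obtain ⟨F', c', hF', hg⟩ := hg
  obtain ⟨F'', c'', hF'', hh⟩ := hh
  refine ⟨fun k => 3 * F k + 2 + F' k + F'' k, 3 * c + c' + c'', ?_,
    (hf.ite hg hh).mono fun v _ => ?_⟩
  · exact Computable.natAdd (Computable.natAdd (Computable.natAdd (Computable.natMul
      (Computable.const 3) hF) (Computable.const 2)) hF') hF''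
  · dsimp only
    rw [add_mul, add_mul, mul_assoc]
    split_ifs <;> omega

theorem add (hg : PT q m g) (hh : PT q m h) : PT q m fun v => g v + h v :=
  lift₂ (f := fun x y => x + y) Dp.add hg hh

theorem interleave (hg : PT q m g) (hh : PT q m h) :
    PT q m fun v => interleave (g v) (h v) :=
  lift₂ (f := fun x y => ParaCircuit.interleave x y) Dp.interleave hg hh

theorem deinterleave_fst (hg : PT q m g) : PT q m fun v => (deinterleave (g v)).1 :=
  lift₂ (f := fun x _ => (deinterleave x).1) Dp.deinterleave_fst hg (const 0)

theorem deinterleave_snd (hg : PT q m g) : PT q m fun v => (deinterleave (g v)).2 :=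
  lift₂ (f := fun x _ => (deinterleave x).2) Dp.deinterleave_snd hg (const 0)

theorem bit (b : Bool) (hg : PT q m g) : PT q m fun v => Nat.bit b (g v) :=
  lift₂ (f := fun x _ => Nat.bit b x) (Dp.bit b) hg (const 0)

theorem div_two (hg : PT q m g) : PT q m fun v => g v / 2 :=
  lift₂ (f := fun x _ => x / 2) Dp.div_two hg (const 0)

theorem mod_two (hg : PT q m g) : PT q m fun v => g v % 2 :=
  lift₂ (f := fun x _ => x % 2) Dp.mod_two hg (const 0)

theorem two_pow_size (hg : PT q m g) (hh : PT q m h) :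
    PT q m fun v => 2 ^ ((g v).size + (h v).size) :=
  lift₂ (f := fun x y => 2 ^ (x.size + y.size)) Dp.two_pow_size hg hh

theorem two_mul (hg : PT q m g) : PT q m fun v => 2 * g v :=
  (bit false hg).congr fun v => by simp [bit_eq]

/-- Multiplication by a constant power of two. -/
theorem two_pow_mul (k : ℕ) (hg : PT q m g) : PT q m fun v => 2 ^ k * g v := by
  induction k with
  | zero => exact hg.congr fun v => by simp
  | succ k ih => exact (two_mul ih).congr fun v => by rw [pow_succ]; ring

theorem div_two_pow (k : ℕ) (hg : PT q m g) : PT q m fun v => g v / 2 ^ k := by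
  induction k with
  | zero => exact hg.congr fun v => by simp
  | succ k ih => exact (div_two ih).congr fun v => by rw [pow_succ, Nat.div_div_eq_div_mul]

theorem mod_two_pow (k : ℕ) (hg : PT q m g) : PT q m fun v => g v % 2 ^ k := by
  induction k generalizing g with
  | zero => exact (const 0).congr fun v => by simp [Nat.mod_one]
  | succ k ih =>
    refine (add (mod_two hg) (two_mul (ih (div_two hg)))).congr fun v => ?_
    rw [pow_succ', Nat.mod_mul]

end PT

/-! ### Predicates -/

open Classical in
/-- The predicate `P` of the registers below `m` is decidable in time linear in the total length of
its arguments, up to a computable function of the number in register `0`. -/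
def PB (q m : ℕ) (P : (ℕ → ℕ) → Prop) : Prop := PT q m fun v => if P v then 1 else 0

namespace PB

variable {m l : ℕ} {P P' : (ℕ → ℕ) → Prop} {g h : (ℕ → ℕ) → ℕ}

theorem congr (hP : PB q m P) (e : ∀ v, P v ↔ P' v) : PB q m P' := by
  rwa [← funext fun v => propext (e v)]

theorem ite [∀ v, Decidable (P v)] (hP : PB q m P) (hg : PT q m g) (hh : PT q m h) :
    PT q m fun v => if P v then g v else h v :=
  (PT.ite_ne_zero hP hg hh).congr fun v => by by_cases h : P v <;> simp [h]

theorem const (P : Prop) : PB q m fun _ => P := by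
  unfold PB
  by_cases h : P <;> simp only [h, if_true, if_false]
  · exact PT.const 1
  · exact PT.const 0

theorem and (hP : PB q m P) (hP' : PB q m P') : PB q m fun v => P v ∧ P' v := by
  classical
  refine (ite hP hP' (PT.const 0)).congr fun v => ?_
  by_cases h : P v <;> simp [h]

theorem not (hP : PB q m P) : PB q m fun v => ¬ P v := by
  classical
  refine (ite hP (PT.const 0) (PT.const 1)).congr fun v => ?_
  by_cases h : P v <;> simp [h]

theorem or (hP : PB q m P) (hP' : PB q m P') : PB q m fun v => P v ∨ P' v := by
  classical
  refine (ite hP (PT.const 1) hP').congr fun v => ?_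
  by_cases h : P v <;> simp [h]

theorem imp (hP : PB q m P) (hP' : PB q m P') : PB q m fun v => P v → P' v :=
  ((not hP).or hP').congr fun v => by tauto

theorem eq (hg : PT q m g) (hh : PT q m h) : PB q m fun v => g v = h v := by
  classical
  exact (PT.lift₂ (f := fun x y => if x = y then 1 else 0) Dp.eq hg hh).congr fun v => by
    congr

theorem lt (hg : PT q m g) (hh : PT q m h) : PB q m fun v => g v < h v := by
  classical
  exact (PT.lift₂ (f := fun x y => if x < y then 1 else 0) Dp.lt hg hh).congr fun v => by
    congr

theorem le (hg : PT q m g) (hh : PT q m h) : PB q m fun v => g v ≤ h v :=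
  (not (lt hh hg)).congr fun v => by omega

theorem testBit (hg : PT q m g) (hh : PT q m h) :
    PB q m fun v => (g v).testBit (h v) = true := by
  classical
  refine (PT.lift₂ (f := fun x y => (x.testBit y).toNat) Dp.testBit hg hh).congr fun v => ?_
  by_cases h : (g v).testBit (h v) = true <;> simp [h]

end PB

end ParaCircuit

namespace ParaCircuit

open Function (update)

variable {q : ℕ}

/-! ### Programs for computable functions -/

theorem Computable.two_pow {F : ℕ → ℕ} (hF : Computable F) : Computable fun n => 2 ^ F n := by
  have h : Primrec fun n : ℕ => 2 ^ n :=
    (Primrec.nat_rec₁ (f := fun _ x => 2 * x) 1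
      (Primrec.nat_mul.comp (Primrec.const 2) Primrec.snd)).of_eq fun n => by
        induction n with
        | zero => rfl
        | succ n ih => rw [pow_succ, ← ih]; ring
  exact h.to_comp.comp hF

/-- Every computable function is bounded by a monotone computable function. -/
theorem Computable.exists_monotone {F : ℕ → ℕ} (hF : Computable F) :
    ∃ G : ℕ → ℕ, Computable G ∧ Monotone G ∧ ∀ n, F n ≤ G n := by
  refine ⟨fun n => Nat.rec (F 0) (fun y x => x + F (y + 1)) n, ?_, ?_, ?_⟩
  · refine Computable.nat_rec (f := fun n => n) (g := fun _ => F 0)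
      (h := fun _ p => p.2 + F (p.1 + 1)) Computable.id (Computable.const _) ?_
    exact Primrec.nat_add.to_comp.comp (Computable.snd.comp Computable.snd)
      (hF.comp (Primrec.succ.to_comp.comp (Computable.fst.comp Computable.snd)))
  · exact monotone_nat_of_le_succ fun n => Nat.le_add_right _ _
  · intro n
    cases n with
    | zero => exact le_rfl
    | succ n => exact Nat.le_add_left _ _

/-- Sum of the numbers in the registers below `m`. -/
def regSum (m : ℕ) (v : ℕ → ℕ) : ℕ := ∑ r ∈ Finset.range m, v r

theorem le_regSum {m r : ℕ} (h : r < m) (v : ℕ → ℕ) : v r ≤ regSum m v :=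
  Finset.single_le_sum (f := v) (fun _ _ => Nat.zero_le _) (Finset.mem_range.2 h)

theorem size_le_self (x : ℕ) : x.size ≤ x := Nat.size_le.2 Nat.lt_two_pow_self

theorem total_le_regSum (m : ℕ) (v : ℕ → ℕ) : total m v ≤ regSum m v :=
  Finset.sum_le_sum fun _ _ => size_le_self _

theorem le_two_pow_of_size_le {x n : ℕ} (h : x.size ≤ n) : x ≤ 2 ^ n := (Nat.size_le.1 h).le

/-- Some program computes `f` from the numbers in the registers below `m`, within a time that is a
monotone computable function of the sum of these numbers. -/
def CT (q m : ℕ) (f : (ℕ → ℕ) → ℕ) : Prop :=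
  ∃ F : ℕ → ℕ, Computable F ∧ Monotone F ∧ Cp q m f fun v => F (regSum m v)

/-- Assigns the value of a function to one of its argument registers. -/
theorem Cp.exists_assign {m r : ℕ} {f T : (ℕ → ℕ) → ℕ} (h : Cp q m f T) (hr : r < m) :
    ∃ p : Prog q, ∀ v, (∀ r, m ≤ r → v r = 0) →
      RunsIn p (cx v) (cx (update v r (f v))) (9 * T v + 2 * (v r).size + 3) := by
  obtain ⟨p, hp⟩ := id h
  refine ⟨.seq p (.seq (Prog.clear r) (Prog.move m r (m + 1))), fun v hv => ?_⟩
  refine ((RunsIn.seq (hp v hv) (RunsIn.seq (Prog.clear_cx _ r) (Prog.move_cx _ (by omega)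
    (by omega) (by omega) (by simp) ?_))).congr ?_).mono ?_
  · rw [Function.update_of_ne (by omega), Function.update_of_ne (by omega), hv _ (by omega)]
  · congr 1
    funext i
    by_cases h1 : i = r
    · subst h1
      simp [Function.update_of_ne hr.ne']
    · rw [Function.update_of_ne h1, Function.update_of_ne h1]
      by_cases h2 : i = m
      · subst h2
        simp [hv]
      · simp [Function.update_of_ne h1, Function.update_of_ne h2]
  · have := h.size_le hv
    rw [Function.update_of_ne hr.ne, Function.update_of_ne hr.ne', Function.update_self]
    omega

namespace CT

variable {m l : ℕ} {f g h : (ℕ → ℕ) → ℕ}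

theorem congr {f' : (ℕ → ℕ) → ℕ} (hf : CT q m f) (e : ∀ v, (∀ r, m ≤ r → v r = 0) → f v = f' v) :
    CT q m f' := by
  obtain ⟨F, hF, mF, hf⟩ := hf
  exact ⟨F, hF, mF, hf.congr e⟩

theorem const (x : ℕ) : CT q m fun _ => x :=
  ⟨fun _ => x.size + 1, Computable.const _, monotone_const, Cp.const m x⟩

theorem proj {i : ℕ} (hi : i < m) : CT q m fun v => v i := by
  refine ⟨fun n => 9 * n + 2, ?_, ?_, (Cp.proj hi).mono fun v _ => ?_⟩
  · exact Computable.natAdd (Computable.natMul (Computable.const 9) Computable.id)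
      (Computable.const 2)
  · intro a b h
    dsimp only
    omega
  · have h1 := size_le_self (v i)
    have h2 := le_regSum hi v
    dsimp only
    omega

theorem exists_common {G : ℕ → (ℕ → ℕ) → ℕ} (hG : ∀ i < l, CT q m (G i)) :
    ∃ F : ℕ → ℕ, Computable F ∧ Monotone F ∧ ∀ i < l, Cp q m (G i) fun v => F (regSum m v) := by
  induction l with
  | zero => exact ⟨fun _ => 0, Computable.const 0, monotone_const, fun i hi => absurd hi (by omega)⟩
  | succ l ih =>
    obtain ⟨F, hF, mF, h⟩ := ih fun i hi => hG i (by omega)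
    obtain ⟨F', hF', mF', h'⟩ := hG l (by omega)
    refine ⟨fun n => F n + F' n, Computable.natAdd hF hF', mF.add mF', fun i hi => ?_⟩
    rcases Nat.lt_succ_iff_lt_or_eq.1 hi with hi | rfl
    · exact (h i hi).mono fun v _ => by dsimp only; omega
    · exact h'.mono fun v _ => by dsimp only; omega

theorem comp_aux {G : ℕ → (ℕ → ℕ) → ℕ} {Ff : ℕ → ℕ} (hFf : Computable Ff) (mFf : Monotone Ff)
    (hf : Dp q l f fun v => Ff (regSum l v)) (hG : ∀ i < l, CT q m (G i)) :
    CT q m fun v => f fun i => if i < l then G i v else 0 := by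
  obtain ⟨F, hF, mF, h⟩ := exists_common hG
  refine ⟨fun s => l * F s + 1 + Ff (l * 2 ^ F s), ?_, ?_, (hf.comp h).mono fun v hv => ?_⟩
  · exact Computable.natAdd (Computable.natAdd (Computable.natMul (Computable.const l) hF)
      (Computable.const 1)) (hFf.comp (Computable.natMul (Computable.const l)
        (Computable.two_pow hF)))
  · intro a b hab
    have h1 := mF hab
    have h2 : l * F a ≤ l * F b := Nat.mul_le_mul_left l h1
    have h3 : Ff (l * 2 ^ F a) ≤ Ff (l * 2 ^ F b) :=
      mFf (Nat.mul_le_mul_left l (Nat.pow_le_pow_right (by norm_num) h1))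
    dsimp only
    omega
  · have e1 : ∑ i ∈ Finset.range l, F (regSum m v) = l * F (regSum m v) := by simp
    have e2 : regSum l (fun i => if i < l then G i v else 0) ≤ l * 2 ^ F (regSum m v) := by
      have : l * 2 ^ F (regSum m v) = ∑ i ∈ Finset.range l, 2 ^ F (regSum m v) := by simp
      rw [this]
      refine Finset.sum_le_sum fun i hi => ?_
      rw [Finset.mem_range] at hi
      rw [if_pos hi]
      exact le_two_pow_of_size_le ((h i hi).size_le hv)
    have e3 := mFf e2
    dsimp only
    rw [e1]
    omega

theorem comp (hf : CT q l f) {G : ℕ → (ℕ → ℕ) → ℕ} (hG : ∀ i < l, CT q m (G i)) :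
    CT q m fun v => f fun i => if i < l then G i v else 0 := by
  obtain ⟨Ff, hFf, mFf, hf⟩ := hf
  refine comp_aux (Ff := fun s => 9 * Ff s + 2 * s + (l + 3)) ?_ ?_ (hf.dp.mono fun v _ => ?_) hG
  · exact Computable.natAdd (Computable.natAdd (Computable.natMul (Computable.const 9) hFf)
      (Computable.natMul (Computable.const 2) Computable.id)) (Computable.const _)
  · intro a b hab
    have := mFf hab
    dsimp only
    omega
  · have := total_le_regSum l v
    omega

theorem lift₂ {f : ℕ → ℕ → ℕ} {c : ℕ} (hf : Dp q 2 (fun v => f (v 0) (v 1))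
    fun v => c * total 2 v + c) (hg : CT q m g) (hh : CT q m h) :
    CT q m fun v => f (g v) (h v) := by
  refine (comp_aux (l := 2) (Ff := fun s => c * s + c) (G := fun i => if i = 0 then g else h)
    (Computable.natAdd (Computable.natMul (Computable.const c) Computable.id) (Computable.const c))
    ?_ (hf.mono fun v _ => ?_) (fun i _ => ?_)).congr fun v _ => ?_
  · intro a b hab
    have := Nat.mul_le_mul_left c hab
    dsimp only
    omega
  · have := Nat.mul_le_mul_left c (total_le_regSum 2 v)
    omega
  · split_ifs
    · exact hg
    · exact hh
  · simp

end CT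

/-- The registers below `m` as in `v`, followed by `a` and `j`. -/
def extend₂ (m : ℕ) (v : ℕ → ℕ) (a j : ℕ) : ℕ → ℕ :=
  fun r => if r < m then v r else if r = m then a else if r = m + 1 then j else 0

theorem extend₂_supp (m : ℕ) (v : ℕ → ℕ) (a j : ℕ) : ∀ r, m + 2 ≤ r → extend₂ m v a j r = 0 := by
  intro r hr
  unfold extend₂
  rw [if_neg (by omega), if_neg (by omega), if_neg (by omega)]

theorem regSum_extend₂ (m : ℕ) (v : ℕ → ℕ) (a j : ℕ) :
    regSum (m + 2) (extend₂ m v a j) = regSum m v + a + j := by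
  unfold regSum
  rw [Finset.sum_range_succ, Finset.sum_range_succ]
  congr 1
  · congr 1
    · refine Finset.sum_congr rfl fun r hr => ?_
      rw [Finset.mem_range] at hr
      simp [extend₂, hr]
    · simp [extend₂]
  · simp [extend₂]

/-- A loop that runs through the stores `V 0`, …, `V N`, the last of which ends it. -/
theorem RunsIn.loop_cx {p : Prog q} {r τ : ℕ} (V : ℕ → ℕ → ℕ) (N : ℕ)
    (h : ∀ i < N, V i r ≠ 0 ∧ RunsIn p (cx (V i)) (cx (V (i + 1))) τ) (hN : V N r = 0) :
    RunsIn (.loop r p) (cx (V 0)) (cx (V N)) (N * (τ + 1) + 1) := by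
  induction N generalizing V with
  | zero => exact (RunsIn.loop_nil (by simp [cx, hN, enc_zero])).mono (by omega)
  | succ N ih =>
    have h1 := h 0 (by omega)
    have h2 := ih (fun i => V (i + 1)) (fun i hi => h (i + 1) (by omega)) hN
    refine (RunsIn.loop_cons (by simp [cx, enc_eq_nil, h1.1]) h1.2 h2).mono ?_
    rw [add_mul]
    omega

/-- Iteration of `a ↦ H a j`, where `j` counts the rounds, as long as `C` is nonzero. -/
theorem CT.iterate {m : ℕ} {a₀ H C : (ℕ → ℕ) → ℕ} (h₀ : CT q m a₀) (hH : CT q (m + 2) H)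
    (hC : CT q (m + 2) C) (A : (ℕ → ℕ) → ℕ → ℕ) (N : (ℕ → ℕ) → ℕ)
    (hA₀ : ∀ v, (∀ r, m ≤ r → v r = 0) → A v 0 = a₀ v)
    (hA : ∀ v, (∀ r, m ≤ r → v r = 0) → ∀ j < N v, A v (j + 1) = H (extend₂ m v (A v j) j))
    (hC₁ : ∀ v, (∀ r, m ≤ r → v r = 0) → ∀ j < N v, C (extend₂ m v (A v j) j) ≠ 0)
    (hC₀ : ∀ v, (∀ r, m ≤ r → v r = 0) → C (extend₂ m v (A v (N v)) (N v)) = 0)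
    {B : ℕ → ℕ} (hB : Computable B) (mB : Monotone B)
    (hN : ∀ v, (∀ r, m ≤ r → v r = 0) → N v ≤ B (regSum m v))
    (hAB : ∀ v, (∀ r, m ≤ r → v r = 0) → ∀ j ≤ N v, A v j ≤ B (regSum m v)) :
    CT q m fun v => A v (N v) := by
  obtain ⟨F₀, cF₀, mF₀, k₀⟩ := h₀
  obtain ⟨FH, cFH, mFH, kH⟩ := hH
  obtain ⟨FC, cFC, mFC, kC⟩ := hC
  obtain ⟨FS, cFS, mFS, kS⟩ : CT q (m + 2) fun v => v (m + 1) + 1 :=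
    CT.lift₂ (f := fun x y => x + y) Dp.add (CT.proj (by omega)) (CT.const 1)
  obtain ⟨pH, hpH⟩ := kH.exists_assign (r := m) (by omega)
  obtain ⟨pS, hpS⟩ := kS.exists_assign (r := m + 1) (by omega)
  obtain ⟨p₀, hp₀⟩ := id k₀
  obtain ⟨pC, hpC⟩ := id kC
  -- a bound on the sum of the registers during the iteration
  set S : ℕ → ℕ := fun s => s + (B s + B s) with hS
  have cS : Computable S := Computable.natAdd Computable.id (Computable.natAdd hB hB)
  have mS : Monotone S := monotone_id.add (mB.add mB)
  refine ⟨fun s => F₀ s + (FC (S s) + (B s * ((3 * FC (S s) + 9 * FH (S s) + 9 * FS (S s)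
    + 4 * B s + 7) + 1) + (2 * B s + 2))), ?_, ?_, ?_⟩
  · have c1 := cFC.comp cS
    have c2 := cFH.comp cS
    have c3 := cFS.comp cS
    refine Computable.natAdd cF₀ (Computable.natAdd c1 (Computable.natAdd (Computable.natMul hB
      (Computable.natAdd ?_ (Computable.const 1)))
      (Computable.natAdd (Computable.natMul (Computable.const 2) hB) (Computable.const 2))))
    exact Computable.natAdd (Computable.natAdd (Computable.natAdd (Computable.natAdd
      (Computable.natMul (Computable.const 3) c1) (Computable.natMul (Computable.const 9) c2))
      (Computable.natMul (Computable.const 9) c3)) (Computable.natMul (Computable.const 4) hB))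
      (Computable.const 7)
  · intro a b hab
    have e1 := mF₀ hab
    have e2 := mFC (mS hab)
    have e3 := mFH (mS hab)
    have e4 := mFS (mS hab)
    have e5 := mB hab
    have e6 : B a * ((3 * FC (S a) + 9 * FH (S a) + 9 * FS (S a) + 4 * B a + 7) + 1)
        ≤ B b * ((3 * FC (S b) + 9 * FH (S b) + 9 * FS (S b) + 4 * B b + 7) + 1) :=
      Nat.mul_le_mul e5 (by omega)
    dsimp only
    omega
  -- register `m` holds the iterated value, register `m + 1` the counter `j`, and register `m + 2`
  -- the value of the test `C`
  refine ⟨.seq p₀ (.seq pC (.seq (.loop (m + 2) (.seq (Prog.clear (m + 2))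
    (.seq pH (.seq pS pC)))) (Prog.clear (m + 1)))), fun v hv => ?_⟩
  set s := regSum m v with hs
  have sup : ∀ j ≤ N v, regSum (m + 2) (extend₂ m v (A v j) j) ≤ S s := by
    intro j hj
    have h1 := hAB v hv j hj
    have h2 := hN v hv
    rw [regSum_extend₂]
    change s + A v j + j ≤ s + (B s + B s)
    have h1' : A v j ≤ B s := h1
    have h2' : N v ≤ B s := h2
    omega
  set W : ℕ → ℕ → ℕ := fun j => update (extend₂ m v (A v j) j) (m + 2)
    (C (extend₂ m v (A v j) j)) with hW
  have start : RunsIn p₀ (cx v) (cx (extend₂ m v (A v 0) 0)) (F₀ s) := by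
    refine (hp₀ v hv).congr ?_
    congr 1
    funext r
    by_cases h : r = m
    · subst h; simp [extend₂, hA₀ v hv]
    · rw [Function.update_of_ne h]
      unfold extend₂
      by_cases h' : r < m
      · rw [if_pos h']
      · rw [if_neg h', if_neg h, hv r (by omega)]
        simp
  have test : ∀ j ≤ N v, RunsIn pC (cx (extend₂ m v (A v j) j)) (cx (W j)) (FC (S s)) :=
    fun j hj => (hpC _ (extend₂_supp _ _ _ _)).mono (mFC (sup j hj))
  have sizeC : ∀ j ≤ N v, (C (extend₂ m v (A v j) j)).size ≤ FC (S s) :=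
    fun j hj => (kC.size_le (extend₂_supp _ _ _ _)).trans (mFC (sup j hj))
  have body : ∀ j < N v, W j (m + 2) ≠ 0 ∧ RunsIn (.seq (Prog.clear (m + 2))
      (.seq pH (.seq pS pC))) (cx (W j)) (cx (W (j + 1)))
      (3 * FC (S s) + 9 * FH (S s) + 9 * FS (S s) + 4 * B s + 7) := by
    intro j hj
    refine ⟨by simpa [hW] using hC₁ v hv j hj, ?_⟩
    have r1 := Prog.clear_cx (q := q) (W j) (m + 2)
    have e1 : update (W j) (m + 2) 0 = extend₂ m v (A v j) j := by
      simp only [hW, Function.update_idem]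
      rw [← extend₂_supp m v (A v j) j (m + 2) le_rfl, Function.update_eq_self]
    have e1' : W j (m + 2) = C (extend₂ m v (A v j) j) := by simp [hW]
    rw [e1, e1'] at r1
    have r2 := hpH _ (extend₂_supp m v (A v j) j)
    have e2 : update (extend₂ m v (A v j) j) m (H (extend₂ m v (A v j) j))
        = extend₂ m v (A v (j + 1)) j := by
      rw [hA v hv j hj]
      funext r
      by_cases h : r = m
      · subst h; simp [extend₂]
      · simp [extend₂, h]
    have e2' : extend₂ m v (A v j) j m = A v j := by simp [extend₂]
    rw [e2, e2'] at r2
    have r3 := hpS _ (extend₂_supp m v (A v (j + 1)) j)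
    have e3' : extend₂ m v (A v (j + 1)) j (m + 1) = j := by simp [extend₂]
    have e3 : update (extend₂ m v (A v (j + 1)) j) (m + 1)
        (extend₂ m v (A v (j + 1)) j (m + 1) + 1) = extend₂ m v (A v (j + 1)) (j + 1) := by
      rw [e3']
      funext r
      by_cases h : r = m + 1
      · subst h; simp [extend₂]
      · simp [extend₂, h]
    rw [e3, e3'] at r3
    refine (RunsIn.seq r1 (RunsIn.seq r2 (RunsIn.seq r3 (test (j + 1) hj)))).mono ?_
    have t1 := sizeC j hj.le
    have t2 := mFH (sup j hj.le)
    have t3 : FS (regSum (m + 2) (extend₂ m v (A v (j + 1)) j)) ≤ FS (S s) := by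
      refine mFS ?_
      have := sup (j + 1) hj
      rw [regSum_extend₂] at this ⊢
      omega
    have t4 : (A v j).size ≤ B s := (size_le_self (A v j)).trans (hAB v hv j hj.le)
    have t5 := size_le_self j
    have t6 : N v ≤ B s := hN v hv
    omega
  have loop := RunsIn.loop_cx W (N v) body (by simpa [hW] using hC₀ v hv)
  have fin := Prog.clear_cx (q := q) (W (N v)) (m + 1)
  refine ((RunsIn.seq start (RunsIn.seq (test 0 (Nat.zero_le _)) (RunsIn.seq loop fin))).congr
    ?_).mono ?_
  · congr 1
    funext r
    by_cases h1 : r = m + 1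
    · subst h1
      simp [hv]
    · rw [Function.update_of_ne h1]
      by_cases h2 : r = m + 2
      · subst h2
        simp [hW, hC₀ v hv, hv]
      · simp only [hW, Function.update_of_ne h2]
        by_cases h3 : r = m
        · subst h3; simp [extend₂]
        · rw [Function.update_of_ne h3]
          unfold extend₂
          by_cases h' : r < m
          · rw [if_pos h']
          · rw [if_neg h', if_neg h3, if_neg h1, hv r (by omega)]
  · have t1 : N v ≤ B s := hN v hv
    have t2 : (W (N v) (m + 1)).size ≤ B s := by
      have : W (N v) (m + 1) = N v := by simp [hW, extend₂]
      rw [this]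
      exact (size_le_self _).trans t1
    have t3 := Nat.mul_le_mul_right
      (3 * FC (S s) + 9 * FH (S s) + 9 * FS (S s) + 4 * B s + 7 + 1) t1
    change _ ≤ F₀ s + (FC (S s) + (B s * ((3 * FC (S s) + 9 * FH (S s) + 9 * FS (S s)
      + 4 * B s + 7) + 1) + (2 * B s + 2)))
    omega

end ParaCircuit

namespace ParaCircuit

open Function (update)

variable {q : ℕ}

/-! ### Primitive recursive and computable functions -/

/-- Primitive recursion. -/
theorem CT.nat_rec {m : ℕ} {a₀ H N : (ℕ → ℕ) → ℕ} (h₀ : CT q m a₀) (hH : CT q (m + 2) H)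
    (hN : CT q m N) (A : (ℕ → ℕ) → ℕ → ℕ)
    (hA₀ : ∀ v, (∀ r, m ≤ r → v r = 0) → A v 0 = a₀ v)
    (hA : ∀ v, (∀ r, m ≤ r → v r = 0) → ∀ j, A v (j + 1) = H (extend₂ m v (A v j) j)) :
    CT q m fun v => A v (N v) := by
  classical
  obtain ⟨F₀, cF₀, mF₀, k₀⟩ := id h₀
  obtain ⟨FH, cFH, mFH, kH⟩ := id hH
  obtain ⟨FN, cFN, mFN, kN⟩ := id hN
  -- `D s j` bounds the value after `j` rounds; a value computed in time `t` is at most `2 ^ t`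
  set D : ℕ → ℕ → ℕ := fun s j => Nat.rec (2 ^ F₀ s) (fun j d => d + 2 ^ FH (s + d + j)) j with hD
  have cD : Computable fun s => D s (2 ^ FN s) + 2 ^ FN s := by
    refine Computable.natAdd ?_ (Computable.two_pow cFN)
    refine Computable.nat_rec (f := fun s => 2 ^ FN s) (g := fun s => 2 ^ F₀ s)
      (h := fun s p => p.2 + 2 ^ FH (s + p.2 + p.1)) (Computable.two_pow cFN)
      (Computable.two_pow cF₀) ?_
    have c1 : Computable fun p : ℕ × ℕ × ℕ => p.2.1 := Computable.fst.comp Computable.snd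
    have c2 : Computable fun p : ℕ × ℕ × ℕ => p.2.2 := Computable.snd.comp Computable.snd
    have cadd := Primrec.nat_add.to_comp
    refine (cadd.comp c2 ((Computable.two_pow cFH).comp
      (cadd.comp (cadd.comp Computable.fst c2) c1))).to₂
  have mono_D : ∀ j s s', s ≤ s' → D s j ≤ D s' j := by
    intro j
    induction j with
    | zero => exact fun s s' h => Nat.pow_le_pow_right (by norm_num) (mF₀ h)
    | succ j ih =>
      intro s s' h
      have h1 := ih s s' h
      have h2 : s + D s j + j ≤ s' + D s' j + j := by omega
      exact Nat.add_le_add h1 (Nat.pow_le_pow_right (by norm_num) (mFH h2))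
  have mono_D' : ∀ s, Monotone (D s) := fun s =>
    monotone_nat_of_le_succ fun j => Nat.le_add_right _ _
  have bd : ∀ v, (∀ r, m ≤ r → v r = 0) → ∀ j, A v j ≤ D (regSum m v) j := by
    intro v hv j
    induction j with
    | zero =>
      rw [hA₀ v hv]
      exact le_two_pow_of_size_le (k₀.size_le hv)
    | succ j ih =>
      have h2 : regSum (m + 2) (extend₂ m v (A v j) j) ≤ regSum m v + D (regSum m v) j + j := by
        rw [regSum_extend₂]
        omega
      rw [hA v hv]
      exact (le_two_pow_of_size_le ((kH.size_le (extend₂_supp m v (A v j) j)).trans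
        (mFH h2))).trans (Nat.le_add_left _ _)
  -- the test whether the counter in register `m + 1` has reached `N`
  have hC : CT q (m + 2) fun e => if e (m + 1) = N (fun i => if i < m then e i else 0)
      then 0 else 1 := by
    have h1 : CT q (m + 2) fun e => N (fun i => if i < m then e i else 0) :=
      CT.comp hN (G := fun i e => e i) fun i hi => CT.proj (by omega)
    have h2 : CT q (m + 2) fun e => if (if e (m + 1) = N (fun i => if i < m then e i else 0)
        then 1 else 0) = 0 then 1 else 0 :=
      CT.lift₂ (f := fun x y => if x = y then 1 else 0) Dp.eq
        (CT.lift₂ (f := fun x y => if x = y then 1 else 0) Dp.eq (CT.proj (by omega)) h1)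
        (CT.const 0)
    exact h2.congr fun e _ => by split_ifs <;> simp_all
  have key : ∀ v : ℕ → ℕ, (∀ r, m ≤ r → v r = 0) → ∀ a j,
      (fun i => if i < m then extend₂ m v a j i else 0) = v := by
    intro v hv a j
    funext i
    by_cases hi : i < m
    · simp [hi, extend₂]
    · simp [hi, hv i (by omega)]
  refine CT.iterate h₀ hH hC A N hA₀ (fun v hv j _ => hA v hv j) ?_ ?_
    (B := fun s => D s (2 ^ FN s) + 2 ^ FN s) cD ?_ ?_ ?_
  · intro v hv j hj
    rw [key v hv]
    simp [extend₂, hj.ne]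
  · intro v hv
    rw [key v hv]
    simp [extend₂]
  · intro s s' h
    have h1 : 2 ^ FN s ≤ 2 ^ FN s' := Nat.pow_le_pow_right (by norm_num) (mFN h)
    exact Nat.add_le_add ((mono_D _ _ _ h).trans (mono_D' _ h1)) h1
  · intro v hv
    exact (le_two_pow_of_size_le (kN.size_le hv)).trans (Nat.le_add_left _ _)
  · intro v hv j hj
    refine (bd v hv j).trans ((mono_D' _ ?_).trans (Nat.le_add_right _ _))
    exact hj.trans (le_two_pow_of_size_le (kN.size_le hv))

/-- Primitive recursive functions, by induction on their definition. -/
theorem CT.of_primrec' {n : ℕ} {f : List.Vector ℕ n → ℕ} (hf : Nat.Primrec' f) :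
    CT q n fun v => f (List.Vector.ofFn fun i : Fin n => v i) := by
  induction hf with
  | zero => exact CT.const 0
  | succ =>
    refine (CT.lift₂ (f := fun x y => x + y) Dp.add (CT.proj (i := 0) (by omega))
      (CT.const 1)).congr fun v _ => ?_
    simp [List.Vector.ofFn]
  | get i => exact (CT.proj i.2).congr fun v _ => by simp
  | @comp n m f g _ _ ihf ihg =>
    refine (CT.comp ihf (G := fun i v => if h : i < m then
      g ⟨i, h⟩ (List.Vector.ofFn fun i : Fin n => v i) else 0) fun i hi => ?_).congr fun v _ => ?_
    · simp only [dif_pos hi]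
      exact ihg ⟨i, hi⟩
    · simp
  | @prec n f g _ _ ihf ihg =>
    have h₀ : CT q (n + 1) fun v => f (List.Vector.ofFn fun i : Fin n => v (i + 1)) := by
      refine (CT.comp ihf (G := fun i v => v (i + 1)) fun i hi => CT.proj (by omega)).congr
        fun v _ => ?_
      simp
    have hH : CT q (n + 1 + 2) fun e => g (e (n + 2) ::ᵥ e (n + 1) ::ᵥ
        List.Vector.ofFn fun i : Fin n => e (i + 1)) := by
      refine (CT.comp ihg (G := fun i e => if i = 0 then e (n + 2) else if i = 1 then e (n + 1)
        else e (i - 1)) fun i hi => ?_).congr fun v _ => ?_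
      · split_ifs
        · exact CT.proj (by omega)
        · exact CT.proj (by omega)
        · exact CT.proj (by omega)
      · congr 1
        simp [List.Vector.ofFn]
    refine (CT.nat_rec h₀ hH (CT.proj (i := 0) (by omega))
      (fun v j => Nat.rec (f (List.Vector.ofFn fun i : Fin n => v (i + 1)))
        (fun y IH => g (y ::ᵥ IH ::ᵥ List.Vector.ofFn fun i : Fin n => v (i + 1))) j)
      (fun v _ => rfl) (fun v hv j => ?_)).congr fun v _ => ?_
    · have e : (fun i : Fin n => extend₂ (n + 1) v (Nat.rec
          (f (List.Vector.ofFn fun i : Fin n => v (i + 1)))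
        (fun y IH => g (y ::ᵥ IH ::ᵥ List.Vector.ofFn fun i : Fin n => v (i + 1))) j) j (i + 1))
          = fun i : Fin n => v (i + 1) := by
        funext i
        simp [extend₂]
      simp only [e]
      simp [extend₂]
    · have e : (List.Vector.ofFn fun i : Fin (n + 1) => v i)
          = v 0 ::ᵥ List.Vector.ofFn fun i : Fin n => v (i + 1) := by
        simp [List.Vector.ofFn]
      rw [e]
      simp

theorem CT.of_primrec₂ {f : ℕ → ℕ → ℕ} (hf : Primrec₂ f) : CT q 2 fun v => f (v 0) (v 1) :=
  (CT.of_primrec' (Nat.Primrec'.prim_iff₂.2 hf)).congr fun v _ => by simp [List.Vector.ofFn]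

/-- A computable function is computed by searching for a number of steps that is sufficient for
evaluating its code. -/
theorem CT.of_computable {f : ℕ → ℕ} (hf : Computable f) : CT q 1 fun v => f (v 0) := by
  obtain ⟨c, hc⟩ := Nat.Partrec.Code.exists_code.1 (Partrec.nat_iff.1 hf)
  have hc' : ∀ x y, y ∈ c.eval x ↔ y = f x := by
    intro x y
    rw [hc]
    exact Part.mem_some_iff
  -- `g s x` is `0` as long as `s` does not suffice to evaluate the code, and `f x + 1` afterwards
  set g : ℕ → ℕ → ℕ := fun s x => Encodable.encode (c.evaln s x) with hg
  have pg : Primrec₂ g := Primrec.encode.comp (Nat.Partrec.Code.primrec_evaln.comp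
    ((Primrec.fst.pair (Primrec.const c)).pair Primrec.snd))
  have ex : ∀ x, ∃ s, g s x ≠ 0 := by
    intro x
    obtain ⟨s, hs⟩ := Nat.Partrec.Code.evaln_complete.1 ((hc' x (f x)).2 rfl)
    refine ⟨s, ?_⟩
    rw [Option.mem_def] at hs
    simp [hg, hs]
  have val : ∀ s x, g s x ≠ 0 → g s x = f x + 1 := by
    intro s x h
    cases e : c.evaln s x with
    | none => simp [hg, e] at h
    | some y =>
      have := (hc' x y).1 (Nat.Partrec.Code.evaln_sound (Option.mem_def.2 e))
      simp [hg, e, this]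
  have cN : Computable fun x => Nat.find (ex x) := by
    have : Partrec fun x => Nat.rfind ((fun s => decide (g s x ≠ 0) : ℕ → Bool) : ℕ →. Bool) := by
      refine Partrec.rfind (p := fun x => ((fun s => decide (g s x ≠ 0) : ℕ → Bool) : ℕ →. Bool)) ?_
      have h1 : PrimrecPred fun a : ℕ × ℕ => g a.2 a.1 ≠ 0 :=
        (PrimrecRel.comp Primrec.eq (pg.comp Primrec.snd Primrec.fst) (Primrec.const 0)).not
      exact h1.decide.to_comp
    refine this.of_eq_tot fun x => ?_
    rw [Nat.mem_rfind]
    refine ⟨?_, fun {s} hs => ?_⟩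
    · simpa using Nat.find_spec (ex x)
    · simpa using Nat.find_min (ex x) hs
  obtain ⟨B, cB, mB, hB⟩ := Computable.exists_monotone cN
  have search : CT q 1 fun v => Nat.find (ex (v 0)) := by
    have hC : CT q 3 fun e => if g (e 2) (e 0) = 0 then 1 else 0 := by
      refine CT.lift₂ (f := fun x y => if x = y then 1 else 0) Dp.eq ?_ (CT.const 0)
      refine (CT.comp (CT.of_primrec₂ pg) (G := fun i e => if i = 0 then e 2 else e 0)
        fun i _ => ?_).congr fun v _ => by simp
      split_ifs <;> exact CT.proj (by omega)
    have hH : CT q 3 fun e => e 2 + 1 :=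
      CT.lift₂ (f := fun x y => x + y) Dp.add (CT.proj (by omega)) (CT.const 1)
    refine CT.iterate (m := 1) (CT.const 0) hH hC (fun _ j => j) (fun v => Nat.find (ex (v 0)))
      (fun _ _ => rfl) (fun v _ j _ => by simp [extend₂]) (fun v _ j hj => ?_) (fun v _ => ?_)
      cB mB (fun v _ => ?_) (fun v _ j hj => ?_)
    · have := Nat.find_min (ex (v 0)) hj
      simp only [not_not] at this
      simp [extend₂, this]
    · have := Nat.find_spec (ex (v 0))
      simp [extend₂, this]
    · simpa [regSum] using hB (v 0)
    · refine hj.trans ?_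
      simpa [regSum] using hB (v 0)
  have pred : CT q 1 fun v => (g (Nat.find (ex (v 0))) (v 0)).pred := by
    have h1 : Primrec₂ fun s x => (g s x).pred := Primrec.pred.comp pg
    refine (CT.comp (CT.of_primrec₂ h1) (G := fun i v => if i = 0 then Nat.find (ex (v 0))
      else v 0) fun i _ => ?_).congr fun v _ => by simp
    split_ifs
    · exact search
    · exact CT.proj (by omega)
  exact pred.congr fun v _ => by rw [val _ _ (Nat.find_spec (ex (v 0))), Nat.pred_succ]

theorem CT.of_computable₂ {f : ℕ → ℕ → ℕ} (hf : Computable₂ f) :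
    CT q 2 fun v => f (v 0) (v 1) := by
  have h1 : Computable fun x : ℕ => f x.unpair.1 x.unpair.2 :=
    Computable₂.comp hf (Computable.fst.comp Computable.unpair)
      (Computable.snd.comp Computable.unpair)
  refine (CT.comp (CT.of_computable h1) (G := fun _ v => Nat.pair (v 0) (v 1)) fun i _ =>
    CT.of_primrec₂ Primrec₂.natPair).congr fun v _ => by simp

/-! ### Computable functions of the parameter -/

/-- The time for a computable function of the parameter is itself a computable function of the
parameter. -/
theorem PT.param {m : ℕ} {f : ℕ → ℕ} (hf : Computable f) (hm : 0 < m) :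
    PT q m fun v => f (v 0) := by
  obtain ⟨F, cF, -, h⟩ := CT.of_computable (q := q) hf
  have h1 : PT q 1 fun v => f (v 0) :=
    ⟨F, 0, cF, h.mono fun v _ => by simp [regSum]⟩
  exact (PT.comp h1 (G := fun _ v => v 0) one_pos (fun _ _ => PT.proj hm) fun _ => rfl).congr
    fun v => by simp

/-- Computable functions of numbers that are bounded in terms of the parameter. -/
theorem PT.guard {m : ℕ} {bnd : ℕ → ℕ} {f : ℕ → ℕ → ℕ} {g : (ℕ → ℕ) → ℕ} (hb : Computable bnd)
    (hf : Computable₂ f) (hg : PT q m g) (hm : 0 < m) :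
    PT q m fun v => if g v < bnd (v 0) then f (v 0) (g v) else 0 := by
  classical
  obtain ⟨F, cF, mF, h⟩ := CT.of_computable₂ (q := q) hf
  obtain ⟨Fb, c, cFb, h'⟩ := PB.lt (q := q) (m := 2) (PT.proj (i := 1) (by omega))
    (PT.param hb (by omega))
  have h2 : PT q 2 fun v => if v 1 < bnd (v 0) then f (v 0) (v 1) else 0 := by
    refine ⟨fun k => 3 * Fb k + 3 + F (k + bnd k), 3 * c, ?_,
      ((h'.ite h (Cp.const 2 0)).congr fun v _ => ?_).mono fun v _ => ?_⟩
    · exact Computable.natAdd (Computable.natAdd (Computable.natMul (Computable.const 3) cFb)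
        (Computable.const 3)) (cF.comp (Computable.natAdd Computable.id hb))
    · by_cases e : v 1 < bnd (v 0) <;> simp [e]
    · have e1 : 3 * (Fb (v 0) + c * total 2 v) = 3 * Fb (v 0) + 3 * c * total 2 v := by ring
      by_cases e : v 1 < bnd (v 0)
        -- as the argument is below the bound, the time is a function of the parameter
      · have e2 : regSum 2 v ≤ v 0 + bnd (v 0) := by
          simp only [regSum, Finset.sum_range_succ, Finset.sum_range_zero]
          omega
        have e3 := mF e2
        simp only [e, if_true]
        simp
        omega
      · simp [e]
        omega
  refine (PT.comp h2 (G := fun i v => if i = 0 then v 0 else g v) two_pos (fun i _ => ?_)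
    fun _ => rfl).congr fun v => by simp
  split_ifs
  · exact PT.proj hm
  · exact hg

end ParaCircuit

namespace ParaCircuit

open Function (update)

variable {q : ℕ}

/-! ### Machines for predicates -/

/-- Three registers. -/
def regs₃ (k j n : ℕ) : ℕ → ℕ
  | 0 => k
  | 1 => j
  | 2 => n
  | _ => 0

theorem regs₃_supp (k j n : ℕ) : ∀ r, 3 ≤ r → regs₃ k j n r = 0
  | _ + 3, _ => rfl

theorem total_regs₃ (k j n : ℕ) : total 3 (regs₃ k j n) = k.size + j.size + n.size := by
  simp [total, Finset.sum_range_succ, regs₃]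

/-- One round of distributing the binary numbers in register `3`, separated by `#`, over other
registers: register `4` counts the separators met so far, and `d` is the destination. -/
def Prog.readBody (d : Option (Sym q) → ℕ) : Prog q :=
  .case 3 fun a => if a = some sepS then
    .seq (.pop 3) (.case 4 fun b => .push 4 (bitS b.isSome))
  else .seq (.pop 3) (.case 4 fun b => .push (d b) (a.getD sepS))

section

variable {d : Option (Sym q) → ℕ} {s s' : Store q} {t : ℕ} {rest : List (Sym q)}

/-- The loop moves a block of bits to its destination; this reverses the block, so that the least
significant bit ends up on top. -/
theorem Prog.read_bits (hd : ∀ a, d a ≠ 3 ∧ d a ≠ 4) (l : List Bool) (e : s 3 = l.map bitS ++ rest)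
    (h : RunsIn (.loop 3 (Prog.readBody d)) (update (update s 3 rest) (d (s 4).head?)
      (l.reverse.map bitS ++ s (d (s 4).head?))) s' t) :
    RunsIn (.loop 3 (Prog.readBody d)) s s' (t + 5 * l.length) := by
  induction l generalizing s with
  | nil =>
    simp only [List.map_nil, List.nil_append, List.reverse_nil] at e h
    rw [← e, Function.update_eq_self, Function.update_eq_self] at h
    exact h.mono (by simp)
  | cons b l ih =>
    set D := d (s 4).head? with hD
    have hD3 : D ≠ 3 := (hd _).1
    have hD4 : D ≠ 4 := (hd _).2
    set s₁ : Store q := update (update s 3 (l.map bitS ++ rest)) D (bitS b :: s D) with hs₁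
    have e4 : s₁ 4 = s 4 := by simp [hs₁, Function.update_of_ne hD4.symm]
    have step : RunsIn (Prog.readBody d) s s₁ 4 := by
      have e3 : (s 3).head? = some (bitS b) := by rw [e]; rfl
      refine (RunsIn.case (t := 3) e3 ?_).mono le_rfl
      rw [if_neg (by simp [bitS, sepS])]
      refine (RunsIn.seq (RunsIn.pop (s' := update s 3 (l.map bitS ++ rest)) ?_)
        (RunsIn.case (t := 1) (a := (s 4).head?) ?_ (RunsIn.push ?_))).mono le_rfl
      · rw [e]; rfl
      · rw [Function.update_of_ne (by norm_num)]
      · rw [← hD, hs₁, Function.update_of_ne hD3]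
        rfl
    refine (RunsIn.loop_cons (by simp [e]) step (ih (s := s₁) ?_ ?_)).mono (t' := _) ?_
    · simp [hs₁, Function.update_of_ne hD3.symm]
    · rw [e4, ← hD]
      refine (congrArg (fun S => RunsIn (.loop 3 (Prog.readBody d)) S s' t) ?_).mp h
      funext r
      by_cases h1 : r = D
      · subst h1
        simp [hs₁]
      · by_cases h2 : r = 3
        · subst h2; simp [hs₁, Function.update_of_ne h1]
        · simp [hs₁, Function.update_of_ne h1, Function.update_of_ne h2]
    · simp only [List.length_cons]
      omega

/-- The loop counts a separator: the first one pushes `0`, the second one pushes `1` to register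
`4`. -/
theorem Prog.read_sep (e : s 3 = sepS :: rest)
    (h : RunsIn (.loop 3 (Prog.readBody d)) (update (update s 3 rest) 4
      (bitS (s 4).head?.isSome :: s 4)) s' t) :
    RunsIn (.loop 3 (Prog.readBody d)) s s' (t + 5) := by
  have step : RunsIn (Prog.readBody d) s (update (update s 3 rest) 4
      (bitS (s 4).head?.isSome :: s 4)) 4 := by
    have e3 : (s 3).head? = some sepS := by rw [e]; rfl
    refine (RunsIn.case (t := 3) e3 ?_).mono le_rfl
    rw [if_pos rfl]
    refine (RunsIn.seq (RunsIn.pop (s' := update s 3 rest) ?_)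
      (RunsIn.case (t := 1) (a := (s 4).head?) ?_ (RunsIn.push ?_))).mono le_rfl
    · rw [e]; rfl
    · rw [Function.update_of_ne (by norm_num)]
    · rw [Function.update_of_ne (by norm_num : (4 : ℕ) ≠ 3)]
  exact (RunsIn.loop_cons (by simp [e]) step h).mono (by omega)

end

theorem length_bits (n : ℕ) : n.bits.length = n.size := Nat.size_eq_bits_len n |>.symm ▸ rfl

/-- Splits an input `bin(j)#bin(k)#bin(n)`. It is held in reverse, so that `n` is met first. -/
theorem Prog.exists_read₃ : ∃ p : Prog q, ∀ j k n,
    RunsIn p (update (fun _ => []) 3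
      ((bin j ++ none :: bin k ++ none :: bin n).map Sum.inl).reverse) (cx (regs₃ k j n))
      (5 * (k.size + j.size + n.size) + 17) := by
  refine ⟨.seq (.loop 3 (Prog.readBody fun a => if a = none then 2 else
    if a = some (bitS false) then 0 else 1)) (Prog.clear 4), fun j k n => ?_⟩
  have hd : ∀ a : Option (Sym q), (if a = none then 2 else if a = some (bitS false) then 0 else 1)
      ≠ 3 ∧ (if a = none then 2 else if a = some (bitS false) then 0 else 1) ≠ 4 := by
    intro a
    split_ifs <;> simp
  refine (RunsIn.seq (s₁ := store₅ (enc k) (enc j) (enc n) []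
    [bitS true, bitS false]) (Prog.read_bits hd n.bits.reverse
      (rest := sepS :: (k.bits.reverse.map bitS ++ sepS :: j.bits.reverse.map bitS)) ?_
      (Prog.read_sep (rest := k.bits.reverse.map bitS ++ sepS :: j.bits.reverse.map bitS) ?_
      (Prog.read_bits hd k.bits.reverse (rest := sepS :: j.bits.reverse.map bitS) ?_
      (Prog.read_sep (rest := j.bits.reverse.map bitS) ?_
      (Prog.read_bits (t := 1) hd j.bits.reverse (rest := []) ?_ ?_))))) (Prog.clear_runsIn _ _)).congr
      ?_ |>.mono ?_
  · simp [bin, List.map_reverse, Function.comp_def]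
  · simp
  · simp
  · simp
  · simp
  · refine (RunsIn.loop_nil ?_).congr ?_
    · simp
    · funext r
      rcases r with _ | _ | _ | _ | _ | r <;> simp [store₅, enc]
  · rw [update_store₅_four]
    funext r
    rcases r with _ | _ | _ | _ | _ | r <;> simp [store₅, cx, regs₃, enc_zero]
  · simp only [List.length_reverse, length_bits]
    simp [store₅]
    omega

/-- Splits an input `bin(j)#bin(n)`; the parameter is set to `0`. -/
theorem Prog.exists_read₂ : ∃ p : Prog q, ∀ j n,
    RunsIn p (update (fun _ => []) 3
      ((bin j ++ none :: bin n).map Sum.inl).reverse) (cx (regs₃ 0 j n))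
      (5 * (j.size + n.size) + 17) := by
  refine ⟨.seq (.loop 3 (Prog.readBody fun a => if a = none then 2 else 1)) (Prog.clear 4),
    fun j n => ?_⟩
  have hd : ∀ a : Option (Sym q), (if a = none then 2 else 1) ≠ 3 ∧
      (if a = none then 2 else 1) ≠ 4 := by
    intro a
    split_ifs <;> simp
  refine (RunsIn.seq (s₁ := store₅ [] (enc j) (enc n) []
    [bitS false]) (Prog.read_bits hd n.bits.reverse
      (rest := sepS :: j.bits.reverse.map bitS) ?_
      (Prog.read_sep (rest := j.bits.reverse.map bitS) ?_
      (Prog.read_bits (t := 1) hd j.bits.reverse (rest := []) ?_ ?_))) (Prog.clear_runsIn _ _)).congr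
      ?_ |>.mono ?_
  · simp [bin, List.map_reverse, Function.comp_def]
  · simp
  · simp
  · refine (RunsIn.loop_nil ?_).congr ?_
    · simp
    · funext r
      rcases r with _ | _ | _ | _ | _ | r <;> simp [store₅, enc]
  · rw [update_store₅_four]
    funext r
    rcases r with _ | _ | _ | _ | _ | r <;> simp [store₅, cx, regs₃, enc_zero]
  · simp only [List.length_reverse, length_bits]
    simp [store₅]
    omega

theorem Machine.OutputsBit.mono {M : Machine} {w : List (Option Bool)} {b : Bool} {t t' : ℕ}
    (h : M.OutputsBit w b t) (ht : t ≤ t') : M.OutputsBit w b t' := by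
  obtain ⟨h⟩ := h
  exact ⟨⟨h.toEvalsTo, h.steps_le_m.trans ht⟩⟩

open Classical in
/-- A predicate is decided by the machine that reads its arguments with the program `rd`, decides
it and leaves the answer in register `3`. -/
theorem PB.exists_machine_of_read {P : (ℕ → ℕ) → Prop} (hP : PB q 3 P) (rd : Prog q) :
    ∃ (M : Machine) (F : ℕ → ℕ) (c : ℕ), Computable F ∧ ∀ w k j n t,
      RunsIn rd (update (fun _ => []) 3 (w.map Sum.inl).reverse) (cx (regs₃ k j n)) t →
      M.OutputsBit w (decide (P (regs₃ k j n)))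
        (t + w.length + (F k + c * (k.size + j.size + n.size))) := by
  obtain ⟨F, c, cF, h⟩ := hP
  obtain ⟨p, hp⟩ := h.dp
  obtain ⟨M, hM⟩ := (Prog.seq rd (.seq p (Prog.move 0 3 1))).exists_machine
  refine ⟨M, fun k => 9 * F k + 18, 9 * c + 2, ?_, fun w k j n t ht => ?_⟩
  · exact Computable.natAdd (Computable.natMul (Computable.const 9) cF) (Computable.const _)
  set v := regs₃ k j n with hv
  have h1 := hp v (regs₃_supp k j n)
  have h2 := Prog.move_cx (q := q) (update (fun _ => 0) 0 (if P v then 1 else 0)) (r := 0) (r' := 3)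
    (x := 1) (by norm_num) (by norm_num) (by norm_num) (by simp) (by simp)
  obtain ⟨t', ht', hr⟩ := RunsIn.seq ht (RunsIn.seq h1 h2)
  refine Machine.OutputsBit.mono (hM w (decide (P v)) (enc (if P v then 1 else 0)) t' ?_ ?_) ?_
  · convert hr using 1
    funext r
    by_cases h3 : r = 3
    · subst h3; simp [cx]
    · simp only [cx, Function.update_of_ne h3]
      by_cases h0 : r = 0
      · subst h0; simp [enc_zero]
      · simp [Function.update_of_ne h0, enc_zero]
  · rw [length_enc]
    by_cases h : P v <;> simp [h]
  · have e1 : ((update (fun _ => 0) 0 (if P v then 1 else 0) : ℕ → ℕ) 0).size ≤ 1 := by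
      by_cases h : P v <;> simp [h]
    have e2 : total 3 v = k.size + j.size + n.size := total_regs₃ k j n
    have e3 : v 0 = k := rfl
    dsimp only at ht'
    rw [e2, e3] at ht'
    have e4 : (9 * c + 2) * (k.size + j.size + n.size)
      = 9 * (c * (k.size + j.size + n.size)) + 2 * (k.size + j.size + n.size) := by ring
    dsimp only
    omega

theorem size_le_lg (n : ℕ) : n.size ≤ lg n := by
  rw [Nat.size_le]
  exact Nat.lt_pow_succ_log_self (by norm_num) n

theorem lg_le_size (n : ℕ) : lg n ≤ n.size + 1 := by
  rcases Nat.eq_zero_or_pos n with rfl | h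
  · simp [lg]
  · have : Nat.log 2 n < n.size := by
      rw [Nat.lt_size]
      exact Nat.pow_log_le_self 2 h.ne'
    unfold lg
    omega

theorem lg_pos (n : ℕ) : 0 < lg n := Nat.succ_pos _

theorem length_bin (n : ℕ) : (bin n).length = n.size := by simp [bin, length_bits]

open Classical in
/-- A machine for a predicate of a parameter `k` and two further numbers. -/
theorem PB.exists_machine₃ {P : (ℕ → ℕ) → Prop} (hP : PB q 3 P) :
    ∃ (M : Machine) (F : ℕ → ℕ) (c : ℕ), Computable F ∧ ∀ j n k,
      M.OutputsBit (bin j ++ none :: bin k ++ none :: bin n) (decide (P (regs₃ k j n)))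
        (F k + c * (lg n + lg j)) := by
  obtain ⟨rd, hrd⟩ := Prog.exists_read₃ (q := q)
  obtain ⟨M, F, c, cF, hM⟩ := hP.exists_machine_of_read rd
  refine ⟨M, fun k => F k + (c + 6) * k + 19, c + 6, ?_, fun j n k => ?_⟩
  · exact Computable.natAdd (Computable.natAdd cF (Computable.natMul (Computable.const _)
      Computable.id)) (Computable.const _)
  refine (hM _ k j n _ (hrd j k n)).mono ?_
  have e1 := Nat.mul_le_mul_left (c + 6) (size_le_self k)
  have e2 := Nat.mul_le_mul_left (c + 6) (size_le_lg j)
  have e3 := Nat.mul_le_mul_left (c + 6) (size_le_lg n)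
  simp only [List.length_append, List.length_cons, length_bin]
  have e4 : c * (k.size + j.size + n.size) + 6 * (k.size + j.size + n.size)
    = (c + 6) * k.size + (c + 6) * j.size + (c + 6) * n.size := by ring
  rw [mul_add (c + 6) (lg n) (lg j)]
  omega

open Classical in
/-- A machine for a predicate of two numbers. -/
theorem PB.exists_machine₂ {P : (ℕ → ℕ) → Prop} (hP : PB q 3 P) :
    ∃ (M : Machine) (c : ℕ), ∀ j n,
      M.OutputsBit (bin j ++ none :: bin n) (decide (P (regs₃ 0 j n))) (c * (lg n + lg j)) := by
  obtain ⟨rd, hrd⟩ := Prog.exists_read₂ (q := q)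
  obtain ⟨M, F, c, cF, hM⟩ := hP.exists_machine_of_read rd
  refine ⟨M, c + 6 + F 0 + 18, fun j n => ?_⟩
  refine (hM _ 0 j n _ (hrd j n)).mono ?_
  have e2 := Nat.mul_le_mul_left (c + 6) (size_le_lg j)
  have e3 := Nat.mul_le_mul_left (c + 6) (size_le_lg n)
  have e5 : F 0 + 18 ≤ (F 0 + 18) * (lg n + lg j) :=
    Nat.le_mul_of_pos_right _ (by have := lg_pos n; omega)
  simp only [List.length_append, List.length_cons, length_bin]
  have e4 : c * (Nat.size 0 + j.size + n.size) + 6 * (j.size + n.size)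
    = (c + 6) * j.size + (c + 6) * n.size := by simp; ring
  have e6 : (c + 6 + F 0 + 18) * (lg n + lg j)
    = (c + 6) * lg n + (c + 6) * lg j + (F 0 + 18) * (lg n + lg j) := by ring
  rw [e6]
  omega

end ParaCircuit

namespace ParaCircuit

open Function (update)

variable {q : ℕ}

/-! ### Simulation of stack machines -/

section Simulation

open Turing.TM2

variable {K : Type} {Γ : K → Type} {Λ σ : Type}

/-- A representation of the configurations of a stack machine by stores: stack `k` is held by
register `3 + idx k`; the control state and the internal state are symbols. The decoding functions
are left inverses of the encoding functions, for stack symbols only where this is required. -/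
structure Coding (q : ℕ) (Γ : K → Type) (Λ σ : Type) where
  /-- numbering of the stacks -/
  idx : K → ℕ
  idx_injective : idx.Injective
  /-- symbol of a stack symbol -/
  sy : ∀ k, Γ k → Sym q
  /-- stack symbol of a symbol -/
  de : ∀ k, Sym q → Option (Γ k)
  /-- symbol of a control state -/
  syL : Λ → Sym q
  /-- control state of a symbol -/
  deL : Sym q → Option Λ
  deL_syL : ∀ l, deL (syL l) = some l
  /-- symbol of an internal state -/
  syV : σ → Sym q
  /-- internal state of a symbol -/
  deV : Sym q → Option σ
  deV_syV : ∀ v, deV (syV v) = some v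

namespace Coding

variable (e : Coding q Γ Λ σ)

/-- The stacks are represented by the store. -/
def StackRel (S : Store q) (T : ∀ k, List (Γ k)) : Prop :=
  ∀ k, (S (3 + e.idx k)).map (e.de k) = (T k).map some

/-- The configuration is represented by the store. -/
def CfgRel (S : Store q) (c : Cfg Γ Λ σ) : Prop :=
  S 1 = (c.l.map e.syL).toList ∧ S 2 = [e.syV c.var] ∧ e.StackRel S c.stk

/-- All symbols pushed by the statement can be decoded. -/
def Encodes : Stmt Γ Λ σ → Prop
  | .push k f s => (∀ v, e.de k (e.sy k (f v)) = some (f v)) ∧ Encodes s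
  | .peek _ _ s => Encodes s
  | .pop _ _ s => Encodes s
  | .load _ s => Encodes s
  | .branch _ s₁ s₂ => Encodes s₁ ∧ Encodes s₂
  | .goto _ => True
  | .halt => True

/-- The program for a statement that is executed in a given internal state. -/
def tr : Stmt Γ Λ σ → σ → Prog q
  | .push k f s, v => .seq (.push (3 + e.idx k) (e.sy k (f v))) (tr s v)
  | .peek k f s, v => .case (3 + e.idx k) fun a => tr s (f v (a.bind (e.de k)))
  | .pop k f s, v => .case (3 + e.idx k) fun a =>
      .seq (.pop (3 + e.idx k)) (tr s (f v (a.bind (e.de k))))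
  | .load f s, v => tr s (f v)
  | .branch f s₁ s₂, v => if f v then tr s₁ v else tr s₂ v
  | .goto f, v => .seq (.push 1 (e.syL (f v))) (.push 2 (e.syV v))
  | .halt, v => .push 2 (e.syV v)

variable {e}

theorem StackRel.head {S : Store q} {T : ∀ k, List (Γ k)} (h : e.StackRel S T) (k : K) :
    (S (3 + e.idx k)).head?.bind (e.de k) = (T k).head? := by
  have h1 := h k
  cases h2 : S (3 + e.idx k) with
  | nil =>
    rw [h2] at h1
    cases h3 : T k with
    | nil => rfl
    | cons b T' => simp [h3] at h1
  | cons a S' =>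
    rw [h2] at h1
    cases h3 : T k with
    | nil => simp [h3] at h1
    | cons b T' =>
      rw [h3] at h1
      simp only [List.map_cons, List.cons.injEq] at h1
      simpa using h1.1

theorem StackRel.congr {S S' : Store q} {T : ∀ k, List (Γ k)} (h : e.StackRel S T)
    (hS : ∀ r, 3 ≤ r → S' r = S r) : e.StackRel S' T := fun k => by
  rw [hS _ (by omega)]
  exact h k

variable [DecidableEq K]

theorem StackRel.update {S : Store q} {T : ∀ k, List (Γ k)} (h : e.StackRel S T) (k : K)
    {l : List (Sym q)} {l' : List (Γ k)} (hl : l.map (e.de k) = l'.map some) :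
    e.StackRel (update S (3 + e.idx k) l) (update T k l') := by
  intro k'
  by_cases hk : k' = k
  · subst hk
    simpa using hl
  · have : 3 + e.idx k' ≠ 3 + e.idx k := fun h => hk (e.idx_injective (by omega))
    rw [Function.update_of_ne hk, Function.update_of_ne this]
    exact h k'

variable (e)

/-- The register holds neither a state nor a stack. -/
def Free (r : ℕ) : Prop := r ≠ 1 ∧ r ≠ 2 ∧ ∀ k, r ≠ 3 + e.idx k

/-- A statement is simulated in constant time. -/
theorem exists_time_tr (s : Stmt Γ Λ σ) (hs : e.Encodes s) : ∃ R, ∀ v S T, e.StackRel S T →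
    S 1 = [] → S 2 = [] → ∃ S', RunsIn (e.tr s v) S S' R ∧ e.CfgRel S' (stepAux s v T) ∧
      ∀ r, e.Free r → S' r = S r := by
  induction s with
  | push k f s ih =>
    obtain ⟨R, hR⟩ := ih hs.2
    refine ⟨1 + R, fun v S T h h1 h2 => ?_⟩
    obtain ⟨S', g1, g2, g3⟩ := hR v (update S (3 + e.idx k) (e.sy k (f v) :: S (3 + e.idx k)))
      (update T k (f v :: T k)) (h.update k (by simp [hs.1 v, h k]))
      (by rw [Function.update_of_ne (by omega), h1]) (by rw [Function.update_of_ne (by omega), h2])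
    refine ⟨S', RunsIn.seq (RunsIn.push rfl) g1, g2, fun r hr => ?_⟩
    rw [g3 r hr, Function.update_of_ne (hr.2.2 k)]
  | peek k f s ih =>
    obtain ⟨R, hR⟩ := ih hs
    refine ⟨R + 1, fun v S T h h1 h2 => ?_⟩
    obtain ⟨S', g1, g2, g3⟩ := hR (f v (T k).head?) S T h h1 h2
    refine ⟨S', RunsIn.case (a := (S (3 + e.idx k)).head?) rfl ?_, g2, g3⟩
    rw [h.head k]
    exact g1
  | pop k f s ih =>
    obtain ⟨R, hR⟩ := ih hs
    refine ⟨1 + R + 1, fun v S T h h1 h2 => ?_⟩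
    obtain ⟨S', g1, g2, g3⟩ := hR (f v (T k).head?)
      (update S (3 + e.idx k) (S (3 + e.idx k)).tail) (update T k (T k).tail)
      (h.update k (by rw [List.map_tail, h k, List.map_tail]))
      (by rw [Function.update_of_ne (by omega), h1]) (by rw [Function.update_of_ne (by omega), h2])
    refine ⟨S', RunsIn.case (a := (S (3 + e.idx k)).head?) rfl (RunsIn.seq (RunsIn.pop rfl) ?_), g2,
      fun r hr => ?_⟩
    · rw [h.head k]
      exact g1
    · rw [g3 r hr, Function.update_of_ne (hr.2.2 k)]
  | load f s ih =>
    obtain ⟨R, hR⟩ := ih hs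
    exact ⟨R, fun v S T h h1 h2 => hR (f v) S T h h1 h2⟩
  | branch f s₁ s₂ ih₁ ih₂ =>
    obtain ⟨R₁, hR₁⟩ := ih₁ hs.1
    obtain ⟨R₂, hR₂⟩ := ih₂ hs.2
    refine ⟨R₁ + R₂, fun v S T h h1 h2 => ?_⟩
    by_cases hf : f v = true
    · obtain ⟨S', g1, g2, g3⟩ := hR₁ v S T h h1 h2
      refine ⟨S', ?_, by simpa [stepAux, hf] using g2, g3⟩
      simp only [tr, hf, if_true]
      exact g1.mono (by omega)
    · obtain ⟨S', g1, g2, g3⟩ := hR₂ v S T h h1 h2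
      refine ⟨S', ?_, by simpa [stepAux, hf] using g2, g3⟩
      simp only [tr, hf]
      exact g1.mono (by omega)
  | goto f =>
    refine ⟨2, fun v S T h h1 h2 => ⟨_, RunsIn.seq (RunsIn.push rfl) (RunsIn.push rfl), ?_,
      fun r hr => ?_⟩⟩
    · refine ⟨by simp [h1, stepAux], by simp [h2, stepAux], h.congr fun r hr => ?_⟩
      rw [Function.update_of_ne (by omega), Function.update_of_ne (by omega)]
    · rw [Function.update_of_ne hr.2.1, Function.update_of_ne hr.1]
  | halt =>
    refine ⟨1, fun v S T h h1 h2 => ⟨_, RunsIn.push rfl, ?_, fun r hr => ?_⟩⟩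
    · refine ⟨by simp [h1, stepAux], by simp [h2, stepAux], h.congr fun r hr => ?_⟩
      rw [Function.update_of_ne (by omega)]
    · rw [Function.update_of_ne hr.2.1]

/-- One step of a machine, where a halted machine keeps its configuration. -/
def stepOrStay (m : Λ → Stmt Γ Λ σ) (c : Cfg Γ Λ σ) : Cfg Γ Λ σ := (step m c).getD c

/-- The program for one step. -/
def round (m : Λ → Stmt Γ Λ σ) : Prog q := .seq (.pop 0) (.case 1 fun a =>
  match a.bind e.deL with
  | none => .skip
  | some l => .case 2 fun b =>
    match b.bind e.deV with
    | none => .skip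
    | some v => .seq (.pop 1) (.seq (.pop 2) (e.tr (m l) v)))

/-- One step of the machine is simulated in constant time; register `0` is a clock. -/
theorem exists_time_round [Finite Λ] (m : Λ → Stmt Γ Λ σ) (hm : ∀ l, e.Encodes (m l)) :
    ∃ R, ∀ S c, e.CfgRel S c → ∃ S', RunsIn (e.round m) S S' R ∧
      e.CfgRel S' (stepOrStay m c) ∧ S' 0 = (S 0).tail ∧ ∀ r, r ≠ 0 → e.Free r → S' r = S r := by
  classical
  cases nonempty_fintype Λ
  choose R hR using fun l => e.exists_time_tr (m l) (hm l)
  refine ⟨(Finset.univ.sup R) + 5, fun S c h => ?_⟩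
  obtain ⟨l, v, T⟩ := c
  obtain ⟨h1, h2, h3⟩ := h
  have hT : e.StackRel (update S 0 (S 0).tail) T :=
    h3.congr fun r hr => Function.update_of_ne (by omega) _ _
  have e1 : update S 0 (S 0).tail 1 = S 1 := Function.update_of_ne (by omega) _ _
  have e2 : update S 0 (S 0).tail 2 = S 2 := Function.update_of_ne (by omega) _ _
  cases l with
  | none =>
    refine ⟨update S 0 (S 0).tail, (RunsIn.seq (RunsIn.pop rfl) (RunsIn.case (t := 1) (a := none)
      ?_ RunsIn.skip)).mono (by omega), ⟨?_, ?_, hT⟩, by simp, fun r h0 hr => ?_⟩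
    · rw [e1, h1]; rfl
    · rw [e1, h1]; rfl
    · rw [e2, h2]; rfl
    · rw [Function.update_of_ne h0]
  | some l =>
    set S₁ : Store q := update (update (update S 0 (S 0).tail) 1 []) 2 [] with hS₁
    obtain ⟨S', g1, g2, g3⟩ := hR l v S₁ T
      (h3.congr fun r hr => by
        rw [hS₁, Function.update_of_ne (by omega), Function.update_of_ne (by omega),
          Function.update_of_ne (by omega)]) (by simp [hS₁]) (by simp [hS₁])
    refine ⟨S', (RunsIn.seq (RunsIn.pop rfl) (RunsIn.case (t := R l + 3) (a := some (e.syL l))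
      ?_ ?_)).mono ?_, g2, ?_, fun r h0 hr => ?_⟩
    · rw [e1, h1]; rfl
    · have : ((some (e.syL l)).bind e.deL) = some l := e.deL_syL l
      simp only [this]
      refine RunsIn.case (t := R l + 2) (a := some (e.syV v)) ?_ ?_
      · rw [e2, h2]; rfl
      · have : ((some (e.syV v)).bind e.deV) = some v := e.deV_syV v
        simp only [this]
        refine (RunsIn.seq (RunsIn.pop rfl) (RunsIn.seq (RunsIn.pop rfl) ?_)).mono
          (t := 1 + (1 + R l)) (by omega)
        rw [Function.update_of_ne (by norm_num : (2 : ℕ) ≠ 1), e1, e2, h1, h2]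
        exact g1
    · have := Finset.le_sup (f := R) (Finset.mem_univ l)
      omega
    · rw [g3 0 ⟨by omega, by omega, fun k => by omega⟩, hS₁, Function.update_of_ne (by omega),
        Function.update_of_ne (by omega), Function.update_self]
    · rw [g3 r hr, hS₁, Function.update_of_ne hr.2.1, Function.update_of_ne hr.1,
        Function.update_of_ne h0]

/-- As many steps as the clock in register `0` prescribes are simulated in linear time. -/
theorem exists_time_rounds [Finite Λ] (m : Λ → Stmt Γ Λ σ) (hm : ∀ l, e.Encodes (m l)) :
    ∃ R, ∀ n S c, e.CfgRel S c → (S 0).length = n → ∃ S',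
      RunsIn (.loop 0 (e.round m)) S S' (n * R + 1) ∧
      e.CfgRel S' ((stepOrStay m)^[n] c) ∧ S' 0 = [] ∧ ∀ r, r ≠ 0 → e.Free r → S' r = S r := by
  obtain ⟨R, hR⟩ := e.exists_time_round m hm
  refine ⟨R + 1, fun n => ?_⟩
  induction n with
  | zero =>
    intro S c h h0
    have h0 := List.length_eq_zero_iff.1 h0
    exact ⟨S, (RunsIn.loop_nil h0).mono (by omega), h, h0, fun _ _ _ => rfl⟩
  | succ n ih =>
    intro S c h h0
    obtain ⟨S₁, g1, g2, g3, g4⟩ := hR S c h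
    obtain ⟨S₂, k1, k2, k3, k4⟩ := ih S₁ (stepOrStay m c) g2 (by rw [g3]; simp [h0])
    refine ⟨S₂, (RunsIn.loop_cons ?_ g1 k1).mono ?_, k2, k3, fun r hr hf => ?_⟩
    · intro hn
      simp [hn] at h0
    · rw [add_mul]
      omega
    · rw [k4 r hr hf, g4 r hr hf]

end Coding

end Simulation

open Turing.TM2 in
/-- The initial configuration on input `w`. -/
def Machine.start (M : Machine) (w : List (Option Bool)) : Cfg M.tm.Γ M.tm.Λ M.tm.σ :=
  Turing.initList M.tm (w.map M.inputAlphabet.symm)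

open Turing.TM2 Coding in
/-- The configuration of the machine on input `w` after `n` steps. -/
def Machine.run (M : Machine) (w : List (Option Bool)) (n : ℕ) :
    Cfg M.tm.Γ M.tm.Λ M.tm.σ :=
  (stepOrStay M.tm.m)^[n] (M.start w)

/-- On input `w` the machine halts within `n` steps and its first output symbol is `1`. -/
def Machine.AcceptsIn (M : Machine) (w : List (Option Bool)) (n : ℕ) : Prop :=
  (M.run w n).l = none ∧ ((M.run w n).stk M.tm.k₁).head? = some (M.outputAlphabet.symm true)

namespace Machine

open Turing.TM2 Coding

variable {M : Machine} {w : List (Option Bool)} {b : Bool} {t n : ℕ}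

/-- Before it halts, the machine with idle steps after halting is the machine. -/
theorem iterate_stepOrStay {K : Type} [DecidableEq K] {Γ : K → Type} {Λ σ : Type}
    {m : Λ → Stmt Γ Λ σ} {c c' : Cfg Γ Λ σ} {n : ℕ} (h : StepsTo m c c' n) :
    (stepOrStay m)^[n] c = c' := by
  have hnone : ∀ n, (flip bind (step m))^[n] none = none := by
    intro n
    induction n with
    | zero => rfl
    | succ n ih => rw [Function.iterate_succ_apply]; exact ih
  induction n generalizing c with
  | zero => exact Option.some.inj h
  | succ n ih =>
    unfold StepsTo at h ih
    rw [Function.iterate_succ_apply] at h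
    change (flip bind (step m))^[n] (step m c) = some c' at h
    rw [Function.iterate_succ_apply]
    cases hs : step m c with
    | none => rw [hs, hnone] at h; cases h
    | some d =>
      rw [hs] at h
      have : stepOrStay m c = d := by simp [stepOrStay, hs]
      rw [this]
      exact ih h

theorem iterate_stepOrStay_of_halted {K : Type} [DecidableEq K] {Γ : K → Type} {Λ σ : Type}
    {m : Λ → Stmt Γ Λ σ} {c : Cfg Γ Λ σ} (h : c.l = none) (n : ℕ) :
    (stepOrStay m)^[n] c = c := by
  have h1 : stepOrStay m c = c := by
    obtain ⟨l, v, T⟩ := c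
    cases h
    rfl
  exact Function.iterate_fixed h1 n

theorem run_add (n d : ℕ) : M.run w (n + d) = (stepOrStay M.tm.m)^[d] (M.run w n) := by
  unfold run
  rw [Nat.add_comm, Function.iterate_add_apply]

theorem run_of_outputsBit (h : M.OutputsBit w b t) (hn : t ≤ n) :
    M.run w n = Turing.haltList M.tm [M.outputAlphabet.symm b] := by
  obtain ⟨⟨⟨s, hs⟩, hst⟩⟩ := h
  change s ≤ t at hst
  have h1 : M.run w s = Turing.haltList M.tm [M.outputAlphabet.symm b] := iterate_stepOrStay hs
  obtain ⟨d, rfl⟩ := Nat.exists_eq_add_of_le (hst.trans hn)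
  rw [run_add, h1]
  exact iterate_stepOrStay_of_halted rfl d

theorem stk_haltList (tm : Turing.FinTM2) (l : List (tm.Γ tm.k₁)) :
    (Turing.haltList tm l).stk tm.k₁ = l := by
  simp [Turing.haltList]

/-- A clock that is sufficient for the machine gives the correct answer. -/
theorem acceptsIn_iff (h : M.OutputsBit w b t) (hn : t ≤ n) : M.AcceptsIn w n ↔ b = true := by
  have h1 := run_of_outputsBit h hn
  unfold AcceptsIn
  rw [h1, stk_haltList]
  simp [Turing.haltList]

/-- Whatever the clock, an accepting run tells the truth. -/
theorem eq_true_of_acceptsIn (h : M.OutputsBit w b t) (hn : M.AcceptsIn w n) : b = true := by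
  refine (acceptsIn_iff h (le_max_left t n)).1 ?_
  have : M.run w (max t n) = M.run w n := by
    obtain ⟨d, hd⟩ := Nat.exists_eq_add_of_le (le_max_right t n)
    rw [hd, run_add]
    exact iterate_stepOrStay_of_halted hn.1 d
  unfold AcceptsIn
  rw [this]
  exact hn

end Machine

end ParaCircuit

namespace ParaCircuit

open Function (update)

variable {q : ℕ}

/-! ### Simulation of a machine in linear time -/

section

open Turing.TM2

variable {K : Type} {Γ : K → Type} {Λ σ : Type}

/-- The symbols that a statement may push. -/
def pushedSymbols : Stmt Γ Λ σ → Set (Σ k, Γ k)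
  | .push k f s => Set.range (fun v => (⟨k, f v⟩ : Σ k, Γ k)) ∪ pushedSymbols s
  | .peek _ _ s => pushedSymbols s
  | .pop _ _ s => pushedSymbols s
  | .load _ s => pushedSymbols s
  | .branch _ s₁ s₂ => pushedSymbols s₁ ∪ pushedSymbols s₂
  | .goto _ => ∅
  | .halt => ∅

theorem finite_pushedSymbols [Finite σ] (s : Stmt Γ Λ σ) : (pushedSymbols s).Finite := by
  induction s with
  | push k f s ih => exact (Set.finite_range _).union ih
  | peek _ _ _ ih => exact ih
  | pop _ _ _ ih => exact ih
  | load _ _ ih => exact ih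
  | branch _ _ _ ih₁ ih₂ => exact ih₁.union ih₂
  | goto _ => exact Set.finite_empty
  | halt => exact Set.finite_empty

theorem Coding.encodes_of_pushedSymbols (e : Coding q Γ Λ σ) (s : Stmt Γ Λ σ)
    (h : ∀ x ∈ pushedSymbols s, e.de x.1 (e.sy x.1 x.2) = some x.2) : e.Encodes s := by
  induction s with
  | push k f s ih =>
    exact ⟨fun v => h ⟨k, f v⟩ (Or.inl ⟨v, rfl⟩), ih fun x hx => h x (Or.inr hx)⟩
  | peek _ _ _ ih => exact ih h
  | pop _ _ _ ih => exact ih h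
  | load _ _ ih => exact ih h
  | branch _ _ _ ih₁ ih₂ =>
    exact ⟨ih₁ fun x hx => h x (Or.inl hx), ih₂ fun x hx => h x (Or.inr hx)⟩
  | goto _ => trivial
  | halt => trivial

open Classical in
/-- Only finitely many stack symbols have to be represented: those of the input alphabet and those
that the machine may push. -/
theorem exists_coding [Fintype K] [Finite Λ] [Finite σ] (U : Set (Σ k, Γ k)) (hU : U.Finite) :
    ∃ q₀, ∀ q, q₀ ≤ q → ∃ e : Coding q Γ Λ σ,
      (∀ x ∈ U, e.de x.1 (e.sy x.1 x.2) = some x.2) ∧ ∀ k, e.idx k < Fintype.card K := by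
  have := hU.to_subtype
  obtain ⟨n, ⟨f⟩⟩ := Finite.exists_equiv_fin (Λ ⊕ σ ⊕ U)
  refine ⟨n, fun q hq => ?_⟩
  -- states and required stack symbols get distinct extra symbols, hence `n` of these are needed
  set code : Λ ⊕ σ ⊕ U → Sym q := fun w => Sum.inr (Fin.castLE hq (f w)) with hcode
  have inj : code.Injective := fun a b h =>
    f.injective (Fin.castLE_injective hq (Sum.inr.inj h))
  have dec := fun w => Function.partialInv_left inj w
  refine ⟨{
    idx := fun k => Fintype.equivFin K k
    idx_injective := fun a b h => (Fintype.equivFin K).injective (Fin.ext h)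
    sy := fun k a => if h : (⟨k, a⟩ : Σ k, Γ k) ∈ U then code (.inr (.inr ⟨_, h⟩)) else sepS
    de := fun k s => match Function.partialInv code s with
      | some (.inr (.inr x)) => if h : x.1.1 = k then some (h ▸ x.1.2) else none
      | _ => none
    syL := fun l => code (.inl l)
    deL := fun s => match Function.partialInv code s with
      | some (.inl l) => some l
      | _ => none
    deL_syL := fun l => by simp only [dec]
    syV := fun v => code (.inr (.inl v))
    deV := fun s => match Function.partialInv code s with
      | some (.inr (.inl v)) => some v
      | _ => none
    deV_syV := fun v => by simp only [dec] }, fun x hx => ?_, fun k => Fin.is_lt _⟩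
  obtain ⟨k, a⟩ := x
  simp only [dif_pos hx, dec, dif_pos]

end

/-- Clears the registers below `N`, whatever they contain. -/
theorem Prog.exists_clear_all (N : ℕ) : ∃ p : Prog q, ∀ s B, (∀ r, (s r).length ≤ B) →
    RunsIn p s (fun r => if r < N then [] else s r) (N * (2 * B + 1) + 1) := by
  induction N with
  | zero => exact ⟨.skip, fun s B _ => RunsIn.skip.mono (by omega)⟩
  | succ N ih =>
    obtain ⟨p, hp⟩ := ih
    refine ⟨.seq p (Prog.clear N), fun s B h => ?_⟩
    refine ((RunsIn.seq (hp s B h) (Prog.clear_runsIn _ N)).congr ?_).mono ?_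
    · funext r
      by_cases hr : r = N
      · subst hr; simp
      · rw [Function.update_of_ne hr]
        by_cases h1 : r < N
        · rw [if_pos h1, if_pos (by omega)]
        · rw [if_neg h1, if_neg (by omega)]
    · have := h N
      simp only [lt_irrefl, if_false]
      rw [add_mul]
      omega

open Classical Coding in
/-- A machine can be simulated in linear time, given a program that loads its input. -/
theorem Machine.dp_acceptsIn_of_load {M : Machine} (e : Coding q M.tm.Γ M.tm.Λ M.tm.σ)
    (hm : ∀ l, e.Encodes (M.tm.m l)) (hin : ∀ a, e.de M.tm.k₀ (e.sy M.tm.k₀ a) = some a)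
    (N : ℕ) (hN : ∀ k, 3 + e.idx k < N) {w : (ℕ → ℕ) → List (Option Bool)} {ld : Prog q} {c : ℕ}
    (hld : ∀ v, (∀ r, 4 ≤ r → v r = 0) → RunsIn ld (cx v)
      (fun r => if r = 0 then enc (v 0) else if r = 3 + e.idx M.tm.k₀ then
        (w v).map (fun a => e.sy M.tm.k₀ (M.inputAlphabet.symm a)) else []) (c * total 4 v + c)) :
    ∃ C, Dp q 4 (fun v => if M.AcceptsIn (w v) (v 0).size then 1 else 0)
      (fun v => C * total 4 v + C) := by
  have : Fintype M.tm.Λ := M.tm.ΛFin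
  obtain ⟨R, hR⟩ := e.exists_time_rounds M.tm.m hm
  obtain ⟨pc, hpc⟩ := Prog.exists_clear_all (q := q) N
  set out : Prog q := .case 1 fun a => if a = none then .case (3 + e.idx M.tm.k₁) fun b =>
    if b.bind (e.de M.tm.k₁) = some (M.outputAlphabet.symm true) then
      .seq pc (.push 0 (bitS true)) else pc else pc with hout
  set A := 1 + c + R with hA
  set E := c + 3 with hE
  refine ⟨A + N * (2 * A) + E + N * (2 * E + 1) + 4,
    .seq ld (.seq (.push 1 (e.syL M.tm.main)) (.seq (.push 2 (e.syV M.tm.initialState))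
      (.seq (.loop 0 (e.round M.tm.m)) out))), fun v hv => ?_⟩
  set S₀ : Store q := fun r => if r = 0 then enc (v 0) else if r = 3 + e.idx M.tm.k₀ then
        (w v).map (fun a => e.sy M.tm.k₀ (M.inputAlphabet.symm a)) else [] with hS₀
  set S₁ : Store q := update (update S₀ 1 [e.syL M.tm.main]) 2 [e.syV M.tm.initialState] with hS₁
  have z1 : S₀ 1 = [] := by simp only [hS₀]; rw [if_neg (by omega), if_neg (by omega)]
  have z2 : S₀ 2 = [] := by simp only [hS₀]; rw [if_neg (by omega), if_neg (by omega)]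
  have r1 : RunsIn (.push 1 (e.syL M.tm.main)) S₀ (update S₀ 1 [e.syL M.tm.main]) 1 :=
    RunsIn.push (by rw [z1])
  have r2 : RunsIn (.push 2 (e.syV M.tm.initialState)) (update S₀ 1 [e.syL M.tm.main]) S₁ 1 :=
    RunsIn.push (by rw [Function.update_of_ne (by norm_num), z2])
  have start : e.CfgRel S₁ (M.start (w v)) := by
    refine ⟨?_, ?_, fun k => ?_⟩
    · simp [hS₁, Machine.start, Turing.initList]
    · simp [hS₁, Machine.start, Turing.initList]
    · rw [hS₁, Function.update_of_ne (by omega), Function.update_of_ne (by omega)]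
      simp only [hS₀]
      rw [if_neg (by omega)]
      by_cases hk : k = M.tm.k₀
      · subst hk
        simp [Machine.start, Turing.initList, hin]
      · rw [if_neg fun h => hk (e.idx_injective (by omega))]
        simp [Machine.start, Turing.initList, hk]
  obtain ⟨S₂, g1, g2, g3, g4⟩ := hR (v 0).size S₁ _ start
    (by simp [hS₁, hS₀, length_enc])
  have pre := RunsIn.seq (hld v hv) (RunsIn.seq r1 (RunsIn.seq r2 g1))
  set t := total 4 v with ht
  have hsz : (v 0).size ≤ t := size_le_total (by norm_num) v
  have hsR : (v 0).size * R ≤ t * R := Nat.mul_le_mul_right R hsz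
  -- the registers are no longer than the time used so far permits, so that they can be cleared
  have len : ∀ r, (S₂ r).length ≤ A * t + E := by
    intro r
    have h1 := pre.length_le r
    have h2 : ((cx v : Store q) r).length ≤ t := by
      simp only [cx, length_enc]
      by_cases hr : r < 4
      · exact size_le_total hr v
      · rw [hv r (by omega)]; simp
    have : A * t = t + c * t + t * R := by rw [hA]; ring
    omega
  have empty : (fun r => if r < N then [] else S₂ r) = (cx (fun _ => 0) : Store q) := by
    funext r
    simp only [cx, enc_zero]
    by_cases hr : r < N
    · rw [if_pos hr]
    · rw [if_neg hr]
      have h3 := hN M.tm.k₀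
      have hf : e.Free r := ⟨by omega, by omega, fun k h => hr (h ▸ hN k)⟩
      rw [g4 r (by omega) hf, hS₁, Function.update_of_ne (by omega),
        Function.update_of_ne (by omega)]
      simp only [hS₀]
      rw [if_neg (by omega), if_neg (by omega)]
  have clr := hpc S₂ _ len
  rw [empty] at clr
  have fin : RunsIn out S₂ (cx (update (fun _ => 0) 0
      (if M.AcceptsIn (w v) (v 0).size then 1 else 0))) (N * (2 * (A * t + E) + 1) + 1 + 3) := by
    have hrun : (Coding.stepOrStay M.tm.m)^[(v 0).size] (M.start (w v))
      = M.run (w v) (v 0).size := rfl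
    rw [hrun] at g2
    have hhead := g2.2.2.head M.tm.k₁
    have hl : (S₂ 1).head? = none ↔ (M.run (w v) (v 0).size).l = none := by
      rw [g2.1]
      cases (M.run (w v) (v 0).size).l <;> simp
    refine (RunsIn.case (t := N * (2 * (A * t + E) + 1) + 1 + 2) rfl ?_).mono (by omega)
    by_cases h1 : (S₂ 1).head? = none
    · rw [if_pos h1]
      refine (RunsIn.case (t := N * (2 * (A * t + E) + 1) + 1 + 1) rfl ?_).mono (by omega)
      rw [hhead]
      by_cases h2 : ((M.run (w v) (v 0).size).stk M.tm.k₁).head?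
        = some (M.outputAlphabet.symm true)
      · have acc : M.AcceptsIn (w v) (v 0).size := ⟨hl.1 h1, h2⟩
        rw [if_pos h2, if_pos acc]
        refine RunsIn.seq clr (RunsIn.push ?_)
        funext r
        by_cases hr : r = 0
        · subst hr; simp [cx, enc]
        · simp [cx, hr]
      · have acc : ¬ M.AcceptsIn (w v) (v 0).size := fun h => h2 h.2
        rw [if_neg h2, if_neg acc]
        refine (clr.congr ?_).mono (by omega)
        rw [Function.update_eq_self]
    · have acc : ¬ M.AcceptsIn (w v) (v 0).size := fun h => h1 (hl.2 h.1)
      rw [if_neg h1, if_neg acc]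
      refine (clr.congr ?_).mono (by omega)
      rw [Function.update_eq_self]
  have total_run := RunsIn.seq (hld v hv) (RunsIn.seq r1 (RunsIn.seq r2 (RunsIn.seq g1 fin)))
  refine total_run.mono ?_
  have e1 : (A + N * (2 * A) + E + N * (2 * E + 1) + 4) * t
    = (t + c * t + t * R) + N * (2 * A * t) + (E + N * (2 * E + 1) + 4) * t := by rw [hA]; ring
  have e2 : N * (2 * (A * t + E) + 1) = N * (2 * A * t) + N * (2 * E + 1) := by ring
  change c * t + c + (1 + (1 + ((v 0).size * R + 1 + (N * (2 * (A * t + E) + 1) + 1 + 3)))) ≤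
    (A + N * (2 * A) + E + N * (2 * E + 1) + 4) * t + (A + N * (2 * A) + E + N * (2 * E + 1) + 4)
  rw [e1, e2]
  omega

open Classical in
/-- Two and three numbers as the input of a simulated machine, the length of the number in register
`0` being the clock. The symbols that code the machine have to be available, hence the lower bound
on `q`. -/
theorem Machine.exists_dp_acceptsIn (M : Machine) : ∃ q₀, ∀ q, q₀ ≤ q → ∃ C,
    Dp q 4 (fun v => if M.AcceptsIn (bin (v 1) ++ none :: bin (v 2)) (v 0).size then 1 else 0)
      (fun v => C * total 4 v + C) ∧
    Dp q 4 (fun v => if M.AcceptsIn (bin (v 1) ++ none :: bin (v 2) ++ none :: bin (v 3))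
      (v 0).size then 1 else 0) (fun v => C * total 4 v + C) := by
  have : Fintype M.tm.Λ := M.tm.ΛFin
  have : Fintype M.tm.σ := M.tm.σFin
  have : Fintype M.tm.K := M.tm.kFin
  have : Fintype (M.tm.Γ M.tm.k₀) := M.tm.Γk₀Fin
  obtain ⟨q₀, h⟩ := exists_coding (Λ := M.tm.Λ) (σ := M.tm.σ)
    (Set.range (fun a => (⟨M.tm.k₀, a⟩ : Σ k, M.tm.Γ k)) ∪ ⋃ l, pushedSymbols (M.tm.m l))
    ((Set.finite_range _).union (Set.finite_iUnion fun l => finite_pushedSymbols _))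
  refine ⟨q₀, fun q hq => ?_⟩
  obtain ⟨e, he, hidx⟩ := h q hq
  have hm : ∀ l, e.Encodes (M.tm.m l) := fun l => e.encodes_of_pushedSymbols _ fun x hx =>
    he x (Or.inr (Set.mem_iUnion.2 ⟨l, hx⟩))
  have hin : ∀ a, e.de M.tm.k₀ (e.sy M.tm.k₀ a) = some a := fun a =>
    he ⟨M.tm.k₀, a⟩ (Or.inl ⟨a, rfl⟩)
  set N := 4 + Fintype.card M.tm.K with hN
  set T := 3 + e.idx M.tm.k₀ with hT
  have hTN : T < N := by have := hidx M.tm.k₀; omega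
  set g : Option Bool → Sym q := fun a => e.sy M.tm.k₀ (M.inputAlphabet.symm a) with hg
  set G : Sym q → Sym q := fun a => a.elim g fun _ => a with hG
  have enc_map : ∀ x, (enc x : List (Sym q)).map G = (bin x).map g := by
    intro x
    simp [enc, bin, hG, Function.comp_def]
  -- moving a number twice restores the order of its digits; the first move goes to a scratch
  -- register among `N`, `N + 1`, `N + 2`, the second one to the input stack, beginning with the
  -- last argument
  have rev : ∀ (S : Store q) (r i x : ℕ), r ≠ i → S r = enc x → S i = [] →
      RunsIn (Prog.mv id r i) S (update (update S r []) i (enc x).reverse) (4 * x.size + 1) := by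
    intro S r i x hri h1 h2
    have h3 := Prog.mv_runsIn id S hri
    rw [h1, h2, List.map_id, List.append_nil, length_enc] at h3
    exact h3
  have ins : ∀ (S : Store q) (i x : ℕ) (w : List (Option Bool)), i ≠ T →
      S i = (enc x).reverse → S T = w.map g → RunsIn (Prog.mv G i T) S
      (update (update S i []) T ((bin x ++ w).map g)) (4 * x.size + 1) := by
    intro S i x w hi h1 h2
    have h3 := Prog.mv_runsIn G S hi
    rw [h1, h2, List.map_reverse, List.reverse_reverse, enc_map, List.length_reverse,
      length_enc, ← List.map_append] at h3
    exact h3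
  have sep : ∀ (S : Store q) (w : List (Option Bool)), S T = w.map g →
      RunsIn (.push T (g none)) S (update S T ((none :: w).map g)) 1 := by
    intro S w h
    exact RunsIn.push (by rw [h]; rfl)
  have hT3 : 3 ≤ T := by omega
  obtain ⟨C, hC⟩ := Machine.dp_acceptsIn_of_load e hm hin N
    (fun k => by have := hidx k; omega) (c := 12)
    (w := fun v => bin (v 1) ++ none :: bin (v 2))
    (ld := .seq (Prog.clear 3) (.seq (Prog.mv id 2 N) (.seq (Prog.mv id 1 (N + 1))
      (.seq (Prog.mv G N T) (.seq (.push T (g none)) (Prog.mv G (N + 1) T)))))) (by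
    intro v hv
    have h1 := Prog.clear_runsIn (cx v : Store q) 3
    have h2 := rev (update (cx v) 3 []) 2 N (v 2) (by omega) (by simp [cx])
      (by simp [cx, Function.update_of_ne (show N ≠ 3 by omega), hv N (by omega), enc_zero])
    have h3 := rev _ 1 (N + 1) (v 1) (by omega)
      (show update (update (update (cx v : Store q) 3 []) 2 []) N (enc (v 2)).reverse 1 = enc (v 1) by
        rw [Function.update_of_ne (by omega), Function.update_of_ne (by omega),
          Function.update_of_ne (by omega)]; rfl)
      (by rw [Function.update_of_ne (by omega), Function.update_of_ne (by omega),
          Function.update_of_ne (by omega)]; simp [cx, hv (N + 1) (by omega), enc_zero])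
    have hTz : update (cx v : Store q) 3 [] T = [] := by
      by_cases h : T = 3
      · rw [h]; simp
      · rw [Function.update_of_ne h]
        simp [cx, hv T (by omega), enc_zero]
    have h4 := ins _ N (v 2) [] (by omega)
      (show update (update (update (update (update (cx v : Store q) 3 []) 2 []) N
        (enc (v 2)).reverse) 1 []) (N + 1) (enc (v 1)).reverse N = (enc (v 2)).reverse by
        rw [Function.update_of_ne (by omega), Function.update_of_ne (by omega),
          Function.update_self])
      (by rw [Function.update_of_ne (by omega), Function.update_of_ne (by omega),
          Function.update_of_ne (by omega), Function.update_of_ne (by omega), hTz]; rfl)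
    rw [List.append_nil] at h4
    have h5 := sep _ (bin (v 2)) (Function.update_self T ((bin (v 2)).map g) (update
      (update (update (update (update (update (cx v : Store q) 3 []) 2 []) N
        (enc (v 2)).reverse) 1 []) (N + 1) (enc (v 1)).reverse) N []))
    have h6 := ins _ (N + 1) (v 1) (none :: bin (v 2)) (by omega)
      (show update (update (update (update (update (update (update (update (cx v : Store q) 3 []) 2 [])
        N (enc (v 2)).reverse) 1 []) (N + 1) (enc (v 1)).reverse) N []) T ((bin (v 2)).map g)) T
        ((none :: bin (v 2)).map g) (N + 1) = (enc (v 1)).reverse by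
        rw [Function.update_of_ne (by omega), Function.update_of_ne (by omega),
          Function.update_of_ne (by omega), Function.update_self]) (Function.update_self _ _ _)
    refine ((RunsIn.seq h1 (RunsIn.seq h2 (RunsIn.seq h3 (RunsIn.seq h4
      (RunsIn.seq h5 h6))))).congr ?_).mono ?_
    · funext r
      rw [← hT]
      by_cases r1 : r = T
      · subst r1
        rw [Function.update_self, if_neg (by omega), if_pos rfl]
      · rw [Function.update_of_ne r1, if_neg r1]
        by_cases r2 : r = N + 1
        · subst r2; simp
        · rw [Function.update_of_ne r2, Function.update_of_ne r1, Function.update_of_ne r1]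
          by_cases r3 : r = N
          · subst r3
            rw [Function.update_self, if_neg (by omega)]
          · rw [Function.update_of_ne r3, Function.update_of_ne r2]
            by_cases r4 : r = 1
            · subst r4; simp
            · rw [Function.update_of_ne r4, Function.update_of_ne r3]
              by_cases r5 : r = 2
              · subst r5; simp
              · rw [Function.update_of_ne r5]
                by_cases r6 : r = 3
                · subst r6; simp
                · rw [Function.update_of_ne r6]
                  by_cases r7 : r = 0
                  · subst r7; rfl
                  · rw [if_neg r7]
                    simp [cx, hv r (by omega), enc_zero]
    · have e1 : ((cx v : Store q) 3).length = (v 3).size := length_enc _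
      rw [e1]
      simp only [total, Finset.sum_range_succ, Finset.sum_range_zero]
      omega)
  obtain ⟨C', hC'⟩ := Machine.dp_acceptsIn_of_load e hm hin N
    (fun k => by have := hidx k; omega) (c := 12)
    (w := fun v => bin (v 1) ++ none :: bin (v 2) ++ none :: bin (v 3))
    (ld := .seq (Prog.mv id 3 (N + 2)) (.seq (Prog.mv id 2 N) (.seq (Prog.mv id 1 (N + 1))
      (.seq (Prog.mv G (N + 2) T) (.seq (.push T (g none)) (.seq
      (Prog.mv G N T) (.seq (.push T (g none)) (Prog.mv G (N + 1) T)))))))) (by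
    intro v hv
    have h1 := rev (cx v) 3 (N + 2) (v 3) (by omega) rfl (by simp [cx, hv (N + 2) (by omega), enc_zero])
    set s₁ := update (update (cx v : Store q) 3 []) (N + 2) (enc (v 3)).reverse with hs₁
    have h2 := rev s₁ 2 N (v 2) (by omega)
      (by rw [hs₁, Function.update_of_ne (by omega), Function.update_of_ne (by omega)]; rfl)
      (by rw [hs₁, Function.update_of_ne (by omega), Function.update_of_ne (by omega)]
          simp [cx, hv N (by omega), enc_zero])
    set s₂ := update (update s₁ 2 []) N (enc (v 2)).reverse with hs₂
    have h3 := rev s₂ 1 (N + 1) (v 1) (by omega)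
      (by rw [hs₂, hs₁, Function.update_of_ne (by omega), Function.update_of_ne (by omega),
          Function.update_of_ne (by omega), Function.update_of_ne (by omega)]; rfl)
      (by rw [hs₂, hs₁, Function.update_of_ne (by omega), Function.update_of_ne (by omega),
          Function.update_of_ne (by omega), Function.update_of_ne (by omega)]
          simp [cx, hv (N + 1) (by omega), enc_zero])
    set s₃ := update (update s₂ 1 []) (N + 1) (enc (v 1)).reverse with hs₃
    have hTz : update (cx v : Store q) 3 [] T = [] := by
      by_cases h : T = 3
      · rw [h]; simp
      · rw [Function.update_of_ne h]
        simp [cx, hv T (by omega), enc_zero]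
    have h4 := ins s₃ (N + 2) (v 3) [] (by omega)
      (by rw [hs₃, hs₂, hs₁, Function.update_of_ne (by omega), Function.update_of_ne (by omega),
          Function.update_of_ne (by omega), Function.update_of_ne (by omega),
          Function.update_self])
      (by rw [hs₃, hs₂, hs₁, Function.update_of_ne (by omega), Function.update_of_ne (by omega),
          Function.update_of_ne (by omega), Function.update_of_ne (by omega),
          Function.update_of_ne (by omega), hTz]; rfl)
    rw [List.append_nil] at h4
    set s₄ := update (update s₃ (N + 2) []) T ((bin (v 3)).map g) with hs₄
    have h5 := sep s₄ (bin (v 3)) (Function.update_self _ _ _)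
    set s₅ := update s₄ T ((none :: bin (v 3)).map g) with hs₅
    have h6 := ins s₅ N (v 2) (none :: bin (v 3)) (by omega)
      (by rw [hs₅, hs₄, hs₃, hs₂, Function.update_of_ne (by omega), Function.update_of_ne (by omega),
          Function.update_of_ne (by omega), Function.update_of_ne (by omega),
          Function.update_of_ne (by omega), Function.update_self]) (Function.update_self _ _ _)
    set s₆ := update (update s₅ N []) T ((bin (v 2) ++ none :: bin (v 3)).map g) with hs₆
    have h7 := sep s₆ _ (Function.update_self _ _ _)
    set s₇ := update s₆ T ((none :: (bin (v 2) ++ none :: bin (v 3))).map g) with hs₇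
    have h8 := ins s₇ (N + 1) (v 1) _ (by omega)
      (by rw [hs₇, hs₆, hs₅, hs₄, hs₃, Function.update_of_ne (by omega),
          Function.update_of_ne (by omega), Function.update_of_ne (by omega),
          Function.update_of_ne (by omega), Function.update_of_ne (by omega),
          Function.update_of_ne (by omega), Function.update_self]) (Function.update_self _ _ _)
    refine ((RunsIn.seq h1 (RunsIn.seq h2 (RunsIn.seq h3 (RunsIn.seq h4
      (RunsIn.seq h5 (RunsIn.seq h6 (RunsIn.seq h7 h8))))))).congr ?_).mono ?_
    · funext r
      rw [← hT]
      by_cases r1 : r = T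
      · subst r1
        rw [Function.update_self, if_neg (by omega), if_pos rfl, List.append_assoc]
        rfl
      rw [Function.update_of_ne r1, if_neg r1]
      by_cases r2 : r = N + 1
      · subst r2; simp
      rw [Function.update_of_ne r2, hs₇, Function.update_of_ne r1, hs₆, Function.update_of_ne r1]
      by_cases r3 : r = N
      · subst r3
        rw [Function.update_self, if_neg (by omega)]
      rw [Function.update_of_ne r3, hs₅, Function.update_of_ne r1, hs₄, Function.update_of_ne r1]
      by_cases r4 : r = N + 2
      · subst r4; simp
      rw [Function.update_of_ne r4, hs₃, Function.update_of_ne r2]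
      by_cases r5 : r = 1
      · subst r5; simp
      rw [Function.update_of_ne r5, hs₂, Function.update_of_ne r3]
      by_cases r6 : r = 2
      · subst r6; simp
      rw [Function.update_of_ne r6, hs₁, Function.update_of_ne r4]
      by_cases r7 : r = 3
      · subst r7; simp
      rw [Function.update_of_ne r7]
      by_cases r8 : r = 0
      · subst r8; rfl
      · rw [if_neg r8]
        simp [cx, hv r (by omega), enc_zero]
    · simp only [total, Finset.sum_range_succ, Finset.sum_range_zero]
      omega)
  refine ⟨C + C', hC.mono fun v _ => ?_, hC'.mono fun v _ => ?_⟩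
  · rw [add_mul]; omega
  · rw [add_mul]; omega

/-- The answer of a machine after a number of steps that is given by the length of a number. -/
theorem Machine.exists_pb_acceptsIn (M : Machine) : ∃ q₀, ∀ q, q₀ ≤ q →
    (∀ (m : ℕ) (u i n : (ℕ → ℕ) → ℕ), PT q m u → PT q m i → PT q m n →
      PB q m fun v => M.AcceptsIn (bin (i v) ++ none :: bin (n v)) (u v).size) ∧
    ∀ (m : ℕ) (u i k n : (ℕ → ℕ) → ℕ), PT q m u → PT q m i → PT q m k → PT q m n →
      PB q m fun v => M.AcceptsIn (bin (i v) ++ none :: bin (k v) ++ none :: bin (n v))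
        (u v).size := by
  obtain ⟨q₀, h⟩ := M.exists_dp_acceptsIn
  refine ⟨q₀, fun q hq => ?_⟩
  obtain ⟨C, h₁, h₂⟩ := h q hq
  refine ⟨fun m u i n hu hi hn => ?_, fun m u i k n hu hi hk hn => ?_⟩
  · refine (PT.comp_aux (Ff := fun _ => C) (cf := C) (G := fun r => if r = 0 then u else
      if r = 1 then i else n) (Computable.const C) (h₁.mono fun v _ => by omega) (fun r _ => ?_)
      (Or.inr fun _ => rfl)).congr fun v => ?_
    · split_ifs
      · exact hu
      · exact hi
      · exact hn
    · simp
  · refine (PT.comp_aux (Ff := fun _ => C) (cf := C) (G := fun r => if r = 0 then u else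
      if r = 1 then i else if r = 2 then k else n) (Computable.const C)
      (h₂.mono fun v _ => by omega) (fun r _ => ?_) (Or.inr fun _ => rfl)).congr fun v => ?_
    · split_ifs
      · exact hu
      · exact hi
      · exact hk
      · exact hn
    · simp

end ParaCircuit

namespace ParaCircuit

/-! ### Circuits given by tables of numbers -/

/-- Truth of a gate with code `c` and parameter `p`, where `W` says which gates feed into it and `V`
gives their values. -/
def gateEval {α : Type} (x : ℕ → Bool) (c p : ℕ) (W : α → Prop) (V : α → Bool) : Prop :=
  match c with
  | 0 => x p = true
  | 1 => ∀ h, W h → V h = false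
  | 2 => ∀ h, W h → V h = true
  | 3 => ∃ h, W h ∧ V h = true
  | _ => p ≤ {h | W h ∧ V h = true}.ncard

/-- The truth of a gate is invariant under renaming of the gates that feed into it. -/
theorem gateEval_map {α β : Type} {φ : β → α} (hφ : φ.Injective) {x : ℕ → Bool} {c p : ℕ}
    {W : α → Prop} {W' : β → Prop} {V : α → Bool} {V' : β → Bool}
    (hW : ∀ h, W h ↔ ∃ h', W' h' ∧ φ h' = h) (hV : ∀ h', W' h' → V (φ h') = V' h') :
    gateEval x c p W V ↔ gateEval x c p W' V' := by
  have hW' : W = fun h => ∃ h', W' h' ∧ φ h' = h := funext fun h => propext (hW h)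
  subst hW'
  have all : ∀ b, (∀ h, (∃ h', W' h' ∧ φ h' = h) → V h = b) ↔ ∀ h', W' h' → V' h' = b := by
    intro b
    constructor
    · intro H h' hh
      rw [← hV h' hh]
      exact H _ ⟨h', hh, rfl⟩
    · rintro H _ ⟨h', hh, rfl⟩
      rw [hV h' hh]
      exact H h' hh
  match c with
  | 0 => exact Iff.rfl
  | 1 => exact all false
  | 2 => exact all true
  | 3 =>
    constructor
    · rintro ⟨_, ⟨h', hh, rfl⟩, hv⟩
      exact ⟨h', hh, by rw [← hV h' hh]; exact hv⟩
    · rintro ⟨h', hh, hv⟩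
      exact ⟨_, ⟨h', hh, rfl⟩, by rw [hV h' hh]; exact hv⟩
  | c + 4 =>
    have : {h | (∃ h', W' h' ∧ φ h' = h) ∧ V h = true} = φ '' {h' | W' h' ∧ V' h' = true} := by
      ext h
      constructor
      · rintro ⟨⟨h', hh, rfl⟩, hv⟩
        exact ⟨h', ⟨hh, by rw [← hV h' hh]; exact hv⟩, rfl⟩
      · rintro ⟨h', ⟨hh, hv⟩, rfl⟩
        exact ⟨⟨h', hh, rfl⟩, by rw [hV h' hh]; exact hv⟩
    simp only [gateEval]
    rw [this, Set.ncard_image_of_injective _ hφ]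

/-- An input, continued by zeros. -/
def ext {n : ℕ} (x : Fin n → Bool) (p : ℕ) : Bool := if h : p < n then x ⟨p, h⟩ else false

/-- Counting the true predecessors expresses the usual meaning of the gates. -/
theorem GateKind.apply_iff {n s : ℕ} {x : Fin n → Bool} (k : GateKind n s) (P : Finset (Fin s))
    (V : Fin s → Bool) :
    k.apply x P.card (P.filter fun h => V h = true).card = true ↔
      gateEval (ext x) k.code (k.param?.getD 0) (· ∈ P) V := by
  cases k with
  | input p => simp [GateKind.apply, gateEval, GateKind.code, GateKind.param?, ext]
  | not => simp [GateKind.apply, gateEval, GateKind.code, Finset.filter_eq_empty_iff]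
  | and =>
    simp only [GateKind.apply, gateEval, GateKind.code, decide_eq_true_eq]
    rw [Finset.card_filter_eq_iff]
  | or =>
    simp only [GateKind.apply, gateEval, GateKind.code, decide_eq_true_eq, Finset.card_pos,
      Finset.Nonempty, Finset.mem_filter]
  | threshold t =>
    simp only [GateKind.apply, gateEval, GateKind.code, decide_eq_true_eq, GateKind.param?,
      Option.getD_some]
    rw [← Set.ncard_coe_finset]
    simp

namespace Circuit

variable {n : ℕ} (C : Circuit n) (x : Fin n → Bool)

/-- Code of the type of gate `a`; beyond the size this is the code of an `or`-gate. -/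
def rcode (a : ℕ) : ℕ := if h : a < C.size then (C.kind ⟨a, h⟩).code else 3

/-- Parameter of gate `a`. -/
def rparam (a : ℕ) : ℕ := if h : a < C.size then ((C.kind ⟨a, h⟩).param?).getD 0 else 0

/-- There is a wire from gate `b` to gate `a`. -/
def rwire (a b : ℕ) : Prop := ∃ g h : Fin C.size, g.val = a ∧ h.val = b ∧ h ∈ C.preds g

/-- Output bit `j` is provided by gate `b`. -/
def rout (j b : ℕ) : Prop := ∃ i : Fin C.numOut, i.val = j ∧ (C.out i).val = b

/-- Value of gate `a`; beyond the size this is the value of an `or`-gate of fan-in `0`. -/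
noncomputable def rval (a : ℕ) : Bool := if h : a < C.size then C.val x ⟨a, h⟩ else false

/-- Depth of gate `a`. -/
noncomputable def rdepth (a : ℕ) : ℕ := if h : a < C.size then C.gateDepth ⟨a, h⟩ else 0

variable {C}

theorem rwire_lt {a b : ℕ} (h : C.rwire a b) : a < C.size ∧ b < C.size := by
  obtain ⟨g, h, rfl, rfl, -⟩ := h
  exact ⟨g.2, h.2⟩

theorem rout_lt {j b : ℕ} (h : C.rout j b) : j < C.numOut ∧ b < C.size := by
  obtain ⟨i, rfl, rfl⟩ := h
  exact ⟨i.2, (C.out i).2⟩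

variable (C)

theorem rcode_le (a : ℕ) : C.rcode a ≤ 4 := by
  unfold rcode
  split_ifs
  · cases C.kind _ <;> simp [GateKind.code]
  · omega

/-- The value of a gate in terms of the tables; it also holds for numbers beyond the size. -/
theorem rval_iff (a : ℕ) : C.rval x a = true ↔
    gateEval (ext x) (C.rcode a) (C.rparam a) (C.rwire a) (C.rval x) := by
  by_cases ha : a < C.size
  · have h1 := GateKind.apply_iff (x := x) (C.kind ⟨a, ha⟩) (C.preds ⟨a, ha⟩) (C.val x)
    rw [← C.val_eq x] at h1
    simp only [rval, rcode, rparam, dif_pos ha]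
    rw [h1]
    refine (gateEval_map (φ := Fin.val) Fin.val_injective (fun h => ?_) fun h' _ => ?_).symm
    · constructor
      · rintro ⟨g, h', rfl, rfl, hm⟩
        exact ⟨h', hm, rfl⟩
      · rintro ⟨h', hm, rfl⟩
        exact ⟨⟨a, ha⟩, h', rfl, rfl, hm⟩
    · exact dif_pos h'.2
  · simp only [rval, rcode, dif_neg ha, gateEval]
    constructor
    · intro h; cases h
    · rintro ⟨h, hw, -⟩
      exact absurd (rwire_lt hw).1 ha

variable {C}

theorem rdepth_lt {a b : ℕ} (h : C.rwire a b) : C.rdepth b < C.rdepth a := by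
  obtain ⟨g, h, rfl, rfl, hm⟩ := h
  simp only [rdepth, Fin.is_lt, dif_pos, Fin.eta]
  rw [C.gateDepth_eq g]
  exact Nat.lt_of_succ_le (Finset.le_sup (f := fun h => C.gateDepth h + 1) hm)

theorem rdepth_le (a : ℕ) : C.rdepth a ≤ C.depth := by
  unfold rdepth
  split_ifs with h
  · exact Finset.le_sup (f := C.gateDepth) (Finset.mem_univ _)
  · omega

theorem rparam_lt {a : ℕ} (h : C.rcode a = 0) : C.rparam a < n := by
  unfold rcode at h
  unfold rparam
  split_ifs at h with ha
  rw [dif_pos ha]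
  cases hk : C.kind ⟨a, ha⟩ <;> simp_all [GateKind.code, GateKind.param?]

theorem rparam_le (a : ℕ) (h : C.rcode a = 4) : C.rparam a ≤ C.size := by
  unfold rcode at h
  unfold rparam
  by_cases ha : a < C.size
  swap
  · rw [dif_neg ha] at h; omega
  rw [dif_pos ha] at h ⊢
  cases hk : C.kind ⟨a, ha⟩ with
  | threshold t => simpa [GateKind.param?] using Nat.lt_succ_iff.1 t.2
  | _ => simp_all [GateKind.code]

theorem not_rwire_of_input {a : ℕ} (h : C.rcode a = 0) (b : ℕ) : ¬ C.rwire a b := by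
  rintro ⟨g, h', rfl, rfl, hm⟩
  simp only [rcode, g.2, dif_pos, Fin.eta] at h
  cases hk : C.kind g with
  | input p => rw [C.input_preds g p hk] at hm; simp at hm
  | _ => simp_all [GateKind.code]

theorem exists_rwire_of_not {a : ℕ} (h : C.rcode a = 1) : ∃ b, ∀ b', C.rwire a b' ↔ b' = b := by
  unfold rcode at h
  by_cases ha : a < C.size
  swap
  · rw [dif_neg ha] at h; omega
  rw [dif_pos ha] at h
  cases hk : C.kind ⟨a, ha⟩ with
  | not =>
    obtain ⟨b, hb⟩ := Finset.card_eq_one.1 (C.not_preds _ hk)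
    refine ⟨b, fun b' => ⟨?_, ?_⟩⟩
    · rintro ⟨g, h', rfl, rfl, hm⟩
      change h' ∈ C.preds ⟨g.1, ha⟩ at hm
      rw [hb, Finset.mem_singleton] at hm
      rw [hm]
    · rintro rfl
      exact ⟨⟨a, ha⟩, b, rfl, rfl, by simp [hb]⟩
  | _ => simp_all [GateKind.code]

/-- The encoding of a circuit in terms of its tables. -/
theorem bit_iff (C : Circuit n) (i : ℕ) : C.bit i = true ↔
    (i % 4 = 0 ∧ (deinterleave (i / 4)).1 < C.size ∧
      C.rcode (deinterleave (i / 4)).1 = (deinterleave (i / 4)).2) ∨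
    (i % 4 = 1 ∧ C.rwire (deinterleave (i / 4)).1 (deinterleave (i / 4)).2) ∨
    (i % 4 = 2 ∧ (C.rcode (deinterleave (i / 4)).1 = 0 ∨ C.rcode (deinterleave (i / 4)).1 = 4) ∧
      C.rparam (deinterleave (i / 4)).1 = (deinterleave (i / 4)).2) ∨
    (i % 4 = 3 ∧ C.rout (deinterleave (i / 4)).1 (deinterleave (i / 4)).2) := by
  unfold bit
  generalize (deinterleave (i / 4)).1 = a
  generalize (deinterleave (i / 4)).2 = b
  have h4 : i % 4 < 4 := Nat.mod_lt _ (by norm_num)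
  generalize i % 4 = r at h4
  interval_cases r
  · simp only [if_true, decide_eq_true_eq]
    constructor
    · rintro ⟨g, rfl, hg⟩
      exact Or.inl ⟨trivial, g.2, by simpa [rcode] using hg⟩
    · rintro (⟨-, ha, hg⟩ | ⟨h, -⟩ | ⟨h, -⟩ | ⟨h, -⟩)
      · exact ⟨⟨a, ha⟩, rfl, by simpa [rcode, ha] using hg⟩
      all_goals omega
  · simp [rwire]
  · simp only [OfNat.ofNat_ne_zero, if_false, OfNat.ofNat_ne_one, if_true, decide_eq_true_eq]
    constructor
    · rintro ⟨g, rfl, hg⟩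
      refine Or.inr (Or.inr (Or.inl ⟨trivial, ?_, by simp [rparam, hg]⟩))
      cases hk : C.kind g <;> simp_all [GateKind.param?, rcode, GateKind.code]
    · rintro (⟨h, -⟩ | ⟨h, -⟩ | ⟨-, hc, hp⟩ | ⟨h, -⟩)
      · cases h
      · cases h
      · have ha : a < C.size := by
          by_contra ha
          simp [rcode, ha] at hc
        simp only [rcode, rparam, ha, dif_pos] at hc hp
        refine ⟨⟨a, ha⟩, rfl, ?_⟩
        cases hk : C.kind ⟨a, ha⟩ <;> simp_all [GateKind.param?, GateKind.code]
      · cases h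
  · simp [rout]

/-- Output bit `j`, where the output is continued by zeros. -/
noncomputable def outBit (C : Circuit n) (x : Fin n → Bool) (j : ℕ) : Bool :=
  (C.output x).getD j false

theorem outBit_eq (C : Circuit n) {j b : ℕ} (h : C.rout j b) : C.outBit x j = C.rval x b := by
  obtain ⟨i, rfl, rfl⟩ := h
  simp [outBit, output, rval]

theorem outBit_of_le (C : Circuit n) {j : ℕ} (h : C.numOut ≤ j) : C.outBit x j = false := by
  simp [outBit, output, h]

theorem exists_rout (C : Circuit n) {j : ℕ} (h : j < C.numOut) : ∃ b, C.rout j b :=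
  ⟨_, ⟨j, h⟩, rfl, rfl⟩

end Circuit

/-- A circuit whose gates are numbers, given by tables. The depth of gate `g` is at most `dp g`. -/
structure Net (n : ℕ) where
  /-- number of gates -/
  size : ℕ
  /-- code of the type of a gate -/
  code : ℕ → ℕ
  /-- parameter of a gate -/
  param : ℕ → ℕ
  /-- `wire g h`: there is a wire from gate `h` to gate `g` -/
  wire : ℕ → ℕ → Prop
  /-- number of output bits -/
  numOut : ℕ
  /-- gate that provides an output bit -/
  out : ℕ → ℕ
  /-- bound on the depth of a gate -/
  dp : ℕ → ℕ
  code_le : ∀ g, code g ≤ 4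
  param_lt : ∀ g < size, code g = 0 → param g < n
  param_le : ∀ g < size, code g = 4 → param g ≤ size
  wire_lt : ∀ g < size, ∀ h, wire g h → h < size ∧ dp h < dp g
  input_wire : ∀ g < size, code g = 0 → ∀ h, ¬ wire g h
  not_wire : ∀ g < size, code g = 1 → ∃ h, ∀ h', wire g h' ↔ h' = h
  out_lt : ∀ j < numOut, out j < size

namespace Net

variable {n : ℕ} (N : Net n)

open Classical in
/-- The circuit given by the tables. -/
noncomputable def toCircuit : Circuit n where
  size := N.size
  kind g := if h0 : N.code g = 0 then .input ⟨N.param g, N.param_lt g g.2 h0⟩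
    else if N.code g = 1 then .not
    else if N.code g = 2 then .and
    else if N.code g = 3 then .or
    else if h4 : N.code g = 4 then
      .threshold ⟨N.param g, Nat.lt_succ_of_le (N.param_le g g.2 h4)⟩
    else .or
  preds g := Finset.univ.filter fun h => N.wire g h
  acyclic := by
    refine Subrelation.wf (r := InvImage (· < ·) fun g : Fin N.size => N.dp g) ?_
      (InvImage.wf _ Nat.lt_wfRel.wf)
    intro h g hg
    exact (N.wire_lt g g.2 h (Finset.mem_filter.1 hg).2).2
  input_preds g p hg := by
    have h0 : N.code g = 0 := by
      by_contra h0
      rw [dif_neg h0] at hg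
      split_ifs at hg
    ext h
    simp [N.input_wire g g.2 h0 h]
  not_preds g hg := by
    have h1 : N.code g = 1 := by
      by_contra h1
      rw [if_neg h1] at hg
      split_ifs at hg
    obtain ⟨h, hh⟩ := N.not_wire g g.2 h1
    rw [Finset.card_eq_one]
    refine ⟨⟨h, (N.wire_lt g g.2 h ((hh h).2 rfl)).1⟩, ?_⟩
    ext h'
    simp [hh, Fin.ext_iff]
  numOut := N.numOut
  out j := ⟨N.out j, N.out_lt j j.2⟩

theorem code_kind {g : ℕ} (hg : g < N.size) : (N.toCircuit.kind ⟨g, hg⟩).code = N.code g := by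
  have := N.code_le g
  simp only [toCircuit]
  split_ifs <;> simp only [GateKind.code] <;> omega

theorem rcode_toCircuit {g : ℕ} (hg : g < N.size) : N.toCircuit.rcode g = N.code g := by
  unfold Circuit.rcode
  rw [dif_pos (show g < N.toCircuit.size from hg)]
  exact N.code_kind hg

theorem rparam_toCircuit {g : ℕ} (hg : g < N.size) (h : N.code g = 0 ∨ N.code g = 4) :
    N.toCircuit.rparam g = N.param g := by
  unfold Circuit.rparam
  rw [dif_pos (show g < N.toCircuit.size from hg)]
  rcases h with h | h <;> simp [toCircuit, h, GateKind.param?]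

theorem rwire_toCircuit {g h : ℕ} : N.toCircuit.rwire g h ↔ g < N.size ∧ N.wire g h := by
  constructor
  · rintro ⟨a, b, rfl, rfl, hm⟩
    exact ⟨a.2, by classical exact (Finset.mem_filter.1 hm).2⟩
  · rintro ⟨hg, hw⟩
    exact ⟨⟨g, hg⟩, ⟨h, (N.wire_lt g hg h hw).1⟩, rfl, rfl,
      by classical exact Finset.mem_filter.2 ⟨Finset.mem_univ _, hw⟩⟩

theorem rout_toCircuit {j b : ℕ} : N.toCircuit.rout j b ↔ j < N.numOut ∧ N.out j = b := by
  constructor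
  · rintro ⟨i, rfl, rfl⟩
    exact ⟨i.2, rfl⟩
  · rintro ⟨hj, rfl⟩
    exact ⟨⟨j, hj⟩, rfl, rfl⟩

/-- The encoding of the circuit of a net in terms of the tables of the net. -/
theorem bit_toCircuit (i : ℕ) : N.toCircuit.bit i = true ↔
    (i % 4 = 0 ∧ (deinterleave (i / 4)).1 < N.size ∧
      N.code (deinterleave (i / 4)).1 = (deinterleave (i / 4)).2) ∨
    (i % 4 = 1 ∧ (deinterleave (i / 4)).1 < N.size ∧
      N.wire (deinterleave (i / 4)).1 (deinterleave (i / 4)).2) ∨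
    (i % 4 = 2 ∧ (deinterleave (i / 4)).1 < N.size ∧
      (N.code (deinterleave (i / 4)).1 = 0 ∨ N.code (deinterleave (i / 4)).1 = 4) ∧
      N.param (deinterleave (i / 4)).1 = (deinterleave (i / 4)).2) ∨
    (i % 4 = 3 ∧ (deinterleave (i / 4)).1 < N.numOut ∧
      N.out (deinterleave (i / 4)).1 = (deinterleave (i / 4)).2) := by
  rw [Circuit.bit_iff]
  generalize (deinterleave (i / 4)).1 = a
  generalize (deinterleave (i / 4)).2 = b
  rw [N.rwire_toCircuit, N.rout_toCircuit]
  refine or_congr ?_ (or_congr Iff.rfl (or_congr ?_ Iff.rfl))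
  · refine and_congr_right fun _ => and_congr_right fun ha => ?_
    rw [N.rcode_toCircuit ha]
  · refine and_congr_right fun _ => ?_
    constructor
    · rintro ⟨h1, h2⟩
      have ha : a < N.size := by
        by_contra ha
        have : N.toCircuit.rcode a = 3 := dif_neg ha
        omega
      rw [N.rcode_toCircuit ha] at h1
      rw [N.rparam_toCircuit ha h1] at h2
      exact ⟨ha, h1, h2⟩
    · rintro ⟨ha, h1, h2⟩
      rw [N.rcode_toCircuit ha, N.rparam_toCircuit ha h1]
      exact ⟨h1, h2⟩

/-- A valuation that satisfies the equation of every gate is the one of the circuit. -/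
theorem rval_toCircuit (x : Fin n → Bool) (V : ℕ → Bool)
    (hV : ∀ g < N.size, V g = true ↔ gateEval (ext x) (N.code g) (N.param g) (N.wire g) V) :
    ∀ g < N.size, N.toCircuit.rval x g = V g := by
  have key : ∀ d, ∀ g < N.size, N.dp g = d → N.toCircuit.rval x g = V g := by
    intro d
    induction d using Nat.strong_induction_on with
    | _ d ih =>
      intro g hg hd
      rw [Bool.eq_iff_iff, N.toCircuit.rval_iff, hV g hg, N.rcode_toCircuit hg]
      have hp : gateEval (ext x) (N.code g) (N.toCircuit.rparam g) (N.toCircuit.rwire g)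
          (N.toCircuit.rval x) ↔ gateEval (ext x) (N.code g) (N.param g) (N.toCircuit.rwire g)
          (N.toCircuit.rval x) := by
        by_cases h : N.code g = 0 ∨ N.code g = 4
        · rw [N.rparam_toCircuit hg h]
        · have := N.code_le g
          have h123 : N.code g = 1 ∨ N.code g = 2 ∨ N.code g = 3 := by omega
          rcases h123 with h | h | h <;> rw [h] <;> rfl
      rw [hp]
      refine gateEval_map (φ := id) Function.injective_id (fun h => ?_) fun h hw => ?_
      · rw [N.rwire_toCircuit]
        simp [hg]
      · obtain ⟨h1, h2⟩ := N.wire_lt g hg h hw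
        exact ih _ (hd ▸ h2) h h1 rfl
  exact fun g hg => key _ g hg rfl

/-- The output, given by a valuation that satisfies the equations of all gates. -/
theorem output_toCircuit (x : Fin n → Bool) (V : ℕ → Bool)
    (hV : ∀ g < N.size, V g = true ↔ gateEval (ext x) (N.code g) (N.param g) (N.wire g) V) :
    N.toCircuit.output x = (List.range N.numOut).map fun j => V (N.out j) := by
  refine List.ext_getElem ?_ fun j h₁ h₂ => ?_
  · simp [Circuit.output, toCircuit]
  · have hj : j < N.numOut := by simpa using h₂
    have h := N.rval_toCircuit x V hV (N.out j) (N.out_lt j hj)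
    unfold Circuit.rval at h
    rw [dif_pos (show N.out j < N.toCircuit.size from N.out_lt j hj)] at h
    simp only [Circuit.output, List.getElem_ofFn, List.getElem_map, List.getElem_range]
    exact h

theorem depth_toCircuit_le (D : ℕ) (hD : ∀ g < N.size, N.dp g ≤ D) : N.toCircuit.depth ≤ D := by
  classical
  have key : ∀ d, ∀ g : Fin N.toCircuit.size, N.dp g = d → N.toCircuit.gateDepth g ≤ d := by
    intro d
    induction d using Nat.strong_induction_on with
    | _ d ih =>
      intro g hd
      rw [Circuit.gateDepth_eq]
      refine Finset.sup_le fun h hh => ?_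
      have h1 := (N.wire_lt g g.2 h (Finset.mem_filter.1 hh).2).2
      have h2 := ih _ (hd ▸ h1) h rfl
      omega
  exact Finset.sup_le fun g _ => (key _ g rfl).trans (hD g g.2)

theorem kind_toCircuit_ne (h : ∀ g < N.size, N.code g ≠ 4) (g : Fin N.toCircuit.size)
    (t : Fin (N.toCircuit.size + 1)) : N.toCircuit.kind g ≠ .threshold t := by
  intro hk
  have h1 := N.code_kind g.2
  rw [Fin.eta, hk] at h1
  exact h g g.2 h1.symm

end Net

end ParaCircuit

namespace ParaCircuit

/-! ### A circuit that inspects the number computed by another circuit -/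

/-- Gate number `t` of the group of gates with index `(x, y)`. -/
def node (x y t : ℕ) : ℕ := 16 * interleave x y + t

/-- First index of a gate. -/
def gx (g : ℕ) : ℕ := (deinterleave (g / 16)).1

/-- Second index of a gate. -/
def gy (g : ℕ) : ℕ := (deinterleave (g / 16)).2

theorem node_mod {x y t : ℕ} (ht : t < 16) : node x y t % 16 = t := by
  unfold node; omega

theorem gx_node {x y t : ℕ} (ht : t < 16) : gx (node x y t) = x := by
  unfold gx node
  rw [show (16 * interleave x y + t) / 16 = interleave x y by omega, deinterleave_interleave]

theorem gy_node {x y t : ℕ} (ht : t < 16) : gy (node x y t) = y := by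
  unfold gy node
  rw [show (16 * interleave x y + t) / 16 = interleave x y by omega, deinterleave_interleave]

theorem node_eq (g : ℕ) : node (gx g) (gy g) (g % 16) = g := by
  unfold node gx gy
  rw [interleave_deinterleave]
  omega

theorem node_lt {x y t L : ℕ} (ht : t < 16) :
    node x y t < 16 * 4 ^ L ↔ x < 2 ^ L ∧ y < 2 ^ L := by
  rw [← interleave_lt_iff]
  unfold node
  omega

theorem gx_lt {g L : ℕ} (h : g < 16 * 4 ^ L) : gx g < 2 ^ L ∧ gy g < 2 ^ L := by
  rw [← node_eq g] at h
  exact (node_lt (Nat.mod_lt _ (by norm_num))).1 h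

/-- The data of a circuit that contains a copy of the circuit `Fr`, and copies of circuits `Sub w`
for the numbers `w` that satisfy `good`. The output bits of `Fr` are read as a number; if this
number is a `w` satisfying `good`, then `Sub w` is evaluated. -/
structure Inspector (n : ℕ) where
  /-- the circuit whose output is inspected -/
  Fr : Circuit n
  /-- logarithm of the range of the indices -/
  L : ℕ
  /-- the numbers that are recognized -/
  good : ℕ → Prop
  /-- the circuit that is evaluated when a number is recognized -/
  Sub : ℕ → Circuit n
  /-- the string presented if the evaluation gives true -/
  yes : List Bool
  /-- the string presented if the evaluation gives false -/
  no : List Bool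
  /-- whether the output consists of a single bit that says if the number is recognized -/
  single : Bool
  /-- bound on the depths of the given circuits -/
  D : ℕ
  size_Fr : Fr.size ≤ 2 ^ L
  numOut_Fr : Fr.numOut ≤ 2 ^ L
  depth_Fr : Fr.depth ≤ D
  size_Sub : ∀ w, good w → (Sub w).size ≤ 2 ^ L
  depth_Sub : ∀ w, good w → (Sub w).depth ≤ D
  le_n : n ≤ 2 ^ L
  le_yes : yes.length ≤ 2 ^ L
  le_no : no.length ≤ 2 ^ L

namespace Inspector

variable {n : ℕ} (M : Inspector n)

/-- `M.W X Y T x y t`: there is a wire from gate `t` of group `(x, y)` to gate `T` of group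
`(X, Y)`. The gates of a group `(x, y)` are: `0` gate `y` of `Fr`; `1` output bit `y` of `Fr`;
`2` its negation; `3` the number is `x`; `4` gate `y` of `Sub x`; `5` the number is `x` and `Sub x`
accepts; `6` the number is recognized and accepted; `7` the number is recognized; `8`, `9` the
negations of the latter two; `10` the number is recognized and rejected; `11` input bit `y`;
`12` input bit `y` if the number is not recognized; `13` the presented string is longer than `y`;
`14` bit `y` of the presented string. -/
def W (X Y : ℕ) : ℕ → ℕ → ℕ → ℕ → Prop
  | 0, x, y, t => t = 0 ∧ x = X ∧ M.Fr.rwire Y y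
  | 1, x, y, t => t = 0 ∧ x = X ∧ M.Fr.rout Y y
  | 2, x, y, t => t = 1 ∧ x = X ∧ y = Y
  | 3, x, y, t => x = X ∧ ((t = 1 ∧ X.testBit y = true) ∨ (t = 2 ∧ ¬ X.testBit y = true))
  | 4, x, y, t => t = 4 ∧ x = X ∧ (M.good X ∧ (M.Sub X).rwire Y y)
  | 5, x, y, t => x = X ∧ ((t = 3 ∧ y = Y ∧ M.good X) ∨ (t = 4 ∧ (M.good X ∧ (M.Sub X).rout 0 y)))
  | 6, _, _, t => t = 5
  | 7, x, _, t => t = 3 ∧ M.good x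
  | 8, x, y, t => t = 6 ∧ x = X ∧ y = Y
  | 9, x, y, t => t = 7 ∧ x = X ∧ y = Y
  | 10, x, y, t => (t = 7 ∨ t = 8) ∧ x = X ∧ y = Y
  | 12, x, y, t => (t = 9 ∨ t = 11) ∧ x = X ∧ y = Y
  | 13, x, y, t => x = X ∧ y = Y ∧
      ((t = 6 ∧ Y < M.yes.length) ∨ (t = 10 ∧ Y < M.no.length) ∨ (t = 9 ∧ Y < n))
  | 14, x, y, t => x = X ∧ y = Y ∧
      ((t = 6 ∧ M.yes.getD Y false = true) ∨ (t = 10 ∧ M.no.getD Y false = true) ∨ t = 12)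
  | _, _, _, _ => False

open Classical in
/-- Code of the type of a gate. -/
noncomputable def code (X Y : ℕ) : ℕ → ℕ
  | 0 => M.Fr.rcode Y
  | 2 => 1
  | 3 => 2
  | 4 => if M.good X then (M.Sub X).rcode Y else 3
  | 5 => if M.good X then 2 else 3
  | 8 => 1
  | 9 => 1
  | 10 => 2
  | 11 => if Y < n then 0 else 3
  | 12 => 2
  | _ => 3

/-- Parameter of a gate. -/
def param (X Y : ℕ) : ℕ → ℕ
  | 0 => M.Fr.rparam Y
  | 4 => (M.Sub X).rparam Y
  | 11 => Y
  | _ => 0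

/-- Depth of a gate, where `d` and `d'` give the depths of the copied gates, of which `D'` is an
upper bound. -/
def level (D' : ℕ) (d d' : ℕ → ℕ → ℕ) (X Y : ℕ) : ℕ → ℕ
  | 0 => d X Y
  | 1 => D' + 1
  | 2 => D' + 2
  | 3 => D' + 3
  | 4 => d' X Y
  | 5 => D' + 4
  | 6 => D' + 5
  | 7 => D' + 4
  | 8 => D' + 6
  | 9 => D' + 5
  | 10 => D' + 7
  | 12 => D' + 6
  | 13 => D' + 8
  | 14 => D' + 8
  | _ => 0

/-- Wires between gates given by their numbers. -/
def wire (g h : ℕ) : Prop :=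
  h < 16 * 4 ^ M.L ∧ M.W (gx g) (gy g) (g % 16) (gx h) (gy h) (h % 16)

theorem wire_iff {g x y t : ℕ} (ht : t < 16) : M.wire g (node x y t) ↔
    (x < 2 ^ M.L ∧ y < 2 ^ M.L) ∧ M.W (gx g) (gy g) (g % 16) x y t := by
  unfold wire
  rw [node_lt ht, gx_node ht, gy_node ht, node_mod ht]

theorem exists_node (g : ℕ) : ∃ x y t, t < 16 ∧ node x y t = g :=
  ⟨_, _, _, Nat.mod_lt _ (by norm_num), node_eq g⟩

theorem rwire_lt_pow {C : Circuit n} {a b L : ℕ} (h : C.rwire a b) (hC : C.size ≤ 2 ^ L) :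
    a < 2 ^ L ∧ b < 2 ^ L :=
  ⟨(Circuit.rwire_lt h).1.trans_le hC, (Circuit.rwire_lt h).2.trans_le hC⟩

/-- Wires go up in level, apart from those into copied gates (types `0` and `4`). -/
theorem level_lt {D' : ℕ} {d d' : ℕ → ℕ → ℕ} (hd : ∀ X Y, d X Y ≤ D')
    (hd' : ∀ X, M.good X → ∀ Y, d' X Y ≤ D') {X Y T x y t : ℕ} (hT : T < 16)
    (h : M.W X Y T x y t) (h0 : T ≠ 0) (h4 : T ≠ 4) :
    level D' d d' x y t < level D' d d' X Y T := by
  have := hd x y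
  interval_cases T <;> simp only [W] at h
  · exact absurd rfl h0
  · obtain ⟨rfl, rfl, -⟩ := h; simp only [level]; omega
  · obtain ⟨rfl, rfl, -⟩ := h; simp only [level]; omega
  · obtain ⟨rfl, ⟨rfl, -⟩ | ⟨rfl, -⟩⟩ := h <;> simp only [level] <;> omega
  · exact absurd rfl h4
  · obtain ⟨rfl, ⟨rfl, -⟩ | ⟨rfl, hg, -⟩⟩ := h
    · simp only [level]; omega
    · have := hd' x hg y
      simp only [level]; omega
  · subst h; simp only [level]; omega
  · obtain ⟨rfl, -⟩ := h; simp only [level]; omega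
  · obtain ⟨rfl, rfl, -⟩ := h; simp only [level]; omega
  · obtain ⟨rfl, rfl, -⟩ := h; simp only [level]; omega
  · obtain ⟨rfl | rfl, -⟩ := h <;> simp only [level] <;> omega
  · obtain ⟨rfl | rfl, -⟩ := h <;> simp only [level] <;> omega
  · obtain ⟨-, -, ⟨rfl, -⟩ | ⟨rfl, -⟩ | ⟨rfl, -⟩⟩ := h <;> simp only [level] <;> omega
  · obtain ⟨-, -, ⟨rfl, -⟩ | ⟨rfl, -⟩ | rfl⟩ := h <;> simp only [level] <;> omega

theorem level_le {D' : ℕ} {d d' : ℕ → ℕ → ℕ} {X Y : ℕ} (hd : d X Y ≤ D') (hd' : d' X Y ≤ D')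
    (T : ℕ) : level D' d d' X Y T ≤ D' + 8 := by
  unfold level
  split <;> omega

open Classical in
/-- The depth function of the copies of the circuits `Sub`. -/
noncomputable def subDepth (X Y : ℕ) : ℕ := if M.good X then (M.Sub X).rdepth Y else 0

theorem subDepth_le (X Y : ℕ) : M.subDepth X Y ≤ M.D := by
  unfold subDepth
  split_ifs with h
  · exact (Circuit.rdepth_le _).trans (M.depth_Sub X h)
  · omega

/-- The circuit, given by tables. -/
noncomputable def net : Net n where
  size := 16 * 4 ^ M.L
  code g := M.code (gx g) (gy g) (g % 16)
  param g := M.param (gx g) (gy g) (g % 16)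
  wire := M.wire
  numOut := if M.single then 1 else 2 * 2 ^ M.L
  out j := if M.single then node 0 0 7 else node 0 (j / 2) (13 + j % 2)
  dp g := level M.D (fun _ => M.Fr.rdepth) M.subDepth (gx g) (gy g) (g % 16)
  code_le g := by
    unfold code
    split
    · exact Circuit.rcode_le _ _
    all_goals try split_ifs
    all_goals first | exact Circuit.rcode_le _ _ | omega
  param_lt g _ h0 := by
    have hT : g % 16 < 16 := Nat.mod_lt _ (by norm_num)
    generalize g % 16 = T at *
    interval_cases T <;> simp only [code] at h0 <;> simp only [param]
    · exact Circuit.rparam_lt h0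
    all_goals try split_ifs at h0
    all_goals try omega
    · exact Circuit.rparam_lt h0
  param_le g _ h0 := by
    have hL : 2 ^ M.L ≤ 16 * 4 ^ M.L := by
      have : 2 ^ M.L ≤ 4 ^ M.L := Nat.pow_le_pow_left (by norm_num) _
      omega
    have hT : g % 16 < 16 := Nat.mod_lt _ (by norm_num)
    generalize g % 16 = T at *
    interval_cases T <;> simp only [code] at h0 <;> simp only [param]
    · exact ((Circuit.rparam_le _ h0).trans M.size_Fr).trans hL
    all_goals try split_ifs at h0
    all_goals try omega
    rename_i hg
    exact ((Circuit.rparam_le _ h0).trans (M.size_Sub _ hg)).trans hL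
  wire_lt g _ h hw := by
    refine ⟨hw.1, ?_⟩
    have hT : g % 16 < 16 := Nat.mod_lt _ (by norm_num)
    by_cases h0 : g % 16 = 0
    · have h1 := hw.2
      rw [h0] at h1 ⊢
      obtain ⟨e1, e2, e3⟩ := h1
      rw [e1]
      exact Circuit.rdepth_lt e3
    · by_cases h4 : g % 16 = 4
      · have h1 := hw.2
        rw [h4] at h1 ⊢
        obtain ⟨e1, e2, e3, e4⟩ := h1
        rw [e1, e2]
        simp only [level, subDepth, e3, if_true]
        exact Circuit.rdepth_lt e4
      · exact M.level_lt (fun _ Y => (Circuit.rdepth_le Y).trans M.depth_Fr)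
          (fun X _ => M.subDepth_le X) hT hw.2 h0 h4
  input_wire g _ h0 h hw := by
    have h1 := hw.2
    have hT : g % 16 < 16 := Nat.mod_lt _ (by norm_num)
    generalize g % 16 = T at *
    interval_cases T <;> simp only [code] at h0 <;> simp only [W] at h1
    · exact Circuit.not_rwire_of_input h0 _ h1.2.2
    all_goals try split_ifs at h0
    all_goals try omega
    exact Circuit.not_rwire_of_input h0 _ h1.2.2.2
  not_wire g hg h1 := by
    obtain ⟨hx, hy⟩ := gx_lt hg
    have single : ∀ t < 16, (∀ x y t', M.W (gx g) (gy g) (g % 16) x y t' ↔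
        t' = t ∧ x = gx g ∧ y = gy g) → ∃ h, ∀ h', M.wire g h' ↔ h' = h := by
      intro t ht H
      refine ⟨node (gx g) (gy g) t, fun h' => ?_⟩
      obtain ⟨x, y, t', ht', rfl⟩ := exists_node h'
      rw [M.wire_iff ht', H]
      constructor
      · rintro ⟨-, rfl, rfl, rfl⟩; rfl
      · intro e
        have e1 := congrArg gx e
        have e2 := congrArg gy e
        have e3 := congrArg (· % 16) e
        simp only [node_mod ht, node_mod ht'] at e3
        rw [gx_node ht', gx_node ht] at e1
        rw [gy_node ht', gy_node ht] at e2
        subst e1 e2 e3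
        exact ⟨⟨hx, hy⟩, rfl, rfl, rfl⟩
    have copy : ∀ t < 16, ∀ b < 2 ^ M.L, (∀ x y t', M.W (gx g) (gy g) (g % 16) x y t' ↔
        t' = t ∧ x = gx g ∧ y = b) → ∃ h, ∀ h', M.wire g h' ↔ h' = h := by
      intro t ht b hb H
      refine ⟨node (gx g) b t, fun h' => ?_⟩
      obtain ⟨x, y, t', ht', rfl⟩ := exists_node h'
      rw [M.wire_iff ht', H]
      constructor
      · rintro ⟨-, rfl, rfl, rfl⟩; rfl
      · intro e
        have e1 := congrArg gx e
        have e2 := congrArg gy e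
        have e3 := congrArg (· % 16) e
        simp only [node_mod ht, node_mod ht'] at e3
        rw [gx_node ht', gx_node ht] at e1
        rw [gy_node ht', gy_node ht] at e2
        subst e1 e2 e3
        exact ⟨⟨hx, hb⟩, rfl, rfl, rfl⟩
    have hT : g % 16 < 16 := Nat.mod_lt _ (by norm_num)
    generalize g % 16 = T at *
    interval_cases T <;> simp only [code] at h1 <;> simp only [W] at single copy
    · obtain ⟨b, hb⟩ := Circuit.exists_rwire_of_not h1
      refine copy 0 (by norm_num) b (rwire_lt_pow ((hb b).2 rfl) M.size_Fr).2 fun x y t' => ?_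
      rw [hb]
    all_goals try split_ifs at h1
    all_goals try omega
    · exact single 1 (by norm_num) fun _ _ _ => Iff.rfl
    · rename_i hgood
      obtain ⟨b, hb⟩ := Circuit.exists_rwire_of_not h1
      refine copy 4 (by norm_num) b (rwire_lt_pow ((hb b).2 rfl) (M.size_Sub _ hgood)).2
        fun x y t' => ?_
      rw [hb]
      simp [hgood]
    · exact single 6 (by norm_num) fun _ _ _ => Iff.rfl
    · exact single 7 (by norm_num) fun _ _ _ => Iff.rfl
  out_lt j hj := by
    have hp : 0 < 2 ^ M.L := by positivity
    split_ifs at hj ⊢ with hs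
    · exact (node_lt (by norm_num)).2 ⟨hp, hp⟩
    · exact (node_lt (by omega)).2 ⟨hp, by omega⟩

end Inspector

end ParaCircuit

namespace ParaCircuit

/-! ### Truth values of the gates -/

namespace Inspector

variable {n : ℕ} (M : Inspector n) (x : Fin n → Bool)

/-- The output bits of `Fr` are the binary digits of `w`. -/
def IsNum (w : ℕ) : Prop := ∀ j < 2 ^ M.L, M.Fr.outBit x j = w.testBit j

/-- The number computed by `Fr` is recognized. -/
def Hit : Prop := ∃ w < 2 ^ M.L, M.good w ∧ M.IsNum x w

/-- The number computed by `Fr` is `w`, it is recognized, and `Sub w` accepts. -/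
def Acc (w : ℕ) : Prop := M.good w ∧ M.IsNum x w ∧ ∀ b, (M.Sub w).rout 0 b → (M.Sub w).rval x b = true

/-- The number computed by `Fr` is recognized, and the circuit for it accepts. -/
def Accepted : Prop := ∃ w < 2 ^ M.L, M.Acc x w

/-- The presented string is longer than `j`. -/
def LongerThan (j : ℕ) : Prop := (M.Accepted x ∧ j < M.yes.length) ∨
  ((M.Hit x ∧ ¬ M.Accepted x) ∧ j < M.no.length) ∨ (¬ M.Hit x ∧ j < n)

/-- Bit `j` of the presented string is `1`. -/
def HasBit (j : ℕ) : Prop := (M.Accepted x ∧ M.yes.getD j false = true) ∨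
  ((M.Hit x ∧ ¬ M.Accepted x) ∧ M.no.getD j false = true) ∨ (¬ M.Hit x ∧ ext x j = true)

/-- The truth values of the gates. -/
def Val (X Y : ℕ) : ℕ → Prop
  | 0 => M.Fr.rval x Y = true
  | 1 => M.Fr.outBit x Y = true
  | 2 => ¬ M.Fr.outBit x Y = true
  | 3 => M.IsNum x X
  | 4 => M.good X ∧ (M.Sub X).rval x Y = true
  | 5 => M.Acc x X
  | 6 => M.Accepted x
  | 7 => M.Hit x
  | 8 => ¬ M.Accepted x
  | 9 => ¬ M.Hit x
  | 10 => M.Hit x ∧ ¬ M.Accepted x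
  | 11 => ext x Y = true
  | 12 => ¬ M.Hit x ∧ ext x Y = true
  | 13 => M.LongerThan x Y
  | 14 => M.HasBit x Y
  | _ => False

open Classical in
/-- The values of the gates. -/
noncomputable def value (g : ℕ) : Bool := decide (M.Val x (gx g) (gy g) (g % 16))

theorem value_node {X Y T : ℕ} (hT : T < 16) : M.value x (node X Y T) = true ↔ M.Val x X Y T := by
  classical
  unfold value
  rw [decide_eq_true_eq, gx_node hT, gy_node hT, node_mod hT]

theorem exists_wire_iff (g : ℕ) : (∃ h, M.wire g h ∧ M.value x h = true) ↔
    ∃ X Y T, T < 16 ∧ (X < 2 ^ M.L ∧ Y < 2 ^ M.L) ∧ M.W (gx g) (gy g) (g % 16) X Y T ∧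
      M.Val x X Y T := by
  constructor
  · rintro ⟨h, hw, hv⟩
    obtain ⟨X, Y, T, hT, rfl⟩ := exists_node h
    obtain ⟨h1, h2⟩ := (M.wire_iff hT).1 hw
    exact ⟨X, Y, T, hT, h1, h2, (M.value_node x hT).1 hv⟩
  · rintro ⟨X, Y, T, hT, h1, h2, h3⟩
    exact ⟨node X Y T, (M.wire_iff hT).2 ⟨h1, h2⟩, (M.value_node x hT).2 h3⟩

theorem forall_wire_iff (g : ℕ) : (∀ h, M.wire g h → M.value x h = true) ↔
    ∀ X Y T, T < 16 → X < 2 ^ M.L ∧ Y < 2 ^ M.L → M.W (gx g) (gy g) (g % 16) X Y T →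
      M.Val x X Y T := by
  constructor
  · intro H X Y T hT h1 h2
    exact (M.value_node x hT).1 (H _ ((M.wire_iff hT).2 ⟨h1, h2⟩))
  · intro H h hw
    obtain ⟨X, Y, T, hT, rfl⟩ := exists_node h
    obtain ⟨h1, h2⟩ := (M.wire_iff hT).1 hw
    exact (M.value_node x hT).2 (H X Y T hT h1 h2)

theorem forall_wire_not_iff (g : ℕ) : (∀ h, M.wire g h → M.value x h = false) ↔
    ∀ X Y T, T < 16 → X < 2 ^ M.L ∧ Y < 2 ^ M.L → M.W (gx g) (gy g) (g % 16) X Y T →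
      ¬ M.Val x X Y T := by
  constructor
  · intro H X Y T hT h1 h2 h3
    have := H _ ((M.wire_iff hT).2 ⟨h1, h2⟩)
    rw [(M.value_node x hT).2 h3] at this
    cases this
  · intro H h hw
    obtain ⟨X, Y, T, hT, rfl⟩ := exists_node h
    obtain ⟨h1, h2⟩ := (M.wire_iff hT).1 hw
    rw [← Bool.not_eq_true, M.value_node x hT]
    exact H X Y T hT h1 h2

theorem node_injective (X : ℕ) {T : ℕ} (hT : T < 16) : (fun y => node X y T).Injective := by
  intro a b h
  have := congrArg gy h
  simpa only [gy_node hT] using this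

theorem outBit_iff (j : ℕ) : M.Fr.outBit x j = true ↔ ∃ b, M.Fr.rout j b ∧ M.Fr.rval x b = true := by
  constructor
  · intro h
    have hj : j < M.Fr.numOut := by
      by_contra hj
      rw [Circuit.outBit_of_le x M.Fr (not_lt.1 hj)] at h
      cases h
    obtain ⟨b, hb⟩ := M.Fr.exists_rout hj
    exact ⟨b, hb, by rw [← Circuit.outBit_eq x M.Fr hb]; exact h⟩
  · rintro ⟨b, hb, h⟩
    rw [Circuit.outBit_eq x M.Fr hb]
    exact h

theorem acc_imp_hit (h : M.Accepted x) : M.Hit x := by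
  obtain ⟨w, hw, h1, h2, -⟩ := h
  exact ⟨w, hw, h1, h2⟩

/-- The values satisfy the equations of all gates. -/
theorem value_eq (g : ℕ) (hg : g < M.net.size) : M.value x g = true ↔
    gateEval (ext x) (M.net.code g) (M.net.param g) (M.net.wire g) (M.value x) := by
  obtain ⟨hX, hY⟩ := gx_lt hg
  have hp : 0 < 2 ^ M.L := by positivity
  have hT : g % 16 < 16 := Nat.mod_lt _ (by norm_num)
  change _ ↔ gateEval (ext x) (M.code (gx g) (gy g) (g % 16)) (M.param (gx g) (gy g) (g % 16))
    (M.wire g) (M.value x)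
  have hV : M.value x g = true ↔ M.Val x (gx g) (gy g) (g % 16) := by
    rw [← M.value_node x hT, node_eq]
  rw [hV]
  have hw : ∀ h, M.wire g h ↔ h < 16 * 4 ^ M.L ∧
    M.W (gx g) (gy g) (g % 16) (gx h) (gy h) (h % 16) := fun h => Iff.rfl
  have ex := M.exists_wire_iff x g
  have all := M.forall_wire_iff x g
  have none := M.forall_wire_not_iff x g
  generalize gx g = X at *
  generalize gy g = Y at *
  generalize g % 16 = T at *
  interval_cases T <;> simp only [code, param, Val] <;> simp only [W] at hw ex all none
  -- copies of the gates of `Fr`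
  · rw [M.Fr.rval_iff x Y]
    refine (gateEval_map (node_injective X (T := 0) (by norm_num)) (fun h => ?_)
      fun y hy => ?_).symm
    · rw [hw h]
      constructor
      · rintro ⟨h1, h2, h3, h4⟩
        refine ⟨gy h, h4, ?_⟩
        rw [← h3, ← h2, node_eq]
      · rintro ⟨y, hy, rfl⟩
        rw [gx_node (by norm_num), gy_node (by norm_num), node_mod (by norm_num),
          node_lt (by norm_num)]
        exact ⟨⟨hX, (rwire_lt_pow hy M.size_Fr).2⟩, rfl, rfl, hy⟩
    · rw [Bool.eq_iff_iff]
      exact M.value_node x (by norm_num)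
  -- the output bits of `Fr`, their negations, and the comparison with the number `X`
  · refine Iff.trans ?_ ex.symm
    rw [M.outBit_iff]
    constructor
    · rintro ⟨b, hb, hv⟩
      exact ⟨X, b, 0, by norm_num, ⟨hX, (Circuit.rout_lt hb).2.trans_le M.size_Fr⟩,
        ⟨rfl, rfl, hb⟩, hv⟩
    · rintro ⟨_, b, _, -, -, ⟨rfl, rfl, hb⟩, hv⟩
      exact ⟨b, hb, hv⟩
  · refine Iff.trans ?_ none.symm
    constructor
    · rintro h _ _ _ - - ⟨rfl, rfl, rfl⟩
      exact h
    · intro H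
      exact H X Y 1 (by norm_num) ⟨hX, hY⟩ ⟨rfl, rfl, rfl⟩
  · refine Iff.trans ?_ all.symm
    constructor
    · rintro h _ j _ - ⟨-, hj⟩ ⟨rfl, ⟨rfl, hb⟩ | ⟨rfl, hb⟩⟩
      · exact (h j hj).trans hb
      · change ¬ _
        rw [h j hj]
        exact hb
    · intro H j hj
      by_cases hb : X.testBit j = true
      · rw [hb]
        exact H X j 1 (by norm_num) ⟨hX, hj⟩ ⟨rfl, Or.inl ⟨rfl, hb⟩⟩
      · have h2 : ¬ M.Fr.outBit x j = true := H X j 2 (by norm_num) ⟨hX, hj⟩ ⟨rfl, Or.inr ⟨rfl, hb⟩⟩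
        rw [Bool.not_eq_true] at hb h2
        rw [hb, h2]
  -- copies of the gates of the circuits `Sub`
  · by_cases hgood : M.good X
    · rw [if_pos hgood]
      refine Iff.trans (and_iff_right hgood) ?_
      rw [(M.Sub X).rval_iff x Y]
      refine (gateEval_map (node_injective X (T := 4) (by norm_num)) (fun h => ?_)
        fun y hy => ?_).symm
      · rw [hw h]
        constructor
        · rintro ⟨h1, h2, h3, -, h4⟩
          refine ⟨gy h, h4, ?_⟩
          rw [← h3, ← h2, node_eq]
        · rintro ⟨y, hy, rfl⟩
          rw [gx_node (by norm_num), gy_node (by norm_num), node_mod (by norm_num),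
            node_lt (by norm_num)]
          exact ⟨⟨hX, (rwire_lt_pow hy (M.size_Sub X hgood)).2⟩, rfl, rfl, hgood, hy⟩
      · rw [Bool.eq_iff_iff]
        refine (M.value_node x (by norm_num)).trans ?_
        exact and_iff_right hgood
    · rw [if_neg hgood]
      refine Iff.trans ?_ ex.symm
      constructor
      · exact fun h => absurd h.1 hgood
      · rintro ⟨_, _, _, -, -, ⟨-, -, h, -⟩, -⟩
        exact absurd h hgood
  -- acceptance by `Sub X`, for one number and for all of them, and recognition
  · by_cases hgood : M.good X
    · rw [if_pos hgood]
      refine Iff.trans ?_ all.symm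
      constructor
      · rintro ⟨-, h2, h3⟩ _ b _ - - ⟨rfl, ⟨rfl, -⟩ | ⟨rfl, -, hb⟩⟩
        · exact h2
        · exact ⟨hgood, h3 b hb⟩
      · intro H
        refine ⟨hgood, H X Y 3 (by norm_num) ⟨hX, hY⟩ ⟨rfl, Or.inl ⟨rfl, rfl, hgood⟩⟩,
          fun b hb => ?_⟩
        exact (H X b 4 (by norm_num) ⟨hX, (Circuit.rout_lt hb).2.trans_le (M.size_Sub X hgood)⟩
          ⟨rfl, Or.inr ⟨rfl, hgood, hb⟩⟩).2
    · rw [if_neg hgood]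
      refine Iff.trans ?_ ex.symm
      constructor
      · exact fun h => absurd h.1 hgood
      · rintro ⟨_, _, _, -, -, ⟨-, ⟨-, -, h⟩ | ⟨-, h, -⟩⟩, -⟩ <;> exact absurd h hgood
  · refine Iff.trans ?_ ex.symm
    constructor
    · rintro ⟨w, hw, h⟩
      exact ⟨w, 0, 5, by norm_num, ⟨hw, hp⟩, rfl, h⟩
    · rintro ⟨w, _, _, -, ⟨hw, -⟩, rfl, h⟩
      exact ⟨w, hw, h⟩
  · refine Iff.trans ?_ ex.symm
    constructor
    · rintro ⟨w, hw, hg, h⟩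
      exact ⟨w, 0, 3, by norm_num, ⟨hw, hp⟩, ⟨rfl, hg⟩, h⟩
    · rintro ⟨w, _, _, -, ⟨hw, -⟩, ⟨rfl, hg⟩, h⟩
      exact ⟨w, hw, hg, h⟩
  -- negations and conjunctions that tell the three cases apart
  · refine Iff.trans ?_ none.symm
    constructor
    · rintro h _ _ _ - - ⟨rfl, rfl, rfl⟩
      exact h
    · intro H
      exact H X Y 6 (by norm_num) ⟨hX, hY⟩ ⟨rfl, rfl, rfl⟩
  · refine Iff.trans ?_ none.symm
    constructor
    · rintro h _ _ _ - - ⟨rfl, rfl, rfl⟩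
      exact h
    · intro H
      exact H X Y 7 (by norm_num) ⟨hX, hY⟩ ⟨rfl, rfl, rfl⟩
  · refine Iff.trans ?_ all.symm
    constructor
    · rintro h _ _ _ - - ⟨rfl | rfl, rfl, rfl⟩
      · exact h.1
      · exact h.2
    · intro H
      exact ⟨H X Y 7 (by norm_num) ⟨hX, hY⟩ ⟨Or.inl rfl, rfl, rfl⟩,
        H X Y 8 (by norm_num) ⟨hX, hY⟩ ⟨Or.inr rfl, rfl, rfl⟩⟩
  -- the input bits
  · by_cases hn : Y < n
    · rw [if_pos hn]
      exact Iff.rfl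
    · rw [if_neg hn]
      refine Iff.trans ?_ ex.symm
      simp [ext, hn]
  · refine Iff.trans ?_ all.symm
    constructor
    · rintro h _ _ _ - - ⟨rfl | rfl, rfl, rfl⟩
      · exact h.1
      · exact h.2
    · intro H
      exact ⟨H X Y 9 (by norm_num) ⟨hX, hY⟩ ⟨Or.inl rfl, rfl, rfl⟩,
        H X Y 11 (by norm_num) ⟨hX, hY⟩ ⟨Or.inr rfl, rfl, rfl⟩⟩
  -- the presented string: its length and its bits
  · refine Iff.trans ?_ ex.symm
    constructor
    · rintro (⟨h, hl⟩ | ⟨h, hl⟩ | ⟨h, hl⟩)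
      · exact ⟨X, Y, 6, by norm_num, ⟨hX, hY⟩, ⟨rfl, rfl, Or.inl ⟨rfl, hl⟩⟩, h⟩
      · exact ⟨X, Y, 10, by norm_num, ⟨hX, hY⟩, ⟨rfl, rfl, Or.inr (Or.inl ⟨rfl, hl⟩)⟩, h⟩
      · exact ⟨X, Y, 9, by norm_num, ⟨hX, hY⟩, ⟨rfl, rfl, Or.inr (Or.inr ⟨rfl, hl⟩)⟩, h⟩
    · rintro ⟨_, _, _, -, -, ⟨rfl, rfl, ⟨rfl, hl⟩ | ⟨rfl, hl⟩ | ⟨rfl, hl⟩⟩, h⟩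
      · exact Or.inl ⟨h, hl⟩
      · exact Or.inr (Or.inl ⟨h, hl⟩)
      · exact Or.inr (Or.inr ⟨h, hl⟩)
  · refine Iff.trans ?_ ex.symm
    constructor
    · rintro (⟨h, hl⟩ | ⟨h, hl⟩ | h)
      · exact ⟨X, Y, 6, by norm_num, ⟨hX, hY⟩, ⟨rfl, rfl, Or.inl ⟨rfl, hl⟩⟩, h⟩
      · exact ⟨X, Y, 10, by norm_num, ⟨hX, hY⟩, ⟨rfl, rfl, Or.inr (Or.inl ⟨rfl, hl⟩)⟩, h⟩
      · exact ⟨X, Y, 12, by norm_num, ⟨hX, hY⟩, ⟨rfl, rfl, Or.inr (Or.inr rfl)⟩, h⟩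
    · rintro ⟨_, _, _, -, -, ⟨rfl, rfl, ⟨rfl, hl⟩ | ⟨rfl, hl⟩ | rfl⟩, h⟩
      · exact Or.inl ⟨h, hl⟩
      · exact Or.inr (Or.inl ⟨h, hl⟩)
      · exact Or.inr (Or.inr h)
  -- the unused gate of the group
  · refine Iff.trans ?_ ex.symm
    simp

open Classical in
/-- The string presented by the output. -/
noncomputable def result : List Bool :=
  if M.Accepted x then M.yes else if M.Hit x then M.no else List.ofFn x

open Classical in
/-- The output bits, as values of gates. -/
theorem map_value_out (hs : M.single = false) :
    Presents ((List.range M.net.numOut).map fun j => M.value x (M.net.out j)) (M.result x) := by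
  have hnum : M.net.numOut = 2 * 2 ^ M.L := by simp [net, hs]
  have hlen : (M.result x).length ≤ 2 ^ M.L := by
    unfold result
    split_ifs
    · exact M.le_yes
    · exact M.le_no
    · simpa using M.le_n
  have hlong : ∀ j, M.LongerThan x j ↔ j < (M.result x).length := by
    intro j
    unfold result LongerThan
    have := M.acc_imp_hit x
    split_ifs with h1 h2
    · simp [h1, this h1]
    · simp [h1, h2]
    · simp [h1, h2]
  have hbit : ∀ j, M.HasBit x j ↔ (M.result x).getD j false = true := by
    intro j
    unfold result HasBit
    have := M.acc_imp_hit x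
    split_ifs with h1 h2
    · simp [h1, this h1]
    · simp [h1, h2]
    · simp [h1, h2, ext, List.getD_eq_getElem?_getD, List.getElem?_ofFn]
      split_ifs with h3 <;> simp [h3]
  have out0 : ∀ j, M.value x (M.net.out (2 * j)) = decide (j < (M.result x).length) := by
    intro j
    have : M.net.out (2 * j) = node 0 j 13 := by simp [net, hs]
    rw [this, Bool.eq_iff_iff, M.value_node x (by norm_num), decide_eq_true_eq]
    exact hlong j
  have out1 : ∀ j, M.value x (M.net.out (2 * j + 1)) = (M.result x).getD j false := by
    intro j
    have : M.net.out (2 * j + 1) = node 0 j 14 := by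
      simp [net, hs]
      congr 1
      omega
    rw [this, Bool.eq_iff_iff, M.value_node x (by norm_num)]
    exact hbit j
  have pairs : ∀ m, (List.range (2 * m)).map (fun j => M.value x (M.net.out j)) =
      (List.range m).flatMap fun j =>
        [decide (j < (M.result x).length), (M.result x).getD j false] := by
    intro m
    induction m with
    | zero => rfl
    | succ m ih =>
      rw [show 2 * (m + 1) = 2 * m + 1 + 1 by ring, List.range_succ, List.range_succ,
        List.range_succ (n := m), List.map_append, List.map_append, ih, List.flatMap_append]
      simp [out0, out1]
  rw [hnum, pairs]
  generalize M.result x = y at *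
  refine ⟨2 * (2 ^ M.L - y.length), ?_⟩
  obtain ⟨d, hd⟩ := Nat.exists_eq_add_of_le hlen
  rw [hd, List.range_add, List.flatMap_append]
  congr 1
  · have e : y = (List.range y.length).map fun j => y.getD j false := by
      refine List.ext_getElem (by simp) fun j h1 h2 => ?_
      simp [h1]
    conv_rhs => rw [e, List.flatMap_map]
    refine List.flatMap_congr fun j hj => ?_
    rw [List.mem_range] at hj
    simp [hj]
  · rw [Nat.add_sub_cancel_left, List.flatMap_map]
    clear hd hlen
    induction d with
    | zero => rfl
    | succ d ih =>
      rw [List.range_succ, List.flatMap_append, ih, show 2 * (d + 1) = 2 * d + 2 by ring,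
        List.replicate_add]
      simp

end Inspector

end ParaCircuit

namespace ParaCircuit

/-! ### Numbers computed by circuits -/

theorem testBit_ofDigits (l : List Bool) (j : ℕ) :
    (Nat.ofDigits 2 (l.map Bool.toNat)).testBit j = l.getD j false := by
  induction l generalizing j with
  | nil => simp
  | cons b l ih =>
    rw [List.map_cons, Nat.ofDigits_cons]
    have e : (b.toNat : ℕ) + 2 * Nat.ofDigits 2 (l.map Bool.toNat)
        = Nat.bit b (Nat.ofDigits 2 (l.map Bool.toNat)) := by
      rw [Nat.bit_val, add_comm]
    cases j with
    | zero => simp [e]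
    | succ j => simp [e, Nat.testBit_bit_succ, ih]

/-- The number whose binary digits are the output bits, the least significant one first. -/
noncomputable def Circuit.outNum {n : ℕ} (C : Circuit n) (x : Fin n → Bool) : ℕ :=
  Nat.ofDigits 2 ((C.output x).map Bool.toNat)

namespace Inspector

variable {n : ℕ} (M : Inspector n) (x : Fin n → Bool)

/-- As `w` and all output bits are within range, comparing the first `2 ^ L` digits suffices. -/
theorem isNum_iff {w : ℕ} (hw : w < 2 ^ M.L) : M.IsNum x w ↔ w = M.Fr.outNum x := by
  have key : ∀ j, (M.Fr.outNum x).testBit j = M.Fr.outBit x j := fun j => testBit_ofDigits _ j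
  constructor
  · intro h
    refine Nat.eq_of_testBit_eq fun j => ?_
    rw [key]
    by_cases hj : j < 2 ^ M.L
    · exact (h j hj).symm
    · rw [Circuit.outBit_of_le x M.Fr (M.numOut_Fr.trans (not_lt.1 hj))]
      refine Nat.testBit_lt_two_pow (hw.trans_le ?_)
      exact Nat.pow_le_pow_right (by norm_num) (Nat.lt_two_pow_self.le.trans (not_lt.1 hj))
  · rintro rfl j -
    exact (key j).symm

theorem hit_iff : M.Hit x ↔ M.Fr.outNum x < 2 ^ M.L ∧ M.good (M.Fr.outNum x) := by
  constructor
  · rintro ⟨w, hw, hg, h⟩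
    rw [M.isNum_iff x hw] at h
    exact h ▸ ⟨hw, hg⟩
  · rintro ⟨hw, hg⟩
    exact ⟨_, hw, hg, (M.isNum_iff x hw).2 rfl⟩

theorem accepted_iff : M.Accepted x ↔ M.Hit x ∧ ∀ b, (M.Sub (M.Fr.outNum x)).rout 0 b →
    (M.Sub (M.Fr.outNum x)).rval x b = true := by
  rw [M.hit_iff]
  constructor
  · rintro ⟨w, hw, hg, h, h'⟩
    rw [M.isNum_iff x hw] at h
    subst h
    exact ⟨⟨hw, hg⟩, h'⟩
  · rintro ⟨⟨hw, hg⟩, h⟩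
    exact ⟨_, hw, hg, (M.isNum_iff x hw).2 rfl, h⟩

open Classical in
/-- A net with a single output says whether the number is recognized. -/
theorem map_value_out_single (hs : M.single = true) :
    ((List.range M.net.numOut).map fun j => M.value x (M.net.out j)) = [decide (M.Hit x)] := by
  have hnum : M.net.numOut = 1 := by simp [net, hs]
  have hout : M.net.out 0 = node 0 0 7 := by simp [net, hs]
  have hv : M.value x (node 0 0 7) = decide (M.Hit x) := by
    rw [Bool.eq_iff_iff, M.value_node x (by norm_num), decide_eq_true_eq]
    exact Iff.rfl
  rw [hnum]
  simp [hout, hv]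

end Inspector

/-! ### Reduction of the fan-in -/

/-- In the binary tree in which `2 t` and `2 t + 1` are the children of `t`, the node `u` lies
below `t`. -/
def Desc (t u : ℕ) : Prop := ∃ i, u / 2 ^ i = t

theorem desc_iff (t u : ℕ) : Desc t u ↔ u = t ∨ Desc (2 * t) u ∨ Desc (2 * t + 1) u := by
  constructor
  · rintro ⟨i, hi⟩
    cases i with
    | zero => exact Or.inl (by simpa using hi)
    | succ i =>
      rw [pow_succ, ← Nat.div_div_eq_div_mul] at hi
      right
      have : u / 2 ^ i = 2 * t ∨ u / 2 ^ i = 2 * t + 1 := by omega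
      exact this.imp (fun h => ⟨i, h⟩) fun h => ⟨i, h⟩
  · rintro (rfl | ⟨i, hi⟩ | ⟨i, hi⟩)
    · exact ⟨0, by simp⟩
    · exact ⟨i + 1, by rw [pow_succ, ← Nat.div_div_eq_div_mul, hi]; omega⟩
    · exact ⟨i + 1, by rw [pow_succ, ← Nat.div_div_eq_div_mul, hi]; omega⟩

/-- The nodes from `2 ^ s` to `2 ^ (s + 1) - 1` are the leaves of the tree of height `s`. -/
theorem desc_leaf {s t u : ℕ} (ht : 2 ^ s ≤ t) (hu : u < 2 ^ (s + 1)) : Desc t u ↔ u = t := by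
  constructor
  · rintro ⟨i, hi⟩
    cases i with
    | zero => simpa using hi
    | succ i =>
      have : u / 2 ^ (i + 1) ≤ u / 2 := Nat.div_le_div_left (by rw [pow_succ]; have := Nat.one_le_two_pow (n := i); omega) (by norm_num)
      rw [pow_succ] at hu
      omega
  · rintro rfl
    exact ⟨0, by simp⟩

theorem desc_one {s h : ℕ} (hh : h < 2 ^ s) : Desc 1 (2 ^ s + h) :=
  ⟨s, Nat.div_eq_of_lt_le (by omega) (by omega)⟩

namespace Net

variable {n : ℕ}

/-- Marks the gates of a net the fan-in of which is to be reduced to two, by replacing them by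
binary trees; `rank` counts the marked gates on the paths to a gate. -/
structure Marking (N : Net n) where
  /-- the marked gates -/
  wide : ℕ → Prop
  /-- bound on the number of marked gates on a path -/
  rank : ℕ → ℕ
  /-- height of the trees -/
  s : ℕ
  size_le : N.size ≤ 2 ^ s
  code_wide : ∀ g, wide g → N.code g = 2 ∨ N.code g = 3
  rank_le : ∀ g < N.size, ∀ h, N.wire g h → rank h ≤ rank g
  rank_lt : ∀ g < N.size, ∀ h, N.wire g h → wide g → rank h < rank g

namespace Marking

variable {N : Net n} (m : N.Marking)

/-- Wire from node `u` of the tree for `h` to node `t` of the tree for `g`. -/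
def treeWire (g t h u : ℕ) : Prop := g < N.size ∧
  ((m.wide g ∧ ((0 < t ∧ t < 2 ^ m.s ∧ h = g ∧ (u = 2 * t ∨ u = 2 * t + 1)) ∨
    (2 ^ m.s ≤ t ∧ u = 1 ∧ 2 ^ m.s + h = t ∧ N.wire g h))) ∨
  (¬ m.wide g ∧ t = 1 ∧ u = 1 ∧ N.wire g h))

/-- The tree for `g` has a node `t`. -/
def IsNode (g t : ℕ) : Prop := g < N.size ∧ 0 < t ∧ (m.wide g ∨ t = 1)

open Classical in
/-- The net in which every marked gate is replaced by a binary tree, the leaves of which correspond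
to all gates of the original net. The root of the tree has number `1`. -/
noncomputable def narrow : Net n where
  size := 4 ^ (m.s + 1)
  code a := if m.IsNode (deinterleave a).1 (deinterleave a).2 then N.code (deinterleave a).1 else 3
  param a := N.param (deinterleave a).1
  wire a b := b < 4 ^ (m.s + 1) ∧ m.treeWire (deinterleave a).1 (deinterleave a).2
    (deinterleave b).1 (deinterleave b).2
  numOut := N.numOut
  out j := interleave (N.out j) 1
  -- every marked gate on a path contributes at most `s + 2` to the depth, hence the term with
  -- `rank`; within a tree the depth grows from the leaves to the root
  dp a := N.dp (deinterleave a).1 + (m.s + 2) * m.rank (deinterleave a).1 +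
    if m.wide (deinterleave a).1 then m.s - Nat.log 2 (deinterleave a).2 else m.s
  code_le a := by
    split_ifs
    · exact N.code_le _
    · omega
  param_lt a _ h := by
    split_ifs at h with h1
    exact N.param_lt _ h1.1 h
  param_le a _ h := by
    split_ifs at h with h1
    · refine (N.param_le _ h1.1 h).trans (m.size_le.trans ?_)
      calc 2 ^ m.s ≤ 4 ^ m.s := Nat.pow_le_pow_left (by norm_num) _
        _ ≤ 4 ^ (m.s + 1) := Nat.pow_le_pow_right (by norm_num) (by omega)
    · omega
  wire_lt a _ b hw := by
    refine ⟨hw.1, ?_⟩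
    obtain ⟨-, hg, ⟨hwide, ⟨h0, h1, h2, h3⟩ | ⟨h1, h2, h3, h4⟩⟩ | ⟨hwide, h1, h2, h3⟩⟩ := hw
    · rw [h2, if_pos hwide, if_pos hwide]
      have hlog : Nat.log 2 (deinterleave b).2 = Nat.log 2 (deinterleave a).2 + 1 := by
        rw [Nat.log_of_one_lt_of_le (by norm_num) (by omega : 2 ≤ (deinterleave b).2)]
        congr 2
        omega
      have hlt : Nat.log 2 (deinterleave a).2 < m.s := Nat.log_lt_of_lt_pow (by omega) h1
      omega
    · have e1 := (N.wire_lt _ hg _ h4).2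
      have e2 : (m.s + 2) * m.rank (deinterleave b).1 + (m.s + 2) ≤
          (m.s + 2) * m.rank (deinterleave a).1 := by
        rw [← Nat.mul_succ]
        exact Nat.mul_le_mul_left _ (m.rank_lt _ hg _ h4 hwide)
      split_ifs <;> omega
    · have e1 := (N.wire_lt _ hg _ h3).2
      have e2 : (m.s + 2) * m.rank (deinterleave b).1 ≤ (m.s + 2) * m.rank (deinterleave a).1 :=
        Nat.mul_le_mul_left _ (m.rank_le _ hg _ h3)
      rw [if_neg hwide]
      split_ifs <;> omega
  input_wire a _ h b hw := by
    split_ifs at h with h1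
    obtain ⟨-, hg, ⟨hwide, -⟩ | ⟨hwide, -, -, h3⟩⟩ := hw
    · have := m.code_wide _ hwide
      omega
    · exact N.input_wire _ hg h _ h3
  not_wire a ha h := by
    have h1 : m.IsNode (deinterleave a).1 (deinterleave a).2 := by
      by_contra h1
      rw [if_neg h1] at h
      omega
    rw [if_pos h1] at h
    obtain ⟨hg, h0, hw⟩ := h1
    have hwide : ¬ m.wide (deinterleave a).1 := fun hw => by
      have := m.code_wide _ hw
      omega
    have ht := hw.resolve_left hwide
    obtain ⟨c, hc⟩ := N.not_wire _ hg h
    have hcs := (N.wire_lt _ hg c ((hc c).2 rfl)).1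
    refine ⟨interleave c 1, fun b => ?_⟩
    unfold treeWire
    constructor
    · rintro ⟨-, -, ⟨hw, -⟩ | ⟨-, -, hu, hw⟩⟩
      · exact absurd hw hwide
      · rw [hc] at hw
        rw [← hw, ← hu, interleave_deinterleave]
    · rintro rfl
      rw [interleave_lt_iff, deinterleave_interleave]
      refine ⟨⟨?_, Nat.one_lt_two_pow (by omega)⟩, hg, Or.inr ⟨hwide, ht, rfl, (hc c).2 rfl⟩⟩
      exact (hcs.trans_le m.size_le).trans_le (Nat.pow_le_pow_right (by norm_num) (by omega))
  out_lt j hj := by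
    rw [interleave_lt_iff]
    exact ⟨((N.out_lt j hj).trans_le m.size_le).trans_le
      (Nat.pow_le_pow_right (by norm_num) (by omega)), Nat.one_lt_two_pow (by omega)⟩

open Classical in
/-- The truth value of node `t` of the tree for `g`. -/
def TreeVal (V : ℕ → Bool) (g t : ℕ) : Prop := m.IsNode g t ∧
  if m.wide g then
    if N.code g = 2 then ∀ h, N.wire g h → Desc t (2 ^ m.s + h) → V h = true
    else ∃ h, N.wire g h ∧ Desc t (2 ^ m.s + h) ∧ V h = true
  else V g = true

variable {m} {x : Fin n → Bool} {V : ℕ → Bool}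

/-- The root of the tree for a gate has the value of the gate. -/
theorem treeVal_one
    (hV : ∀ g < N.size, V g = true ↔ gateEval (ext x) (N.code g) (N.param g) (N.wire g) V)
    {g : ℕ} (hg : g < N.size) : m.TreeVal V g 1 ↔ V g = true := by
  have hn : m.IsNode g 1 := ⟨hg, one_pos, Or.inr rfl⟩
  unfold TreeVal
  rw [and_iff_right hn]
  split_ifs with hw hc
  · rw [hV g hg, hc]
    refine forall_congr' fun h => ?_
    constructor
    · intro H hh
      exact H hh (desc_one ((N.wire_lt g hg h hh).1.trans_le m.size_le))
    · exact fun H hh _ => H hh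
  · rw [hV g hg, (m.code_wide g hw).resolve_left hc]
    refine exists_congr fun h => ?_
    constructor
    · rintro ⟨h1, -, h2⟩
      exact ⟨h1, h2⟩
    · rintro ⟨h1, h2⟩
      exact ⟨h1, desc_one ((N.wire_lt g hg h h1).1.trans_le m.size_le), h2⟩
  · exact Iff.rfl

open Classical in
/-- The truth values of the nodes satisfy the equations of all gates of the narrowed net: a node
collects the gates of its leaves. -/
theorem treeVal_eq
    (hV : ∀ g < N.size, V g = true ↔ gateEval (ext x) (N.code g) (N.param g) (N.wire g) V)
    (a : ℕ) (ha : a < m.narrow.size) :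
    decide (m.TreeVal V (deinterleave a).1 (deinterleave a).2) = true ↔
    gateEval (ext x) (m.narrow.code a) (m.narrow.param a) (m.narrow.wire a)
      fun b => decide (m.TreeVal V (deinterleave b).1 (deinterleave b).2) := by
  obtain ⟨hglt, htlt⟩ := deinterleave_lt ha
  rw [decide_eq_true_eq]
  set g := (deinterleave a).1 with hg'
  set t := (deinterleave a).2 with ht'
  have hcode : m.narrow.code a = if m.IsNode g t then N.code g else 3 := rfl
  have hparam : m.narrow.param a = N.param g := rfl
  have hwire : ∀ b, m.narrow.wire a b ↔ b < 4 ^ (m.s + 1) ∧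
    m.treeWire g t (deinterleave b).1 (deinterleave b).2 := fun b => Iff.rfl
  have hwire' : ∀ h u, m.narrow.wire a (interleave h u) ↔ (h < 2 ^ (m.s + 1) ∧ u < 2 ^ (m.s + 1)) ∧
      m.treeWire g t h u := by
    intro h u
    rw [hwire, deinterleave_interleave, interleave_lt_iff]
  rw [hcode, hparam]
  by_cases hnode : m.IsNode g t
  swap
  · rw [if_neg hnode]
    constructor
    · exact fun h => absurd h.1 hnode
    · rintro ⟨b, hb, -⟩
      rw [hwire] at hb
      obtain ⟨-, hg, ⟨hw, ⟨h0, -⟩ | ⟨h1, -⟩⟩ | ⟨-, h1, -⟩⟩ := hb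
      · exact absurd ⟨hg, h0, Or.inl hw⟩ hnode
      · exact absurd ⟨hg, lt_of_lt_of_le (by positivity) h1, Or.inl hw⟩ hnode
      · exact absurd ⟨hg, by omega, Or.inr h1⟩ hnode
  rw [if_pos hnode]
  obtain ⟨hg, h0, hwt⟩ := id hnode
  have hpow : N.size ≤ 2 ^ (m.s + 1) :=
    m.size_le.trans (Nat.pow_le_pow_right (by norm_num) (by omega))
  have one_lt : 1 < 2 ^ (m.s + 1) := Nat.one_lt_two_pow (by omega)
  by_cases hw : m.wide g
  swap
  · have ht := hwt.resolve_left hw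
    rw [ht, treeVal_one hV hg, hV g hg]
    have inj : (fun h => interleave h 1).Injective := by
      intro h h' e
      have := congrArg (fun b => (deinterleave b).1) e
      simpa [deinterleave_interleave] using this
    refine (gateEval_map inj (fun b => ?_) fun h hh => ?_).symm
    · constructor
      · rw [hwire]
        rintro ⟨-, -, ⟨h, -⟩ | ⟨-, -, h1, h2⟩⟩
        · exact absurd h hw
        · refine ⟨_, h2, ?_⟩
          rw [← h1, interleave_deinterleave]
      · rintro ⟨h, hh, rfl⟩
        rw [hwire']
        exact ⟨⟨(N.wire_lt g hg h hh).1.trans_le hpow, one_lt⟩, hg, Or.inr ⟨hw, ht, rfl, hh⟩⟩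
    · rw [deinterleave_interleave, Bool.eq_iff_iff, decide_eq_true_eq]
      exact treeVal_one hV (N.wire_lt g hg h hh).1
  have hval : m.TreeVal V g t ↔ if N.code g = 2 then ∀ h, N.wire g h → Desc t (2 ^ m.s + h) →
      V h = true else ∃ h, N.wire g h ∧ Desc t (2 ^ m.s + h) ∧ V h = true := by
    unfold TreeVal
    rw [and_iff_right hnode, if_pos hw]
  by_cases hleaf : 2 ^ m.s ≤ t
  · -- a leaf passes on the value of the gate that it stands for
    obtain ⟨k, hk⟩ := Nat.exists_eq_add_of_le hleaf
    have hdesc : ∀ h, N.wire g h → (Desc t (2 ^ m.s + h) ↔ h = k) := by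
      intro h hh
      have := (N.wire_lt g hg h hh).1.trans_le m.size_le
      rw [desc_leaf hleaf (by rw [pow_succ]; omega)]
      omega
    have hleafwire : ∀ b, m.narrow.wire a b ↔ N.wire g k ∧ b = interleave k 1 := by
      intro b
      constructor
      · rw [hwire]
        rintro ⟨-, -, ⟨-, ⟨-, h, -⟩ | ⟨-, h1, h2, h3⟩⟩ | ⟨h, -⟩⟩
        · omega
        · have h4 : (deinterleave b).1 = k := by omega
          rw [h4] at h3
          exact ⟨h3, by rw [← h4, ← h1, interleave_deinterleave]⟩
        · exact absurd hw h
      · rintro ⟨hh, rfl⟩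
        rw [hwire']
        exact ⟨⟨(N.wire_lt g hg k hh).1.trans_le hpow, one_lt⟩, hg,
          Or.inl ⟨hw, Or.inr ⟨hleaf, rfl, hk.symm, hh⟩⟩⟩
    have hroot : N.wire g k → (decide (m.TreeVal V (deinterleave (interleave k 1)).1
        (deinterleave (interleave k 1)).2) = true ↔ V k = true) := by
      intro hh
      rw [deinterleave_interleave, decide_eq_true_eq]
      exact treeVal_one hV (N.wire_lt g hg k hh).1
    rw [hval]
    split_ifs with hc
    · rw [hc]
      constructor
      · intro H b hb
        obtain ⟨hh, rfl⟩ := (hleafwire b).1 hb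
        exact (hroot hh).2 (H k hh ((hdesc k hh).2 rfl))
      · intro H h hh hd
        obtain rfl := (hdesc h hh).1 hd
        exact (hroot hh).1 (H _ ((hleafwire _).2 ⟨hh, rfl⟩))
    · rw [(m.code_wide g hw).resolve_left hc]
      constructor
      · rintro ⟨h, hh, hd, hv⟩
        obtain rfl := (hdesc h hh).1 hd
        exact ⟨_, (hleafwire _).2 ⟨hh, rfl⟩, (hroot hh).2 hv⟩
      · rintro ⟨b, hb, hv⟩
        obtain ⟨hh, rfl⟩ := (hleafwire b).1 hb
        exact ⟨k, hh, (hdesc k hh).2 rfl, (hroot hh).1 hv⟩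
  -- an inner node combines the values of its two children
  · have hlt : t < 2 ^ m.s := not_le.1 hleaf
    have hinner : ∀ b, m.narrow.wire a b ↔ b = interleave g (2 * t) ∨ b = interleave g (2 * t + 1) := by
      intro b
      constructor
      · rw [hwire]
        rintro ⟨-, -, ⟨-, ⟨-, -, h1, h2⟩ | ⟨h, -⟩⟩ | ⟨h, -⟩⟩
        · rw [← interleave_deinterleave b, h1]
          exact h2.imp (fun h => by rw [h]) fun h => by rw [h]
        · exact absurd h hleaf
        · exact absurd hw h
      · rintro (rfl | rfl)
        · rw [hwire', pow_succ]
          exact ⟨⟨by rw [pow_succ] at hpow; omega, by omega⟩, hg,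
            Or.inl ⟨hw, Or.inl ⟨h0, hlt, rfl, Or.inl rfl⟩⟩⟩
        · rw [hwire', pow_succ]
          exact ⟨⟨by rw [pow_succ] at hpow; omega, by omega⟩, hg,
            Or.inl ⟨hw, Or.inl ⟨h0, hlt, rfl, Or.inr rfl⟩⟩⟩
    have hdesc : ∀ h, Desc t (2 ^ m.s + h) ↔
        Desc (2 * t) (2 ^ m.s + h) ∨ Desc (2 * t + 1) (2 ^ m.s + h) := by
      intro h
      rw [desc_iff]
      exact or_iff_right (by omega)
    have hchild : ∀ u, 0 < u → (decide (m.TreeVal V (deinterleave (interleave g u)).1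
        (deinterleave (interleave g u)).2) = true ↔
        if N.code g = 2 then ∀ h, N.wire g h → Desc u (2 ^ m.s + h) → V h = true
        else ∃ h, N.wire g h ∧ Desc u (2 ^ m.s + h) ∧ V h = true) := by
      intro u hu
      have hn : m.IsNode g u := ⟨hg, hu, Or.inl hw⟩
      rw [deinterleave_interleave, decide_eq_true_eq]
      change m.TreeVal V g u ↔ _
      unfold TreeVal
      rw [and_iff_right hn, if_pos hw]
    have c1 := hchild (2 * t) (by omega)
    have c2 := hchild (2 * t + 1) (by omega)
    rw [hval]
    split_ifs at c1 c2 ⊢ with hc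
    · rw [hc]
      constructor
      · intro H b hb
        rcases (hinner b).1 hb with rfl | rfl
        · exact c1.2 fun h hh hd => H h hh ((hdesc h).2 (Or.inl hd))
        · exact c2.2 fun h hh hd => H h hh ((hdesc h).2 (Or.inr hd))
      · intro H h hh hd
        rcases (hdesc h).1 hd with hd | hd
        · exact c1.1 (H _ ((hinner _).2 (Or.inl rfl))) h hh hd
        · exact c2.1 (H _ ((hinner _).2 (Or.inr rfl))) h hh hd
    · rw [(m.code_wide g hw).resolve_left hc]
      constructor
      · rintro ⟨h, hh, hd, hv⟩
        rcases (hdesc h).1 hd with hd | hd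
        · exact ⟨_, (hinner _).2 (Or.inl rfl), c1.2 ⟨h, hh, hd, hv⟩⟩
        · exact ⟨_, (hinner _).2 (Or.inr rfl), c2.2 ⟨h, hh, hd, hv⟩⟩
      · rintro ⟨b, hb, hv⟩
        rcases (hinner b).1 hb with rfl | rfl
        · obtain ⟨h, hh, hd, hv'⟩ := c1.1 hv
          exact ⟨h, hh, (hdesc h).2 (Or.inl hd), hv'⟩
        · obtain ⟨h, hh, hd, hv'⟩ := c2.1 hv
          exact ⟨h, hh, (hdesc h).2 (Or.inr hd), hv'⟩

/-- The narrowed net has the output of the original one. -/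
theorem output_narrow
    (hV : ∀ g < N.size, V g = true ↔ gateEval (ext x) (N.code g) (N.param g) (N.wire g) V) :
    m.narrow.toCircuit.output x = (List.range N.numOut).map fun j => V (N.out j) := by
  classical
  rw [m.narrow.output_toCircuit x _ (treeVal_eq hV)]
  refine List.map_congr_left fun j hj => ?_
  change decide (m.TreeVal V (deinterleave (interleave (N.out j) 1)).1
    (deinterleave (interleave (N.out j) 1)).2) = _
  rw [deinterleave_interleave, Bool.eq_iff_iff, decide_eq_true_eq]
  exact treeVal_one hV (N.out_lt j (by simpa [narrow] using hj))

/-- The narrowed net is of fan-in two if the gates of larger fan-in were marked. -/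
theorem over_narrow (h4 : ∀ g < N.size, N.code g ≠ 4)
    (h2 : ∀ g < N.size, ¬ m.wide g → ∃ b c, ∀ h, N.wire g h → h = b ∨ h = c) :
    m.narrow.toCircuit.Over .NC := by
  classical
  intro g
  refine ⟨m.narrow.kind_toCircuit_ne (fun g hg => ?_) g, ?_⟩
  · change (if m.IsNode _ _ then _ else 3) ≠ 4
    split_ifs with h
    · exact h4 _ h.1
    · omega
  · have two : ∃ b c, ∀ h ∈ m.narrow.toCircuit.preds g, h.val = b ∨ h.val = c := by
      set a := (deinterleave g.val).1 with ha
      have hmem : ∀ h ∈ m.narrow.toCircuit.preds g, m.treeWire a (deinterleave g.val).2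
          (deinterleave h.val).1 (deinterleave h.val).2 := fun h hh =>
        (Finset.mem_filter.1 hh).2.2
      by_cases hsize : a < N.size
      swap
      · exact ⟨0, 0, fun h hh => absurd (hmem h hh).1 hsize⟩
      by_cases hw : m.wide a
      · by_cases hleaf : 2 ^ m.s ≤ (deinterleave g.val).2
        · refine ⟨interleave ((deinterleave g.val).2 - 2 ^ m.s) 1, 0, fun h hh => Or.inl ?_⟩
          obtain ⟨-, ⟨-, ⟨-, h1, -⟩ | ⟨-, h1, h2, -⟩⟩ | ⟨h1, -⟩⟩ := hmem h hh
          · omega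
          · rw [← h2, Nat.add_sub_cancel_left, ← h1, interleave_deinterleave]
          · exact absurd hw h1
        · refine ⟨interleave a (2 * (deinterleave g.val).2),
            interleave a (2 * (deinterleave g.val).2 + 1), fun h hh => ?_⟩
          obtain ⟨-, ⟨-, ⟨-, -, h1, h2⟩ | ⟨h1, -⟩⟩ | ⟨h1, -⟩⟩ := hmem h hh
          · rw [← interleave_deinterleave h.val, h1]
            exact h2.imp (fun h => by rw [h]) fun h => by rw [h]
          · exact absurd h1 hleaf
          · exact absurd hw h1
      · obtain ⟨b, c, hbc⟩ := h2 a hsize hw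
        refine ⟨interleave b 1, interleave c 1, fun h hh => ?_⟩
        obtain ⟨-, ⟨h1, -⟩ | ⟨-, -, h1, h2⟩⟩ := hmem h hh
        · exact absurd h1 hw
        · rw [← interleave_deinterleave h.val, h1]
          exact (hbc _ h2).imp (fun h => by rw [h]) fun h => by rw [h]
    obtain ⟨b, c, hbc⟩ := two
    have hsub : (m.narrow.toCircuit.preds g).map Fin.valEmbedding ⊆ {b, c} := by
      intro i hi
      obtain ⟨h, hh, rfl⟩ := Finset.mem_map.1 hi
      simpa using hbc h hh
    have := Finset.card_le_card hsub
    rw [Finset.card_map] at this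
    exact this.trans Finset.card_le_two

end Marking

end Net

end ParaCircuit

namespace ParaCircuit

/-! ### The net over a given basis -/

/-- In an `NC`-circuit every gate is fed by at most two gates. -/
theorem Circuit.exists_rwire_pair {n : ℕ} {C : Circuit n} (h : C.Over .NC) (a : ℕ) :
    ∃ b c, ∀ d, C.rwire a d → d = b ∨ d = c := by
  by_cases ha : a < C.size
  swap
  · exact ⟨0, 0, fun d hd => absurd (Circuit.rwire_lt hd).1 ha⟩
  have h2 := (h ⟨a, ha⟩).2
  have mem : ∀ d, C.rwire a d → ∃ e ∈ C.preds ⟨a, ha⟩, e.val = d := by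
    rintro d ⟨g, e, rfl, rfl, hm⟩
    exact ⟨e, hm, rfl⟩
  have h3 : (C.preds ⟨a, ha⟩).card = 0 ∨ (C.preds ⟨a, ha⟩).card = 1 ∨
    (C.preds ⟨a, ha⟩).card = 2 := by omega
  rcases h3 with h3 | h3 | h3
  · rw [Finset.card_eq_zero] at h3
    refine ⟨0, 0, fun d hd => ?_⟩
    obtain ⟨e, he, -⟩ := mem d hd
    simp [h3] at he
  · obtain ⟨b, hb⟩ := Finset.card_eq_one.1 h3
    refine ⟨b, b, fun d hd => ?_⟩
    obtain ⟨e, he, rfl⟩ := mem d hd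
    simp only [hb, Finset.mem_singleton] at he
    simp [he]
  · obtain ⟨b, c, -, hb⟩ := Finset.card_eq_two.1 h3
    refine ⟨b, c, fun d hd => ?_⟩
    obtain ⟨e, he, rfl⟩ := mem d hd
    simp only [hb, Finset.mem_insert, Finset.mem_singleton] at he
    exact he.imp (fun h => by rw [h]) fun h => by rw [h]

theorem Circuit.rcode_ne_four {n : ℕ} {C : Circuit n} (h : C.Over .AC) (a : ℕ) : C.rcode a ≠ 4 := by
  unfold Circuit.rcode
  split_ifs with ha
  · have := h ⟨a, ha⟩
    cases hk : C.kind ⟨a, ha⟩ with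
    | threshold t => exact absurd hk (this t)
    | _ => simp [GateKind.code]
  · omega

theorem Circuit.Over.ac {n : ℕ} {C : Circuit n} (h : C.Over .NC) : C.Over .AC :=
  fun g t => (h g).1 t

/-- The circuit without gates. -/
def Circuit.empty (n : ℕ) : Circuit n where
  size := 0
  kind g := g.elim0
  preds g := g.elim0
  acyclic := ⟨fun g => g.elim0⟩
  input_preds g := g.elim0
  not_preds g := g.elim0
  numOut := 0
  out j := j.elim0

namespace Inspector

variable {n : ℕ} (M : Inspector n)

/-- The gates the fan-in of which may be unbounded. The circuit `Fr` may be of bounded depth and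
unbounded fan-in (`wf`), or of bounded fan-in. -/
noncomputable def marking (wf : Prop) [Decidable wf] (r : ℕ) (hr : wf → M.Fr.depth ≤ r) : M.net.Marking where
  wide g := g % 16 ≠ 4 ∧ (g % 16 = 0 → wf) ∧ (M.net.code g = 2 ∨ M.net.code g = 3)
  rank g := level r (fun _ Y => if wf then M.Fr.rdepth Y else 0) (fun _ _ => 0) (gx g) (gy g) (g % 16)
  s := 4 + 2 * M.L
  size_le := by
    change 16 * 4 ^ M.L ≤ _
    rw [pow_add, pow_mul]
    norm_num
  code_wide g h := h.2.2
  rank_le g hg h hw := by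
    have hT : g % 16 < 16 := Nat.mod_lt _ (by norm_num)
    by_cases h0 : g % 16 = 0
    · have h1 := hw.2
      rw [h0] at h1 ⊢
      obtain ⟨e1, e2, e3⟩ := h1
      rw [e1]
      simp only [level]
      split_ifs
      · exact (Circuit.rdepth_lt e3).le
      · exact le_rfl
    · by_cases h4 : g % 16 = 4
      · have h1 := hw.2
        rw [h4] at h1 ⊢
        obtain ⟨e1, -⟩ := h1
        rw [e1]
        exact le_rfl
      · refine (M.level_lt (fun _ Y => ?_) (fun X _ _ => Nat.zero_le _) hT hw.2 h0 h4).le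
        split_ifs with hf
        · exact (Circuit.rdepth_le Y).trans (hr hf)
        · omega
  rank_lt g hg h hw hwide := by
    have hT : g % 16 < 16 := Nat.mod_lt _ (by norm_num)
    by_cases h0 : g % 16 = 0
    · have hf := hwide.2.1 h0
      have h1 := hw.2
      rw [h0] at h1 ⊢
      obtain ⟨e1, e2, e3⟩ := h1
      rw [e1]
      simp only [level]
      rw [if_pos hf, if_pos hf]
      exact Circuit.rdepth_lt e3
    · refine M.level_lt (fun _ Y => ?_) (fun X _ _ => Nat.zero_le _) hT hw.2 h0 hwide.1
      split_ifs with hf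
      · exact (Circuit.rdepth_le Y).trans (hr hf)
      · omega

/-- The net has no threshold gates if the given circuits have none. -/
theorem code_ne_four (hF : M.Fr.Over .AC) (hS : ∀ w, (M.Sub w).Over .AC) (g : ℕ) :
    M.net.code g ≠ 4 := by
  change M.code _ _ _ ≠ 4
  unfold code
  split
  · exact Circuit.rcode_ne_four hF _
  all_goals try split_ifs
  all_goals first | exact Circuit.rcode_ne_four (hS _) _ | omega

/-- If the fan-in of `Fr` is bounded or its gates are marked, the gates that are not marked have
fan-in two. -/
theorem exists_pair {wf : Prop} [Decidable wf] {r : ℕ} (hr : wf → M.Fr.depth ≤ r)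
    (hF : M.Fr.Over .AC) (hF' : ¬ wf → M.Fr.Over .NC) (hS : ∀ w, (M.Sub w).Over .NC)
    (g : ℕ) (hg : g < M.net.size) (hw : ¬ (M.marking wf r hr).wide g) :
    ∃ b c, ∀ h, M.net.wire g h → h = b ∨ h = c := by
  have hc := M.net.code_le g
  have h4 := M.code_ne_four hF (fun w => (hS w).ac) g
  by_cases h0 : M.net.code g = 0
  · exact ⟨0, 0, fun h hh => absurd hh (M.net.input_wire g hg h0 h)⟩
  by_cases h1 : M.net.code g = 1
  · obtain ⟨b, hb⟩ := M.net.not_wire g hg h1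
    exact ⟨b, b, fun h hh => Or.inl ((hb h).1 hh)⟩
  have h23 : M.net.code g = 2 ∨ M.net.code g = 3 := by omega
  by_cases ht : g % 16 = 4
  · obtain ⟨b, c, hbc⟩ := Circuit.exists_rwire_pair (hS (gx g)) (gy g)
    refine ⟨node (gx g) b 4, node (gx g) c 4, fun h hh => ?_⟩
    have hh' := hh.2
    rw [ht] at hh'
    obtain ⟨e1, e2, -, e3⟩ := hh'
    rw [← node_eq h, e1, e2]
    exact (hbc _ e3).imp (fun h => by rw [h]) fun h => by rw [h]
  · have hf : g % 16 = 0 ∧ ¬ wf := by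
      by_contra hcon
      exact hw ⟨ht, fun h => by tauto, h23⟩
    obtain ⟨b, c, hbc⟩ := Circuit.exists_rwire_pair (hF' hf.2) (gy g)
    refine ⟨node (gx g) b 0, node (gx g) c 0, fun h hh => ?_⟩
    have hh' := hh.2
    rw [hf.1] at hh'
    obtain ⟨e1, e2, e3⟩ := hh'
    rw [← node_eq h, e1, e2]
    exact (hbc _ e3).imp (fun h => by rw [h]) fun h => by rw [h]

theorem dp_le (g : ℕ) : M.net.dp g ≤ M.D + 8 :=
  level_le (d := fun _ => M.Fr.rdepth) (d' := M.subDepth)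
    ((Circuit.rdepth_le _).trans M.depth_Fr) (M.subDepth_le _ _) _

theorem dp_narrow_le {wf : Prop} [Decidable wf] {r : ℕ} (hr : wf → M.Fr.depth ≤ r) (a : ℕ) :
    (M.marking wf r hr).narrow.dp a ≤ M.D + 8 + (6 + 2 * M.L) * (r + 8) + (4 + 2 * M.L) := by
  classical
  have h1 := M.dp_le (deinterleave a).1
  have h2 : (M.marking wf r hr).rank (deinterleave a).1 ≤ r + 8 := by
    refine level_le (X := gx (deinterleave a).1) (d := fun _ Y => if wf then M.Fr.rdepth Y else 0)
      (d' := fun _ _ => 0)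
      ?_ (Nat.zero_le _) _
    split_ifs with hf
    · exact (Circuit.rdepth_le _).trans (hr hf)
    · omega
  have h3 : (4 + 2 * M.L + 2) * (M.marking wf r hr).rank (deinterleave a).1
    ≤ (6 + 2 * M.L) * (r + 8) := Nat.mul_le_mul (by omega) h2
  unfold Net.Marking.narrow
  dsimp only
  rw [show (M.marking wf r hr).s = 4 + 2 * M.L from rfl]
  split_ifs <;> omega

end Inspector

/-- A basis requires bounded fan-in or not. -/
def Basis.Narrow : Basis → Prop
  | .NC => True
  | _ => False

namespace Inspector

variable {n : ℕ} (M : Inspector n)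

open Classical in
/-- The net over a given basis: for `NC` the fan-in is reduced. -/
noncomputable def finalNet (B : Basis) (wf : Prop) (r : ℕ) (hr : wf → M.Fr.depth ≤ r) : Net n :=
  if B.Narrow then (M.marking wf r hr).narrow else M.net

variable {B : Basis} {wf : Prop} {r : ℕ} (hr : wf → M.Fr.depth ≤ r)

theorem output_finalNet (x : Fin n → Bool) : (M.finalNet B wf r hr).toCircuit.output x =
    (List.range M.net.numOut).map fun j => M.value x (M.net.out j) := by
  classical
  unfold finalNet
  split_ifs
  · exact Net.Marking.output_narrow (M.value_eq x)
  · exact M.net.output_toCircuit x _ (M.value_eq x)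

theorem size_finalNet : (M.finalNet B wf r hr).size ≤ 4 ^ (5 + 2 * M.L) := by
  classical
  unfold finalNet
  split_ifs
  · exact le_of_eq (by change 4 ^ (4 + 2 * M.L + 1) = _; congr 1; omega)
  · change 16 * 4 ^ M.L ≤ _
    calc 16 * 4 ^ M.L = 4 ^ (2 + M.L) := by rw [pow_add]; norm_num
      _ ≤ _ := Nat.pow_le_pow_right (by norm_num) (by omega)

theorem numOut_finalNet : (M.finalNet B wf r hr).numOut = if M.single then 1 else 2 * 2 ^ M.L := by
  classical
  unfold finalNet
  split_ifs <;> simp_all [Net.Marking.narrow, net]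

open Classical in
/-- Reducing the fan-in costs a logarithmic term for every marked gate on a path, and there are at
most `r + 8` of these. -/
theorem depth_finalNet : (M.finalNet B wf r hr).toCircuit.depth ≤
    M.D + 8 + if B = .NC then (6 + 2 * M.L) * (r + 8) + (4 + 2 * M.L) else 0 := by
  classical
  refine Net.depth_toCircuit_le _ _ fun g _ => ?_
  unfold finalNet
  cases B with
  | NC =>
    rw [if_pos (show Basis.Narrow .NC from trivial), if_pos rfl]
    have := M.dp_narrow_le hr g
    omega
  | AC =>
    rw [if_neg (show ¬ Basis.Narrow .AC from fun h => h)]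
    exact (M.dp_le g).trans (by omega)
  | TC =>
    rw [if_neg (show ¬ Basis.Narrow .TC from fun h => h)]
    exact (M.dp_le g).trans (by omega)

theorem over_finalNet (hF : M.Fr.Over B ∨ wf ∧ M.Fr.Over .AC) (hS : ∀ w, (M.Sub w).Over B) :
    (M.finalNet B wf r hr).toCircuit.Over B := by
  classical
  unfold finalNet
  cases B with
  | NC =>
    rw [if_pos (show Basis.Narrow .NC from trivial)]
    have hF' : M.Fr.Over .AC := hF.elim (fun h => h.ac) fun h => h.2
    refine Net.Marking.over_narrow (fun g _ => M.code_ne_four hF' (fun w => (hS w).ac) g) ?_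
    exact M.exists_pair hr hF' (fun h => hF.resolve_right fun h' => h h'.1) hS
  | AC =>
    rw [if_neg (show ¬ Basis.Narrow .AC from fun h => h)]
    have hF' : M.Fr.Over .AC := hF.elim (fun h => h) fun h => h.2
    exact M.net.kind_toCircuit_ne fun g _ => M.code_ne_four hF' hS g
  | TC => trivial

end Inspector

end ParaCircuit

namespace ParaCircuit

variable {q m : ℕ}

/-! ### Case distinctions -/

theorem PB.exists_lt {l : ℕ} {P : ℕ → (ℕ → ℕ) → Prop} (hP : ∀ i < l, PB q m (P i)) :
    PB q m fun v => ∃ i < l, P i v := by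
  induction l with
  | zero => exact (PB.const False).congr fun v => by simp
  | succ l ih =>
    refine ((ih fun i hi => hP i (by omega)).or (hP l (by omega))).congr fun v => ?_
    constructor
    · rintro (⟨i, hi, h⟩ | h)
      exacts [⟨i, by omega, h⟩, ⟨l, by omega, h⟩]
    · rintro ⟨i, hi, h⟩
      rcases Nat.lt_succ_iff_lt_or_eq.1 hi with hi | rfl
      exacts [Or.inl ⟨i, hi, h⟩, Or.inr h]

/-- Case distinction by a number `T v` below a constant. -/
theorem PB.select {l : ℕ} {P : ℕ → (ℕ → ℕ) → Prop} {T : (ℕ → ℕ) → ℕ} (hT : PT q m T)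
    (hl : ∀ v, T v < l) (hP : ∀ i < l, PB q m (P i)) : PB q m fun v => P (T v) v := by
  refine (PB.exists_lt fun i hi => (PB.eq hT (PT.const i)).and (hP i hi)).congr fun v => ?_
  constructor
  · rintro ⟨i, -, rfl, h⟩
    exact h
  · exact fun h => ⟨T v, hl v, rfl, h⟩

/-- Case distinction by a number `T v` below a constant. -/
theorem PT.select {l : ℕ} {f : ℕ → (ℕ → ℕ) → ℕ} {T : (ℕ → ℕ) → ℕ} (hT : PT q m T)
    (hl : ∀ v, T v < l) (hf : ∀ i < l, PT q m (f i)) : PT q m fun v => f (T v) v := by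
  classical
  have key : ∀ k ≤ l, PT q m fun v => if T v < k then f (T v) v else 0 := by
    intro k
    induction k with
    | zero => exact fun _ => (PT.const 0).congr fun v => by simp
    | succ k ih =>
      intro hk
      refine ((PB.eq hT (PT.const k)).ite (hf k (by omega)) (ih (by omega))).congr fun v => ?_
      by_cases h : T v = k
      · rw [if_pos h, if_pos (by omega), h]
      · rw [if_neg h]
        congr 1
        exact propext (by omega)
  exact (key l le_rfl).congr fun v => if_pos (hl v)

/-- Access to a fixed string. -/
theorem PB.getD {Y : (ℕ → ℕ) → ℕ} (hY : PT q m Y) (l : List Bool) :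
    PB q m fun v => l.getD (Y v) false = true := by
  refine (PB.exists_lt (l := l.length) fun i _ =>
    (PB.eq hY (PT.const i)).and (PB.const (l.getD i false = true))).congr fun v => ?_
  constructor
  · rintro ⟨i, -, e, h⟩
    rw [e]
    exact h
  · intro h
    refine ⟨Y v, ?_, rfl, h⟩
    by_contra hlt
    rw [List.getD_eq_default _ _ (by omega)] at h
    exact absurd h (by simp)

/-! ### Tables of circuits -/

section Circuits

variable {d : (ℕ → ℕ) → ℕ}

/-- The bits of the encodings of a family of circuits are computed in logarithmic time, in the
sense of `PT`. -/
def BitPB (q m : ℕ) (C : ∀ v : ℕ → ℕ, Circuit (d v)) : Prop :=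
  ∀ i, PT q m i → PB q m fun v => (C v).bit (i v) = true

variable {C : ∀ v : ℕ → ℕ, Circuit (d v)} {a b : (ℕ → ℕ) → ℕ}

/-- The four tables of an encoding. -/
theorem Circuit.bit_table {n : ℕ} (C : Circuit n) (a b r : ℕ) (hr : r < 4) :
    C.bit (4 * interleave a b + r) = true ↔ (r = 0 ∧ a < C.size ∧ C.rcode a = b) ∨
      (r = 1 ∧ C.rwire a b) ∨ (r = 2 ∧ (C.rcode a = 0 ∨ C.rcode a = 4) ∧ C.rparam a = b) ∨
      (r = 3 ∧ C.rout a b) := by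
  rw [C.bit_iff, show (4 * interleave a b + r) % 4 = r by omega,
    show (4 * interleave a b + r) / 4 = interleave a b by omega, deinterleave_interleave]

theorem BitPB.table (hC : BitPB q m C) (ha : PT q m a) (hb : PT q m b) (r : ℕ) :
    PB q m fun v => (C v).bit (4 * interleave (a v) (b v) + r) = true :=
  hC _ (((ha.interleave hb).two_pow_mul 2).add (PT.const r))

theorem BitPB.rwire (hC : BitPB q m C) (ha : PT q m a) (hb : PT q m b) :
    PB q m fun v => (C v).rwire (a v) (b v) :=
  (hC.table ha hb 1).congr fun v => by rw [Circuit.bit_table _ _ _ _ (by norm_num)]; simp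

theorem BitPB.rparam (hC : BitPB q m C) (ha : PT q m a) (hb : PT q m b) :
    PB q m fun v => ((C v).rcode (a v) = 0 ∨ (C v).rcode (a v) = 4) ∧ (C v).rparam (a v) = b v :=
  (hC.table ha hb 2).congr fun v => by rw [Circuit.bit_table _ _ _ _ (by norm_num)]; simp

theorem BitPB.rout (hC : BitPB q m C) (ha : PT q m a) (hb : PT q m b) :
    PB q m fun v => (C v).rout (a v) (b v) :=
  (hC.table ha hb 3).congr fun v => by rw [Circuit.bit_table _ _ _ _ (by norm_num)]; simp

/-- The code of a gate is found by trying the possible values. -/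
theorem BitPB.rcode (hC : BitPB q m C) (ha : PT q m a) :
    PT q m fun v => (C v).rcode (a v) := by
  classical
  have h : ∀ b, PB q m fun v => a v < (C v).size ∧ (C v).rcode (a v) = b := fun b =>
    (hC.table ha (PT.const b) 0).congr fun v => by
      rw [Circuit.bit_table _ _ _ _ (by norm_num)]; simp
  refine ((h 0).ite (PT.const 0) ((h 1).ite (PT.const 1) ((h 2).ite (PT.const 2)
    ((h 4).ite (PT.const 4) (PT.const 3))))).congr fun v => ?_
  by_cases ha : a v < (C v).size
  · have := (C v).rcode_le (a v)
    simp only [ha, true_and]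
    split_ifs <;> omega
  · simp only [ha, false_and, if_false]
    unfold Circuit.rcode
    rw [dif_neg ha]

/-- The tables of a family of nets are computed in logarithmic time. -/
structure TablePT (q m : ℕ) (N : ∀ v : ℕ → ℕ, Net (d v)) : Prop where
  size : PT q m fun v => (N v).size
  code : ∀ g, PT q m g → PT q m fun v => (N v).code (g v)
  param : ∀ g b, PT q m g → PT q m b → PB q m fun v =>
    ((N v).code (g v) = 0 ∨ (N v).code (g v) = 4) ∧ (N v).param (g v) = b v
  wire : ∀ g h, PT q m g → PT q m h → PB q m fun v => (N v).wire (g v) (h v)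
  numOut : PT q m fun v => (N v).numOut
  out : ∀ j, PT q m j → PT q m fun v => (N v).out (j v)

/-- A family of nets whose tables are computed in logarithmic time has encodings that are computed
in logarithmic time. -/
theorem TablePT.bit {N : ∀ v : ℕ → ℕ, Net (d v)} (hN : TablePT q m N) :
    BitPB q m fun v => (N v).toCircuit := by
  intro i hi
  have hr := hi.mod_two_pow 2
  have ha := (hi.div_two_pow 2).deinterleave_fst
  have hb := (hi.div_two_pow 2).deinterleave_snd
  have hs := PB.lt ha hN.size
  refine (((PB.eq hr (PT.const 0)).and (hs.and (PB.eq (hN.code _ ha) hb))).or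
    (((PB.eq hr (PT.const 1)).and (hs.and (hN.wire _ _ ha hb))).or
    (((PB.eq hr (PT.const 2)).and (hs.and (hN.param _ _ ha hb))).or
    ((PB.eq hr (PT.const 3)).and ((PB.lt ha hN.numOut).and
      (PB.eq (hN.out _ ha) hb)))))).congr fun v => ?_
  rw [Net.bit_toCircuit]
  norm_num

end Circuits

namespace Inspector

variable {d : (ℕ → ℕ) → ℕ}

/-- The data of a family of inspectors are computed in logarithmic time. -/
structure DataPT (q m : ℕ) (yes no : List Bool) (single : Bool)
    (M : ∀ v : ℕ → ℕ, Inspector (d v)) : Prop where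
  inputs : PT q m d
  two_pow : PT q m fun v => 2 ^ (M v).L
  Fr : BitPB q m fun v => (M v).Fr
  good : ∀ w, PT q m w → PB q m fun v => (M v).good (w v)
  Sub : ∀ w, PT q m w → BitPB q m fun v => (M v).Sub (w v)
  yes : ∀ v, (M v).yes = yes
  no : ∀ v, (M v).no = no
  single : ∀ v, (M v).single = single

variable {yes no : List Bool} {single : Bool} {M : ∀ v : ℕ → ℕ, Inspector (d v)}

theorem PT.gx {g : (ℕ → ℕ) → ℕ} (hg : PT q m g) : PT q m fun v => gx (g v) :=
  (hg.div_two_pow 4).deinterleave_fst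

theorem PT.gy {g : (ℕ → ℕ) → ℕ} (hg : PT q m g) : PT q m fun v => gy (g v) :=
  (hg.div_two_pow 4).deinterleave_snd

theorem DataPT.size (hM : DataPT q m yes no single M) : PT q m fun v => (M v).net.size := by
  refine ((hM.two_pow.two_pow_size hM.two_pow).two_pow_mul 2).congr fun v => ?_
  change _ = 16 * 4 ^ (M v).L
  rw [Nat.size_pow, ← two_mul, pow_mul, pow_succ]
  ring

/-- The net of an inspector is as uniform as its data. -/
theorem DataPT.table (hM : DataPT q m yes no single M) : TablePT q m fun v => (M v).net where
  size := hM.size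
  code g hg := by
    classical
    have hx := PT.gx hg
    have hy := PT.gy hg
    refine PT.select (f := fun T v => (M v).code (gx (g v)) (gy (g v)) T) (hg.mod_two_pow 4)
      (fun v => Nat.mod_lt _ (by norm_num)) fun T hT => ?_
    have h4 := (hM.good _ hx).ite ((hM.Sub _ hx).rcode hy) (PT.const 3)
    have h5 := (hM.good _ hx).ite (PT.const 2) (PT.const 3)
    have h11 := (PB.lt hy hM.inputs).ite (PT.const 0) (PT.const 3)
    interval_cases T <;> simp only [code]
    · exact hM.Fr.rcode hy
    all_goals first | exact PT.const _ | skip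
    · exact h4.congr fun v => by congr
    · exact h5.congr fun v => by congr
    · exact h11.congr fun v => by congr
  param g b hg hb := by
    classical
    have hx := PT.gx hg
    have hy := PT.gy hg
    refine PB.select (P := fun T v => ((M v).code (gx (g v)) (gy (g v)) T = 0 ∨
      (M v).code (gx (g v)) (gy (g v)) T = 4) ∧ (M v).param (gx (g v)) (gy (g v)) T = b v)
      (hg.mod_two_pow 4) (fun v => Nat.mod_lt _ (by norm_num)) fun T hT => ?_
    have h0 := hM.Fr.rparam hy hb
    have h4 := (hM.good _ hx).and ((hM.Sub _ hx).rparam hy hb)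
    have h11 := (PB.lt hy hM.inputs).and (PB.eq hy hb)
    have h5 := PB.const (q := q) (m := m) False
    interval_cases T <;> simp only [code, param]
    · exact h0
    all_goals norm_num
    all_goals try exact h5
    · refine h4.congr fun v => ?_
      by_cases hg : (M v).good (gx (g v)) <;> simp [hg]
    · exact h5.congr fun v => by split_ifs <;> norm_num
    · refine h11.congr fun v => ?_
      by_cases hg : gy (g v) < d v <;> simp [hg]
  wire g h hg hh := by
    have hX := PT.gx hg
    have hY := PT.gy hg
    have hx := PT.gx hh
    have hy := PT.gy hh
    have ht := hh.mod_two_pow 4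
    have hs : PB q m fun v => h v < 16 * 4 ^ (M v).L := PB.lt hh hM.size
    refine hs.and ?_
    refine PB.select (P := fun T v => (M v).W (gx (g v)) (gy (g v)) T (gx (h v)) (gy (h v))
      (h v % 16)) (hg.mod_two_pow 4) (fun v => Nat.mod_lt _ (by norm_num)) fun T hT => ?_
    have t : ∀ i, PB q m fun v => h v % 16 = i := fun i => PB.eq ht (PT.const i)
    have ex := PB.eq hx hX
    have ey := PB.eq hy hY
    interval_cases T <;> simp only [W]
    · exact (t 0).and (ex.and (hM.Fr.rwire hY hy))
    · exact (t 0).and (ex.and (hM.Fr.rout hY hy))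
    · exact (t 1).and (ex.and ey)
    · exact ex.and (((t 1).and (PB.testBit hX hy)).or ((t 2).and (PB.testBit hX hy).not))
    · exact (t 4).and (ex.and ((hM.good _ hX).and ((hM.Sub _ hX).rwire hY hy)))
    · exact ex.and (((t 3).and (ey.and (hM.good _ hX))).or
        ((t 4).and ((hM.good _ hX).and ((hM.Sub _ hX).rout (PT.const 0) hy))))
    · exact t 5
    · exact (t 3).and (hM.good _ hx)
    · exact (t 6).and (ex.and ey)
    · exact (t 7).and (ex.and ey)
    · exact ((t 7).or (t 8)).and (ex.and ey)
    · exact PB.const False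
    · exact ((t 9).or (t 11)).and (ex.and ey)
    · refine ex.and (ey.and (((t 6).and ?_).or (((t 10).and ?_).or
        ((t 9).and (PB.lt hY hM.inputs)))))
      · exact (PB.lt hY (PT.const yes.length)).congr fun v => by rw [hM.yes]
      · exact (PB.lt hY (PT.const no.length)).congr fun v => by rw [hM.no]
    · refine ex.and (ey.and (((t 6).and ?_).or (((t 10).and ?_).or (t 12))))
      · exact (PB.getD hY yes).congr fun v => by rw [hM.yes]
      · exact (PB.getD hY no).congr fun v => by rw [hM.no]
    · exact PB.const False
  numOut := by
    cases single with
    | true => exact (PT.const 1).congr fun v => by simp [net, hM.single]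
    | false => exact hM.two_pow.two_mul.congr fun v => by simp [net, hM.single]
  out j hj := by
    cases single with
    | true => exact (PT.const (node 0 0 7)).congr fun v => by simp [net, hM.single]
    | false =>
      refine ((((PT.const 0).interleave hj.div_two).two_pow_mul 4).add
        ((PT.const 13).add hj.mod_two)).congr fun v => ?_
      simp [net, hM.single, node]

end Inspector

end ParaCircuit

namespace ParaCircuit

variable {q m : ℕ} {d : (ℕ → ℕ) → ℕ}

/-! ### Uniformity of the narrowed nets and of given families -/

/-- Reduction of the fan-in preserves uniformity: the trees consist of binary numbers. -/
theorem TablePT.narrow {N : ∀ v : ℕ → ℕ, Net (d v)} (hN : TablePT q m N)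
    {k : ∀ v, (N v).Marking} (hs : PT q m fun v => 2 ^ (k v).s)
    (hw : ∀ g, PT q m g → PB q m fun v => (k v).wide (g v)) :
    TablePT q m fun v => (k v).narrow := by
  have hsize : PT q m fun v => (k v).narrow.size := by
    refine (hs.two_pow_size hs).congr fun v => ?_
    change _ = 4 ^ ((k v).s + 1)
    rw [Nat.size_pow, ← two_mul, pow_mul]
    norm_num
  have hnode : ∀ g t, PT q m g → PT q m t → PB q m fun v => (k v).IsNode (g v) (t v) :=
    fun g t hg ht => (PB.lt hg hN.size).and ((PB.lt (PT.const 0) ht).and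
      ((hw g hg).or (PB.eq ht (PT.const 1))))
  refine ⟨hsize, fun g hg => ?_, fun g b hg hb => ?_, fun g h hg hh => ?_, hN.numOut,
    fun j hj => (hN.out j hj).interleave (PT.const 1)⟩
  · classical
    exact ((hnode _ _ hg.deinterleave_fst hg.deinterleave_snd).ite
      (hN.code _ hg.deinterleave_fst) (PT.const 3)).congr fun v => by
        unfold Net.Marking.narrow
        congr
  · refine ((hnode _ _ hg.deinterleave_fst hg.deinterleave_snd).and
      (hN.param _ _ hg.deinterleave_fst hb)).congr fun v => ?_
    unfold Net.Marking.narrow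
    dsimp only
    split_ifs with h <;> simp [h]
  · have hx := hg.deinterleave_fst
    have ht := hg.deinterleave_snd
    have hy := hh.deinterleave_fst
    have hu := hh.deinterleave_snd
    have hwire := hN.wire _ _ hx hy
    have hu1 := PB.eq hu (PT.const 1)
    exact (PB.lt hh hsize).and ((PB.lt hx hN.size).and
      (((hw _ hx).and (((PB.lt (PT.const 0) ht).and ((PB.lt ht hs).and ((PB.eq hy hx).and
        ((PB.eq hu ht.two_mul).or (PB.eq hu (ht.two_mul.add (PT.const 1))))))).or
        ((PB.le hs ht).and (hu1.and ((PB.eq (hs.add hy) ht).and hwire))))).or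
      ((hw _ hx).not.and ((PB.eq ht (PT.const 1)).and (hu1.and hwire)))))

theorem Inspector.DataPT.finalNet {yes no : List Bool} {single : Bool}
    {M : ∀ v : ℕ → ℕ, Inspector (d v)} (hM : DataPT q m yes no single M) (B : Basis) (wf : Prop)
    {r : (ℕ → ℕ) → ℕ} (hr : ∀ v, wf → (M v).Fr.depth ≤ r v) :
    TablePT q m fun v => (M v).finalNet B wf (r v) (hr v) := by
  classical
  unfold Inspector.finalNet
  by_cases hB : B.Narrow
  · simp only [hB, if_true]
    refine hM.table.narrow ?_ fun g hg => ?_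
    · refine ((hM.two_pow.two_pow_size hM.two_pow).two_pow_mul 2).congr fun v => ?_
      change _ = 2 ^ (4 + 2 * (M v).L)
      rw [Nat.size_pow, ← pow_add]
      congr 1
      omega
    · have ht := hg.mod_two_pow 4
      have hc := hM.table.code g hg
      exact (PB.eq ht (PT.const 4)).not.and (((PB.eq ht (PT.const 0)).imp (PB.const wf)).and
        ((PB.eq hc (PT.const 2)).or (PB.eq hc (PT.const 3))))
  · simp only [hB, if_false]
    exact hM.table

/-- A number of length `O(log a + log b)`. -/
def fuel : ℕ → ℕ → ℕ → ℕ
  | 0, _, _ => 0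
  | c + 1, a, b => 2 ^ ((2 ^ 2 * 2 ^ (a.size + b.size)).size + (fuel c a b).size)

/-- The number provides a clock for a time bound of the form that uniformity allows. -/
theorem le_size_fuel (c a b : ℕ) : c * (lg a + lg b) ≤ (fuel c a b).size := by
  induction c with
  | zero => simp
  | succ c ih =>
    have h1 := lg_le_size a
    have h2 := lg_le_size b
    rw [fuel, Nat.size_pow, ← pow_add, Nat.size_pow, Nat.succ_mul]
    omega

theorem PT.fuel {a b : (ℕ → ℕ) → ℕ} (ha : PT q m a) (hb : PT q m b) (c : ℕ) :
    PT q m fun v => fuel c (a v) (b v) := by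
  induction c with
  | zero => exact PT.const 0
  | succ c ih => exact ((ha.two_pow_size hb).two_pow_mul 2).two_pow_size ih

/-- The encodings of a uniform family of circuits are computed in logarithmic time, where the
simulation of the machine that provides the uniformity requires sufficiently many symbols. -/
theorem Uniform.exists_bitPB {C : (n : ℕ) → Circuit n} (hC : Uniform C) :
    ∃ q₀, ∀ q ≥ q₀, ∀ m (d : (ℕ → ℕ) → ℕ), PT q m d → BitPB q m fun v => C (d v) := by
  obtain ⟨M, c, hM⟩ := hC
  obtain ⟨q₀, h₀⟩ := M.exists_pb_acceptsIn
  refine ⟨q₀, fun q hq m d hd i hi => ?_⟩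
  exact ((h₀ q hq).1 m _ i d (hd.fuel hi c) hi hd).congr fun v =>
    Machine.acceptsIn_iff (hM _ _) (le_size_fuel _ _ _)

end ParaCircuit

namespace ParaCircuit

/-! ### Polynomial bounds and recognizable parameters -/

theorem lt_two_pow_lg (n : ℕ) : n < 2 ^ lg n := Nat.lt_pow_succ_log_self (by norm_num) n

/-- Polynomials are bounded by powers of two whose exponents are linear in the length of the
argument. -/
theorem mul_pow_le_two_pow {a b e : ℕ} (h : a + b ≤ e) (n : ℕ) :
    a * (n + 1) ^ b ≤ 2 ^ (e * (n.size + 1)) := by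
  have h1 : n + 1 ≤ 2 ^ (n.size + 1) :=
    (Nat.lt_size_self n).trans_le (Nat.pow_le_pow_right (by norm_num) (by omega))
  have h2 : a ≤ (2 ^ (n.size + 1)) ^ a :=
    Nat.lt_two_pow_self.le.trans (Nat.pow_le_pow_left (Nat.le_self_pow (by omega) 2) a)
  calc a * (n + 1) ^ b ≤ (2 ^ (n.size + 1)) ^ a * (2 ^ (n.size + 1)) ^ b :=
        Nat.mul_le_mul h2 (Nat.pow_le_pow_left h1 b)
    _ = 2 ^ ((a + b) * (n.size + 1)) := by rw [← pow_add, ← pow_mul, Nat.mul_comm]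
    _ ≤ _ := Nat.pow_le_pow_right (by norm_num) (Nat.mul_le_mul_right _ h)

/-- Conversely, such powers of two are polynomially bounded. -/
theorem two_pow_le_mul_pow (e n : ℕ) : 2 ^ (e * (n.size + 1)) ≤ 2 ^ (2 * e) * (n + 1) ^ e := by
  have h : 2 ^ (n.size + 1) ≤ 4 * (n + 1) := by
    rcases Nat.eq_zero_or_pos n with rfl | hn
    · norm_num
    · have h1 : 2 ^ (n.size - 1) ≤ n := Nat.lt_size.1 (by
        have := Nat.size_pos.2 hn
        omega)
      have h2 := Nat.size_pos.2 hn
      rw [show n.size + 1 = n.size - 1 + 2 by omega, pow_add]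
      omega
  calc 2 ^ (e * (n.size + 1)) = (2 ^ (n.size + 1)) ^ e := by rw [← pow_mul, Nat.mul_comm]
    _ ≤ (4 * (n + 1)) ^ e := Nat.pow_le_pow_left h e
    _ = _ := by rw [Nat.mul_pow, pow_mul]; norm_num

theorem PT.two_pow_mul_size {q m : ℕ} {d : (ℕ → ℕ) → ℕ} (hd : PT q m d) (e : ℕ) :
    PT q m fun v => 2 ^ (e * ((d v).size + 1)) := by
  induction e with
  | zero => exact (PT.const 1).congr fun v => by simp
  | succ e ih =>
    refine (ih.two_pow_size hd).congr fun v => ?_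
    rw [Nat.size_pow, Nat.succ_mul]
    congr 1
    omega

theorem le_lg_pow {n i : ℕ} (hi : i ≠ 0) : lg n ≤ lg n ^ i := Nat.le_self_pow hi _

/-- A substitute for the time-constructibility of `F`: a predicate that recognizes in logarithmic
time that `F w` is at most logarithmic in `n`, and fails to do so only for `n` bounded in terms
of `w`. -/
theorem exists_recognizer {F : ℕ → ℕ} (hF : Computable F) : ∃ good : ℕ → ℕ → Prop,
    (∃ q₀, ∀ q ≥ q₀, ∀ m (n w : (ℕ → ℕ) → ℕ), PT q m n → PT q m w →
      PB q m fun v => good (n v) (w v)) ∧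
    (∀ n w, good n w → w ≤ n ∧ 2 ^ F w ≤ n) ∧
    ∃ H : ℕ → ℕ, Computable H ∧ ∀ n w, ¬ good n w → n ≤ H w := by
  have hP : PB 0 3 fun v => 2 ^ F (v 0) ≤ v 2 :=
    PB.le (PT.param (Computable.two_pow hF) (by norm_num)) (PT.proj (by norm_num))
  obtain ⟨M, G, c, hG, hM⟩ := hP.exists_machine₃
  obtain ⟨q₀, h₀⟩ := M.exists_pb_acceptsIn
  -- `M` decides `2 ^ F w ≤ n` in time `G w + c * lg n`, up to constants; it is run for at least
  -- `(c + 1) * lg n` steps, which suffices as soon as `G w ≤ lg n`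
  refine ⟨fun n w => M.AcceptsIn (bin 0 ++ none :: bin w ++ none :: bin n)
    (fuel (c + 1) n 0).size ∧ w ≤ n, ⟨q₀, fun q hq m n w hn hw => ?_⟩, fun n w h => ?_,
    fun w => G w + 2 ^ G w + 2 ^ F w + w, ?_, fun n w h => ?_⟩
  · exact ((h₀ q hq).2 m _ _ _ _ (hn.fuel (PT.const 0) _) (PT.const 0) hw hn).and (PB.le hw hn)
  · exact ⟨h.2, by simpa [regs₃] using Machine.eq_true_of_acceptsIn (hM 0 n w) h.1⟩
  · exact Computable.natAdd (Computable.natAdd (Computable.natAdd hG (Computable.two_pow hG))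
      (Computable.two_pow hF)) Computable.id
  · by_contra! hlt
    have p1 : 0 < 2 ^ G w := by positivity
    have p2 : 0 < 2 ^ F w := by positivity
    refine h ⟨?_, by omega⟩
    have h1 := lt_two_pow_lg n
    have h2 : G w < lg n := (Nat.pow_lt_pow_iff_right (by norm_num : 1 < 2)).1 (by omega)
    have h3 := le_size_fuel (c + 1) n 0
    rw [Nat.succ_mul] at h3
    have h4 : 2 ^ F w ≤ n := by omega
    refine (Machine.acceptsIn_iff (hM 0 n w) (by omega)).2 ?_
    simpa [regs₃] using h4

theorem Circuit.over_empty (n : ℕ) (B : Basis) : (Circuit.empty n).Over B := by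
  cases B with
  | NC => exact fun g => g.elim0
  | AC => exact fun g => g.elim0
  | TC => trivial

theorem Circuit.bit_empty (n i : ℕ) : (Circuit.empty n).bit i = false := by
  rw [Bool.eq_false_iff]
  intro h
  rw [Circuit.bit_iff] at h
  rcases h with ⟨-, h, -⟩ | ⟨-, h⟩ | ⟨-, h, -⟩ | ⟨-, h⟩
  · exact absurd h (Nat.not_lt_zero _)
  · obtain ⟨g, -⟩ := h
    exact g.elim0
  · have : (Circuit.empty n).rcode (deinterleave (i / 4)).1 = 3 := dif_neg (Nat.not_lt_zero _)
    omega
  · obtain ⟨g, -⟩ := h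
    exact g.elim0

open Classical in
/-- The selected circuits of a family that is uniform up to a function `f` of the parameter, where
`good n w` implies that `f w` is at most logarithmic in `n`. -/
theorem exists_bitPB_of_good {C : (n k : ℕ) → Circuit n} {M : Machine} {f : ℕ → ℕ} {c : ℕ}
    (hM : ∀ j n k, M.OutputsBit (bin j ++ none :: bin k ++ none :: bin n) ((C n k).bit j)
      (f k + c * (lg n + lg j))) {good : ℕ → ℕ → Prop} (hf : ∀ n w, good n w → f w ≤ lg n)
    (hgood : ∃ q₀, ∀ q ≥ q₀, ∀ m (n w : (ℕ → ℕ) → ℕ), PT q m n → PT q m w →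
      PB q m fun v => good (n v) (w v)) :
    ∃ q₀, ∀ q ≥ q₀, ∀ m (n w : (ℕ → ℕ) → ℕ), PT q m n → PT q m w →
      BitPB q m fun v => if good (n v) (w v) then C (n v) (w v) else Circuit.empty (n v) := by
  obtain ⟨q₁, h₁⟩ := hgood
  obtain ⟨q₀, h₀⟩ := M.exists_pb_acceptsIn
  refine ⟨max q₀ q₁, fun q hq m n w hn hw i hi => ?_⟩
  refine ((h₁ q (le_of_max_le_right hq) m n w hn hw).and ((h₀ q (le_of_max_le_left hq)).2 m _ i w n
    (hn.fuel hi (c + 1)) hi hw hn)).congr fun v => ?_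
  dsimp only
  split_ifs with hg
  -- the additional multiple of `lg n` in the clock absorbs the time `f w`
  · have h1 := hf _ _ hg
    have h3 := le_size_fuel (c + 1) (n v) (i v)
    rw [Nat.succ_mul] at h3
    rw [Machine.acceptsIn_iff (hM _ _ _) (by omega)]
    simp [hg]
  · simp [hg, Circuit.bit_empty]

end ParaCircuit

namespace ParaCircuit

/-! ### From parameterized circuits to kernelizations -/

/-- Acceptance by a circuit with a single output. -/
theorem Circuit.forall_rout_iff {n : ℕ} {C : Circuit n} {x : Fin n → Bool} {a : Bool}
    (h : C.output x = [a]) : (∀ b, C.rout 0 b → C.rval x b = true) ↔ a = true := by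
  have ha : C.outBit x 0 = a := by simp [Circuit.outBit, h]
  have hn : C.numOut = 1 := by simpa [Circuit.output] using congrArg List.length h
  obtain ⟨b, hb⟩ := C.exists_rout (j := 0) (by omega)
  constructor
  · intro H
    rw [← ha, C.outBit_eq x hb]
    exact H b hb
  · intro H b hb
    rw [← C.outBit_eq x hb, ha, H]

open Classical in
/-- The first direction: a problem in `para-X^i` has a kernelization computed by `X^i`-circuits. -/
theorem exists_kernelization {B : Basis} {i : ℕ} (hBi : ¬ (B = Basis.NC ∧ i = 0))
    {Q : Language Bool} {κ : List Bool → ℕ} (hκ : IsParameterization κ) (h : InPara B i Q κ) :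
    ∃ K : List Bool → List Bool, IsKernelization Q κ K ∧ ComputedBy B i K := by
  obtain ⟨f, c, C, hf, hCQ, hC, T, hT⟩ := h
  obtain ⟨E, ⟨⟨b, hE⟩, hEu⟩, hEκ⟩ := hκ
  obtain ⟨good, hgood, hgf, H, hH, hgH⟩ := exists_recognizer hf
  have hflg : ∀ n w, good n w → f w ≤ lg n := fun n w hg => by
    have h1 := (hgf n w hg).2.trans_lt (lt_two_pow_lg n)
    exact ((Nat.pow_lt_pow_iff_right (by norm_num : 1 < 2)).1 h1).le
  obtain ⟨q₁, hq₁⟩ := exists_bitPB_of_good hT hflg hgood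
  obtain ⟨q₀, hq₀⟩ := hgood
  obtain ⟨q₂, hq₂⟩ := hEu.exists_bitPB
  -- fixed instances, presented according to the answer
  obtain ⟨yes, hyes⟩ : ∃ y : List Bool, (∃ x, x ∈ Q) → y ∈ Q := by
    by_cases hQ : ∃ x, x ∈ Q
    · exact ⟨hQ.choose, fun _ => hQ.choose_spec⟩
    · exact ⟨[], fun h => absurd h hQ⟩
  obtain ⟨no, hno⟩ : ∃ y : List Bool, (∃ x, x ∉ Q) → y ∉ Q := by
    by_cases hQ : ∃ x, x ∉ Q
    · exact ⟨hQ.choose, fun _ => hQ.choose_spec⟩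
    · exact ⟨[], fun h => absurd h hQ⟩
  -- `2 ^ (e * (n.size + 1))` exceeds `b * (n + 1) ^ b`, `(n + 1) ^ (c + 1)`, and the fixed
  -- instances
  obtain ⟨e, he⟩ : ∃ e, 2 * b + c + 2 + yes.length + no.length = e := ⟨_, rfl⟩
  have hL : ∀ {a d : ℕ} (n : ℕ), a + d ≤ e → a * (n + 1) ^ d ≤ 2 ^ (e * (n.size + 1)) :=
    fun n h => mul_pow_le_two_pow h n
  have hconst : ∀ {a : ℕ} (n : ℕ), a ≤ e → a ≤ 2 ^ (e * (n.size + 1)) := fun n h =>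
    (by simpa using hL (d := 0) n (by omega : _ + 0 ≤ e))
  have hn : ∀ n, n < 2 ^ (e * (n.size + 1)) := fun n =>
    Nat.lt_of_succ_le (by simpa using hL (a := 1) (d := 1) n (by omega))
  let M : ∀ n, Inspector n := fun n =>
    { Fr := E n
      L := e * (n.size + 1)
      good := good n
      Sub := fun w => if good n w then C n w else Circuit.empty n
      yes := yes
      no := no
      single := false
      D := b + (c + 1) * lg n ^ i
      size_Fr := (hE n).2.2.1.trans (hL n (by omega))
      numOut_Fr := (hE n).2.2.2.trans (hL n (by omega))
      depth_Fr := by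
        have := (hE n).2.1
        simp only [pow_zero, mul_one] at this
        omega
      size_Sub := fun w hw => by
        rw [if_pos hw]
        refine (hC n w).2.2.1.trans ?_
        refine (Nat.mul_le_mul_right _ (Nat.lt_two_pow_self.le.trans (hgf n w hw).2)).trans ?_
        refine le_trans ?_ (hL (a := 1) (d := c + 1) n (by omega))
        rw [one_mul, pow_succ, Nat.mul_comm]
        exact Nat.mul_le_mul_left _ (by omega)
      depth_Sub := fun w hw => by
        rw [if_pos hw]
        refine (hC n w).2.1.trans ?_
        split_ifs with h0
        · subst h0
          simp only [pow_zero, mul_one]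
          omega
        · have h1 := hflg n w hw
          have h2 := le_lg_pow (n := n) h0
          rw [Nat.succ_mul]
          omega
      le_n := (hn n).le
      le_yes := hconst n (by omega)
      le_no := hconst n (by omega) }
  have hr : ∀ n, True → (M n).Fr.depth ≤ b := fun n _ => by
    have := (hE n).2.1
    simpa using this
  have hdata : ∀ q, q₀ ≤ q → q₁ ≤ q → q₂ ≤ q →
      Inspector.DataPT q 3 yes no false fun v => M (v 2) := fun q h0 h1 h2 =>
    have h : PT q 3 fun v => v 2 := PT.proj (by norm_num)
    ⟨h, h.two_pow_mul_size e, hq₂ q h2 3 _ h, fun w hw => hq₀ q h0 3 _ w h hw,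
      fun w hw => hq₁ q h1 3 _ w h hw, fun _ => rfl, fun _ => rfl, fun _ => rfl⟩
  have hnum : ∀ x : List Bool, (M x.length).Fr.outNum x.get = κ x := fun x => (hEκ x).symm
  -- the inspected circuit computes the parameter of the input
  have hhit : ∀ x : List Bool, (M x.length).Hit x.get ↔ good x.length (κ x) := fun x => by
    rw [Inspector.hit_iff, hnum]
    exact ⟨fun h => h.2, fun h => ⟨((hgf _ _ h).1).trans_lt (hn _), h⟩⟩
  have hacc : ∀ x : List Bool, good x.length (κ x) →
      ((M x.length).Accepted x.get ↔ x ∈ Q) := fun x hg => by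
    rw [Inspector.accepted_iff, hhit, hnum, and_iff_right hg]
    have hsub : (M x.length).Sub (κ x) = C x.length (κ x) := if_pos hg
    rw [hsub]
    obtain ⟨a, ha, haQ⟩ := hCQ x
    rw [← haQ]
    exact Circuit.forall_rout_iff ha
  refine ⟨fun x => (M x.length).result x.get, ⟨fun x => ?_, fun k => yes.length + no.length + H k,
    ?_, fun x => ?_⟩, fun n => ((M n).finalNet B True b (hr n)).toCircuit, ⟨?_, ?_⟩, fun x => ?_⟩
  · unfold Inspector.result
    dsimp only
    by_cases hg : good x.length (κ x)
    · by_cases hQ : x ∈ Q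
      · rw [if_pos ((hacc x hg).2 hQ)]
        exact iff_of_true hQ (hyes ⟨x, hQ⟩)
      · rw [if_neg (mt (hacc x hg).1 hQ), if_pos ((hhit x).2 hg)]
        exact iff_of_false hQ (hno ⟨x, hQ⟩)
    · rw [if_neg (mt (fun h => (hhit x).1 ((M x.length).acc_imp_hit x.get h)) hg), if_neg (mt (hhit x).1 hg)]
      simp
  · exact Computable.natAdd (Computable.const _) hH
  · unfold Inspector.result
    dsimp only
    split_ifs with h1 h2
    · change yes.length ≤ _
      omega
    · change no.length ≤ _
      omega
    · have := hgH _ _ (mt (hhit x).2 h2)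
      simp only [List.length_ofFn]
      omega
  · have h3 : ∀ n : ℕ, 4 ^ (5 + 2 * (e * (n.size + 1))) ≤
        2 ^ (10 + 8 * e) * (n + 1) ^ (4 * e) := fun n => by
      have := two_pow_le_mul_pow (4 * e) n
      calc 4 ^ (5 + 2 * (e * (n.size + 1))) = 2 ^ 10 * 2 ^ (4 * e * (n.size + 1)) := by
            rw [show 4 = 2 ^ 2 by norm_num, ← pow_mul, ← pow_add]
            congr 1
            ring
        _ ≤ 2 ^ 10 * (2 ^ (2 * (4 * e)) * (n + 1) ^ (4 * e)) := Nat.mul_le_mul_left _ this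
        _ = _ := by rw [pow_add, ← mul_assoc]; congr 3; ring
    -- a single constant for size and depth
    obtain ⟨a, ha⟩ : ∃ a, 2 ^ (10 + 8 * e) + 4 * e + b + c + 13 + (6 + 4 * e) * (b + 8) + 4 = a :=
      ⟨_, rfl⟩
    have hpos : 0 < 2 ^ (10 + 8 * e) := by positivity
    have h4 : ∀ n : ℕ, 4 ^ (5 + 2 * (e * (n.size + 1))) ≤ a * (n + 1) ^ a := fun n =>
      (h3 n).trans (Nat.mul_le_mul (by omega) (Nat.pow_le_pow_right (by omega) (by omega)))
    refine ⟨a, fun n => ⟨?_, ?_, ?_, ?_⟩⟩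
    · refine (M n).over_finalNet (hr n) (Or.inr ⟨trivial, (hE n).1⟩) fun w => ?_
      change (if good n w then C n w else Circuit.empty n).Over B
      split_ifs
      · exact (hC n w).1
      · exact Circuit.over_empty n B
    · refine ((M n).depth_finalNet (hr n)).trans ?_
      change b + (c + 1) * lg n ^ i + 8 + (if B = .NC then
        (6 + 2 * (e * (n.size + 1))) * (b + 8) + (4 + 2 * (e * (n.size + 1))) else 0) ≤ _
      have hp : 0 < lg n ^ i := Nat.pow_pos (lg_pos n)
      split_ifs with hB
      -- the binary trees have depth `O(log n)`, which requires `i ≠ 0`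
      · have h0 : i ≠ 0 := fun h => hBi ⟨hB, h⟩
        have h1 := le_lg_pow (n := n) h0
        have h2 := size_le_lg n
        have h5 : n.size + 1 ≤ 2 * lg n ^ i := by omega
        have h6 : e * (n.size + 1) ≤ 2 * e * lg n ^ i := by
          calc _ ≤ e * (2 * lg n ^ i) := Nat.mul_le_mul_left _ h5
            _ = _ := by ring
        calc _ ≤ b * lg n ^ i + (c + 1) * lg n ^ i + 8 * lg n ^ i +
              ((6 * lg n ^ i + 2 * (2 * e * lg n ^ i)) * (b + 8) +
                (4 * lg n ^ i + 2 * (2 * e * lg n ^ i))) := by gcongr <;> nlinarith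
          _ = (b + c + 13 + (6 + 4 * e) * (b + 8) + 4 * e) * lg n ^ i := by ring
          _ ≤ _ := Nat.mul_le_mul_right _ (by omega)
      · calc _ ≤ b * lg n ^ i + (c + 1) * lg n ^ i + 8 * lg n ^ i := by nlinarith
          _ = (b + c + 9) * lg n ^ i := by ring
          _ ≤ _ := Nat.mul_le_mul_right _ (by omega)
    · exact ((M n).size_finalNet (hr n)).trans (h4 n)
    · refine ((M n).numOut_finalNet (hr n)).trans_le (le_trans ?_ (h4 n))
      change 2 * 2 ^ (e * (n.size + 1)) ≤ _
      rw [show 4 = 2 ^ 2 by norm_num, ← pow_mul, ← pow_succ']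
      exact Nat.pow_le_pow_right (by norm_num) (by omega)
  · obtain ⟨T', c', hT'⟩ := (((hdata (max q₀ (max q₁ q₂)) (by omega) (by omega) (by omega)).finalNet
      B True (r := fun _ => b) fun v => hr (v 2)).bit _ (PT.proj (i := 1) (by norm_num))).exists_machine₂
    refine ⟨T', c', fun j n => ?_⟩
    have h := hT' j n
    dsimp only at h
    simp only [Bool.decide_eq_true] at h
    exact h
  · change Presents (((M x.length).finalNet B True b (hr _)).toCircuit.output x.get) _
    rw [Inspector.output_finalNet]
    exact (M x.length).map_value_out x.get rfl

end ParaCircuit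

namespace ParaCircuit

/-! ### From kernelizations to parameterized circuits -/

/-- The number whose binary digits present the string `y`. -/
def presentNum : List Bool → ℕ
  | [] => 0
  | b :: y => 1 + 2 * b.toNat + 4 * presentNum y

/-- The zeros that fill up a presentation do not change the number. -/
theorem Presents.ofDigits {o y : List Bool} (h : Presents o y) :
    Nat.ofDigits 2 (o.map Bool.toNat) = presentNum y := by
  obtain ⟨r, rfl⟩ := h
  induction y with
  | nil =>
    induction r with
    | zero => rfl
    | succ r ih => simp [List.replicate_succ, Nat.ofDigits_cons, presentNum]
  | cons b y ih =>
    simp only [List.flatMap_cons, List.cons_append, List.nil_append, List.map_cons,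
      Nat.ofDigits_cons, presentNum, ← ih]
    simp
    ring

theorem presentNum_lt (y : List Bool) : presentNum y < 4 ^ y.length := by
  induction y with
  | nil => simp [presentNum]
  | cons b y ih =>
    have := b.toNat_le
    rw [presentNum, List.length_cons, pow_succ]
    omega

/-- Reads one bit of a presented string. -/
def decodeStep (p : List Bool × ℕ) : List Bool × ℕ :=
  if p.2 = 0 then p else (p.1 ++ [decide (p.2 / 2 % 2 = 1)], p.2 / 4)

/-- The string presented by the binary digits of a number. -/
def decode (w : ℕ) : List Bool := (decodeStep^[w] ([], w)).1

/-- Reading `t` bits reads the whole string if it is no longer than `t`; further steps are idle. -/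
theorem decodeStep_iterate (y l : List Bool) (t : ℕ) (ht : y.length ≤ t) :
    decodeStep^[t] (l, presentNum y) = (l ++ y, 0) := by
  induction y generalizing l t with
  | nil =>
    rw [List.append_nil]
    exact Function.iterate_fixed (by simp [decodeStep, presentNum]) t
  | cons b y ih =>
    obtain ⟨t, rfl⟩ : ∃ s, t = s + 1 := ⟨t - 1, by simp at ht; omega⟩
    have h1 : presentNum (b :: y) / 4 = presentNum y := by
      have := b.toNat_le
      rw [presentNum]; omega
    have h2 : decide (presentNum (b :: y) / 2 % 2 = 1) = b := by
      rw [presentNum]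
      cases b <;> simp <;> omega
    have h3 : presentNum (b :: y) ≠ 0 := by rw [presentNum]; omega
    rw [Function.iterate_succ_apply, decodeStep, if_neg h3, h1, h2,
      ih _ _ (by simpa using ht), List.append_assoc]
    rfl

theorem length_le_presentNum (y : List Bool) : y.length ≤ presentNum y := by
  induction y with
  | nil => simp
  | cons b y ih => rw [presentNum, List.length_cons]; omega

theorem decode_presentNum (y : List Bool) : decode (presentNum y) = y := by
  rw [decode, decodeStep_iterate _ _ _ (length_le_presentNum y)]
  rfl

theorem primrec_decode : Primrec decode := by
  have hstep : Primrec decodeStep := by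
    refine Primrec.ite (Primrec.eq.comp Primrec.snd (Primrec.const 0)) Primrec.id
      (Primrec.pair (Primrec.list_concat.comp Primrec.fst ?_)
        (Primrec.nat_div.comp Primrec.snd (Primrec.const 4)))
    exact (Primrec.eq.comp (Primrec.nat_mod.comp
      (Primrec.nat_div.comp Primrec.snd (Primrec.const 2)) (Primrec.const 2))
      (Primrec.const 1)).decide
  exact Primrec.fst.comp (Primrec.nat_iterate Primrec.id
    (Primrec.pair (Primrec.const []) Primrec.id) (hstep.comp Primrec.snd).to₂)

/-- Membership of the decoded string is decidable for numbers below a bound in terms of the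
parameter, with no dependence of the time on the input length other than a linear one. -/
theorem PB.decode_mem {q m : ℕ} {Q : Language Bool}
    (hQ : ComputablePred fun x : List Bool => x ∈ Q) {F : ℕ → ℕ} (hF : Computable F)
    {w : (ℕ → ℕ) → ℕ} (hw : PT q m w) (hm : 0 < m) :
    PB q m fun v => w v < 4 ^ F (v 0) ∧ decode (w v) ∈ Q := by
  classical
  obtain ⟨_, hQ⟩ := hQ
  have hb : Computable fun k => 2 ^ (F k + F k) := Computable.two_pow (Computable.natAdd hF hF)
  have hc : Computable₂ fun _ w : ℕ => if decode w ∈ Q then 1 else 0 := by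
    refine ((Computable.cond (hQ.comp primrec_decode.to_comp) (Computable.const 1)
      (Computable.const 0)).comp Computable.snd).of_eq fun p => ?_
    by_cases h : decode p.2 ∈ Q <;> simp [h]
  refine (PT.guard hb hc hw hm).congr fun v => ?_
  have h4 : 4 ^ F (v 0) = 2 ^ (F (v 0) + F (v 0)) := by
    rw [← two_mul, pow_mul]
    norm_num
  simp only [h4]
  by_cases h1 : w v < 2 ^ (F (v 0) + F (v 0)) <;> by_cases h2 : decode (w v) ∈ Q <;> simp [h1, h2]

open Classical in
/-- The second direction: a problem that has a kernelization computed by `X^i`-circuits is in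
`para-X^i`. -/
theorem inPara_of_kernelization {B : Basis} {i : ℕ} (hBi : ¬ (B = Basis.NC ∧ i = 0))
    {Q : Language Bool} {κ : List Bool → ℕ} (hQ : ComputablePred fun x : List Bool => x ∈ Q)
    {K : List Bool → List Bool} (hK : IsKernelization Q κ K) (hC : ComputedBy B i K) :
    InPara B i Q κ := by
  obtain ⟨hKQ, F, hF, hKF⟩ := hK
  obtain ⟨E, ⟨⟨b, hE⟩, hEu⟩, hEK⟩ := hC
  obtain ⟨q, hq⟩ := hEu.exists_bitPB
  obtain ⟨e, he⟩ : ∃ e, 2 * b + 2 = e := ⟨_, rfl⟩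
  -- the range has to contain the kernel circuit and the numbers presenting strings of length `F k`
  let L : ℕ → ℕ → ℕ := fun n k => e * (n.size + 1) + 2 * F k + 2
  have hL : ∀ {a d : ℕ} (n k : ℕ), a + d ≤ e → a * (n + 1) ^ d ≤ 2 ^ L n k :=
    fun n k h => (mul_pow_le_two_pow h n).trans (Nat.pow_le_pow_right (by norm_num)
      (by change _ ≤ e * (n.size + 1) + 2 * F k + 2; omega))
  let M : ∀ n k : ℕ, Inspector n := fun n k =>
    { Fr := E n
      L := L n k
      good := fun w => w < 4 ^ F k ∧ decode w ∈ Q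
      Sub := fun _ => Circuit.empty n
      yes := []
      no := []
      single := true
      D := b * lg n ^ i
      size_Fr := (hE n).2.2.1.trans (hL n k (by omega))
      numOut_Fr := (hE n).2.2.2.trans (hL n k (by omega))
      depth_Fr := (hE n).2.1
      size_Sub := fun _ _ => Nat.zero_le _
      depth_Sub := fun _ _ => by simp [Circuit.depth, Circuit.empty]
      le_n := by
        have := hL (a := 1) (d := 1) n k (by omega)
        rw [one_mul, pow_one] at this
        omega
      le_yes := Nat.zero_le _
      le_no := Nat.zero_le _ }
  -- the kernel circuit is over the basis itself, so that none of its gates has to be narrowed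
  have hr : ∀ n k, False → (M n k).Fr.depth ≤ 0 := fun _ _ h => h.elim
  have hdata : Inspector.DataPT q 3 [] [] true fun v => M (v 2) (v 0) := by
    have h : PT q 3 fun v => v 2 := PT.proj (by norm_num)
    refine ⟨h, ?_, hq q le_rfl 3 _ h, fun w hw => PB.decode_mem hQ hF hw (by norm_num),
      fun w hw i hi => (PB.const False).congr fun v => ?_, fun _ => rfl, fun _ => rfl, fun _ => rfl⟩
    · have hp : PT q 3 fun v => 2 ^ (F (v 0) + F (v 0)) :=
        PT.param (Computable.two_pow (Computable.natAdd hF hF)) (by norm_num)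
      refine ((h.two_pow_mul_size e).two_pow_size hp).congr fun v => ?_
      change _ = 2 ^ (e * ((v 2).size + 1) + 2 * F (v 0) + 2)
      rw [Nat.size_pow, Nat.size_pow]
      congr 1
      omega
    · change False ↔ (Circuit.empty (v 2)).bit (i v) = true
      simp [Circuit.bit_empty]
  have hhit : ∀ x : List Bool, (M x.length (κ x)).Hit x.get ↔ x ∈ Q := fun x => by
    have hnum : (M x.length (κ x)).Fr.outNum x.get = presentNum (K x) := (hEK x).ofDigits
    have h1 : presentNum (K x) < 4 ^ F (κ x) :=
      (presentNum_lt _).trans_le (Nat.pow_le_pow_right (by norm_num) (hKF x))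
    have h2 : 4 ^ F (κ x) ≤ 2 ^ L x.length (κ x) := by
      rw [show 4 = 2 ^ 2 by norm_num, ← pow_mul]
      exact Nat.pow_le_pow_right (by norm_num)
        (by change _ ≤ e * (x.length.size + 1) + 2 * F (κ x) + 2; omega)
    rw [Inspector.hit_iff, hnum, hKQ x]
    constructor
    · rintro ⟨-, -, h⟩
      rwa [decode_presentNum] at h
    · intro h
      refine ⟨h1.trans_le h2, h1, ?_⟩
      rwa [decode_presentNum]
  obtain ⟨T, G, c, hG, hT⟩ := ((hdata.finalNet B False (r := fun _ => 0)
    fun v => hr (v 2) (v 0)).bit _ (PT.proj (i := 1) (by norm_num))).exists_machine₃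
  obtain ⟨a, ha⟩ : ∃ a, c + b + 40 * e + 8 = a := ⟨_, rfl⟩
  have hpos : ∀ k, 0 < 2 ^ (18 + 8 * F k + 8 * e) := fun k => by positivity
  refine ⟨fun k => G k + (36 * F k + 96) + 2 ^ (18 + 8 * F k + 8 * e), a,
    fun n k => ((M n k).finalNet B False 0 (hr n k)).toCircuit, ?_, fun x => ?_,
    fun n k => ⟨?_, ?_, ?_, ?_⟩, T, fun j n k => ?_⟩
  · have h8 : Computable fun k => 8 * F k := Computable.natMul (Computable.const 8) hF
    have h36 : Computable fun k => 36 * F k := Computable.natMul (Computable.const 36) hF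
    exact Computable.natAdd (Computable.natAdd hG (Computable.natAdd h36 (Computable.const 96)))
      (Computable.two_pow (Computable.natAdd (Computable.natAdd (Computable.const 18) h8)
        (Computable.const _)))
  · refine ⟨decide ((M x.length (κ x)).Hit x.get), ?_, by rw [decide_eq_true_eq, hhit]⟩
    rw [Inspector.output_finalNet]
    exact (M x.length (κ x)).map_value_out_single x.get rfl
  · exact (M n k).over_finalNet (hr n k) (Or.inl (hE n).1) fun _ => Circuit.over_empty n B
  · refine ((M n k).depth_finalNet (hr n k)).trans ?_
    change b * lg n ^ i + 8 + (if B = .NC then (6 + 2 * (e * (n.size + 1) + 2 * F k + 2)) * (0 + 8) +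
      (4 + 2 * (e * (n.size + 1) + 2 * F k + 2)) else 0) ≤ _
    dsimp only
    have hp := hpos k
    split_ifs with hB h0 h0
    · exact absurd ⟨hB, h0⟩ hBi
    · have h1 := le_lg_pow (n := n) h0
      have h2 := size_le_lg n
      have h3 := lg_pos n
      have h6 : e * (n.size + 1) ≤ 2 * e * lg n ^ i := by
        calc _ ≤ e * (2 * lg n ^ i) := Nat.mul_le_mul_left _ (by omega)
          _ = _ := by ring
      have h7 : (b + 36 * e) * lg n ^ i ≤ a * lg n ^ i := Nat.mul_le_mul_right _ (by omega)
      rw [Nat.add_mul, show 36 * e * lg n ^ i = 18 * (2 * e * lg n ^ i) by ring] at h7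
      omega
    · rw [h0, pow_zero]
      omega
    · have h7 : b * lg n ^ i ≤ a * lg n ^ i := Nat.mul_le_mul_right _ (by omega)
      omega
  · refine ((M n k).size_finalNet (hr n k)).trans ?_
    have := two_pow_le_mul_pow (4 * e) n
    calc 4 ^ (5 + 2 * (e * (n.size + 1) + 2 * F k + 2))
        = 2 ^ (18 + 8 * F k) * 2 ^ (4 * e * (n.size + 1)) := by
          rw [show 4 = 2 ^ 2 by norm_num, ← pow_mul, ← pow_add]
          congr 1
          ring
      _ ≤ 2 ^ (18 + 8 * F k) * (2 ^ (2 * (4 * e)) * (n + 1) ^ (4 * e)) :=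
          Nat.mul_le_mul_left _ this
      _ = 2 ^ (18 + 8 * F k + 8 * e) * (n + 1) ^ (4 * e) := by
          rw [← mul_assoc, ← pow_add]
          congr 3
          ring
      _ ≤ _ := Nat.mul_le_mul (Nat.le_add_left _ _)
          (Nat.pow_le_pow_right (by omega) (by omega))
  · exact (M n k).numOut_finalNet (hr n k)
  · have h := hT j n k
    dsimp only at h
    simp only [Bool.decide_eq_true] at h
    refine h.mono ?_
    have : c * (lg n + lg j) ≤ a * (lg n + lg j) := Nat.mul_le_mul_right _ (by omega)
    dsimp only
    have hp := hpos k
    omega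

end ParaCircuit

theorem theorem1 (B : ParaCircuit.Basis) (i : ℕ) (hBi : ¬ (B = ParaCircuit.Basis.NC ∧ i = 0))
    (Q : Language Bool) (κ : List Bool → ℕ)
    (hκ : ParaCircuit.IsParameterization κ)
    (hQ : ComputablePred (fun x : List Bool => x ∈ Q)) :
    ParaCircuit.InPara B i Q κ ↔
      ∃ K : List Bool → List Bool,
        ParaCircuit.IsKernelization Q κ K ∧ ParaCircuit.ComputedBy B i K :=
  ⟨ParaCircuit.exists_kernelization hBi hκ,
    fun ⟨_, hK, hC⟩ => ParaCircuit.inPara_of_kernelization hBi hQ hK hC⟩
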